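/- **Setting.** Let $h_i>0$ ($i\ge 1$), $h_i\to0$, and for even $i\ge2$ let $0<\delta_i<\min\{h_{i-1},h_{i+1}\}$. The Rooms and Passages domain $\Omega\subset\mathbb R^2$ is the union of open square rooms $R_i$ ($i$ odd) of size $h_i\times h_i$ and rectangular passages $P_i$ ($i$ even) of length $h_i$ and width $\delta_i$, placed one after the other from left to right, $R_1,P_2,R_3,P_4,\dots$, all symmetric about the $x$-axis, each passage being open at its two ends. For $x\in\Omega$ the near points of $x$ are the points of $\partial\Omega$ nearest to $x$; the skeleton $\Gamma$ is the set of points of $\Omega$ with more than one near point, and $\tau:\Omega\to\Gamma$ maps $x$ to the point $t\in\Gamma$ such that $x$ lies on a segment joining $t$ to one of its near points ($\tau$ is defined off a null set at least). Up to endpoints, $\Gamma$ is the union of countably many edges $e$ (straight segments and parabolic arcs): the central line of each passage; a horizontal segment in the centre of each room; in each room four segments of the diagonals emanating from the corners; and, at each end of each passage, a horizontal segment which begins at the end of the passage and two parabolic arcs. The edges of the last kind, whose points have a re-entrant corner of $\Omega$ as a near point, are called singular ($\Gamma_{\rm sing}$), all others regular ($\Gamma_{\rm reg}$). Let $\sigma$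 be arc length on the edges, let $s$ be the distance from $t(\sigma)$ along the two segments joining $t(\sigma)$ to its two near points (with a minus sign on one of them), let $l(\sigma)$ be their common length, $|\nabla\tau|=(|\nabla\tau_1|^2+|\nabla\tau_2|^2)^{1/2}$, and $$\alpha(\sigma)=\int_{-l(\sigma)}^{l(\sigma)}\frac{ds}{|\nabla\tau(\sigma,s)|},\qquad \beta(\sigma)=\int_{-l(\sigma)}^{l(\sigma)}|\nabla\tau(\sigma,s)|\,ds .$$ Put $$\widetilde L^2(\Gamma)=\bigoplus_{e\in\Gamma_{\rm reg}}L^2(e;\alpha\,d\sigma)\oplus\bigoplus_{e\in\Gamma_{\rm sing}}\mathbb C\mathbf 1_e,\qquad \widetilde H^1(\Gamma)=\bigoplus_{e\in\Gamma_{\rm reg}}H^1(e;\alpha,\beta)\oplus\bigoplus_{e\in\Gamma_{\rm sing}}\mathbb C\mathbf 1_e$$ (Hilbert sums), where $\mathbf 1_e$ is normed as an element of $L^2(e;\alpha\,d\sigma)$ and $H^1(e;\alpha,\beta)$ has the inner product $\int_e(f'\overline{g'}\beta+f\overline g\,\alpha)\,d\sigma$. Let $H_\Gamma$ be the operator in $\widetilde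 L^2(\Gamma)$ such that $H_\Gamma+I$ is the self-adjoint operator associated with the inner product of $\widetilde H^1(\Gamma)$. Let $\hat H^1(\Omega)=\bigoplus_{e}H^1(\tau^{-1}(e))$, let $E_1$ be its natural embedding into $\bigoplus_eL^2(\tau^{-1}(e))=L^2(\Omega)$, let $H_\Omega=\bigoplus_e(-\Delta_{N,\tau^{-1}(e)})$ be the operator such that $H_\Omega+I$ is the self-adjoint operator associated with the inner product of $\hat H^1(\Omega)$, and let $T_1:\widetilde H^1(\Gamma)\to\hat H^1(\Omega)$, $T_1f=f\circ\tau$ (this is a well-defined bounded operator). **Theorem.** For every Rooms and Passages domain $\Omega$: 1. $(H_\Gamma+I)^{-1}$ is a bounded operator on $\widetilde L^2(\Gamma)$ which is not compact, and $0\in\sigma_{\rm ess}(H_\Gamma)$. In fact $0$ is an eigenvalue of $H_\Gamma$ of infinite multiplicity: the elements of $\widetilde L^2(\Gamma)$ that vanish on all regular edges form an infinite-dimensional subspace of the null space of $H_\Gamma$. 2. $E_1$ is not compact, and $0\in\sigma_{\rm ess}(H_\Omega)$. 3. If $E_1(T_1T_1^*-I):\hat H^1(\Omega)\to L^2(\Omega)$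 is compact, then $\sigma_{\rm ess}(H_\Omega)\subseteq\sigma_{\rm ess}(H_\Gamma)$. -/

import Mathlib

open Set Filter Topology MeasureTheory
open scoped ContDiff InnerProductSpace

noncomputable section

namespace RP

/-! ### Forms, operators, essential spectrum -/

section Operators

variable {V H : Type*} [NormedAddCommGroup V] [InnerProductSpace ℂ V]
  [NormedAddCommGroup H] [InnerProductSpace ℂ H]

/-- Pairs `(u, f)` such that `u` is (the image under `J` of) an element `v` of the form domain `V`
and `⟪w, v⟫_V = ⟪J w, f + u⟫_H` for all `w ∈ V`. -/
def formGraph (J : V →L[ℂ] H) : Submodule ℂ (H × H) where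
  carrier := {p | ∃ v : V, J v = p.1 ∧ ∀ w : V, ⟪w, v⟫_ℂ = ⟪J w, p.2 + p.1⟫_ℂ}
  zero_mem' := ⟨0, by simp, by simp⟩
  add_mem' := by
    rintro p q ⟨v, hv, hv'⟩ ⟨w, hw, hw'⟩
    refine ⟨v + w, by simp [hv, hw], fun z => ?_⟩
    rw [inner_add_right, hv' z, hw' z, ← inner_add_right]
    congr 1
    simp only [Prod.fst_add, Prod.snd_add]
    abel
  smul_mem' := by
    rintro c p ⟨v, hv, hv'⟩
    refine ⟨c • v, by simp [hv], fun z => ?_⟩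
    rw [inner_smul_right, hv' z, ← inner_smul_right, smul_add]
    rfl

/-- The operator `A` in `H` such that `A + I` is the operator associated with the inner product
of `V`, where `V` is regarded as a subspace of `H` by means of the embedding `J`. -/
def formOperator (J : V →L[ℂ] H) : H →ₗ.[ℂ] H := (formGraph J).toLinearPMap

/-- The essential spectrum of a self-adjoint operator, by means of singular sequences. -/
def essSpectrum (A : H →ₗ.[ℂ] H) : Set ℂ :=
  {z | ∃ u : ℕ → A.domain, (∀ n, ‖(u n : H)‖ = 1) ∧
    (∀ v : H, Tendsto (fun n => ⟪v, (u n : H)⟫_ℂ) atTop (𝓝 0)) ∧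
    Tendsto (fun n => A (u n) - z • (u n : H)) atTop (𝓝 0)}

/-- The bounded operator `R` is the inverse `(A + I)⁻¹`. -/
def IsInverseOfAddOne (A : H →ₗ.[ℂ] H) (R : H →L[ℂ] H) : Prop :=
  (∀ u : A.domain, R (A u + u) = u) ∧ ∀ f : H, ∃ u : A.domain, (u : H) = R f ∧ A u + u = f

/-- The null space of `A`, as a subspace of `H`. -/
def nullSpace (A : H →ₗ.[ℂ] H) : Submodule ℂ H :=
  (LinearMap.ker A.toFun).map A.domain.subtype

end Operators

/-- The map between Hilbert sums given by a family of contractions. -/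
def sumMap {ι : Type*} {V W : ι → Type*}
    [∀ i, NormedAddCommGroup (V i)] [∀ i, InnerProductSpace ℂ (V i)]
    [∀ i, NormedAddCommGroup (W i)] [∀ i, InnerProductSpace ℂ (W i)]
    (J : ∀ i, V i →ₗ[ℂ] W i) (hJ : ∀ i v, ‖J i v‖ ≤ ‖v‖) : lp V 2 →L[ℂ] lp W 2 :=
  LinearMap.mkContinuous
    { toFun := fun f => ⟨fun i => J i (f i), (lp.memℓp f).mono' fun i => hJ i (f i)⟩
      map_add' := fun f g => by ext i; exact map_add (J i) (f i) (g i)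
      map_smul' := fun c f => by ext i; exact map_smul (J i) c (f i) } 1
    (fun f => by
      rw [one_mul]
      exact lp.norm_mono (by norm_num) fun i => hJ i (f i))

/-! ### The Sobolev space `H¹(U)` of an open subset of the plane -/

/-- The Euclidean plane. -/
abbrev Plane : Type := EuclideanSpace ℝ (Fin 2)

/-- `L²(U)`. -/
abbrev L2 (U : Set Plane) : Type := Lp ℂ 2 (volume.restrict U)

theorem integrable_test_smul {U : Set Plane} (f : L2 U) {ψ : Plane → ℝ} (hψ : Continuous ψ)
    (hc : HasCompactSupport ψ) : Integrable (fun x => ψ x • f x) (volume.restrict U) := by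
  have h : MemLp ψ 2 (volume.restrict U) := hψ.memLp_of_hasCompactSupport hc
  exact memLp_one_iff_integrable.1 (MemLp.smul (p := 2) (q := 2) (r := 1) (Lp.memLp f) h)

/-- `H¹(U)`: the pairs `(f, (g₀, g₁))` with `f, g₀, g₁ ∈ L²(U)`, where `(g₀, g₁)` is the weak
gradient of `f`. The inner product is `∫ (∇f · conj ∇g + f conj g)`. -/
def H1 (U : Set Plane) : Submodule ℂ (WithLp 2 (L2 U × PiLp 2 fun _ : Fin 2 => L2 U)) where
  carrier := {p | ∀ φ : Plane → ℝ, ContDiff ℝ ∞ φ → HasCompactSupport φ → tsupport φ ⊆ U →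
    ∀ i : Fin 2, ∫ x in U, (fderiv ℝ φ x (EuclideanSpace.single i 1)) • p.fst x =
      -∫ x in U, φ x • p.snd i x}
  zero_mem' := by
    intro φ _ _ _ i
    have h0 : (∫ x in U, (fderiv ℝ φ x (EuclideanSpace.single i 1)) • (0 : L2 U) x) = 0 := by
      rw [integral_eq_zero_of_ae]
      filter_upwards [Lp.coeFn_zero ℂ 2 (volume.restrict U)] with x hx
      rw [hx]; simp
    have h1 : (∫ x in U, φ x • (0 : L2 U) x) = 0 := by
      rw [integral_eq_zero_of_ae]
      filter_upwards [Lp.coeFn_zero ℂ 2 (volume.restrict U)] with x hx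
      rw [hx]; simp
    simp only [WithLp.zero_fst, WithLp.zero_snd, PiLp.zero_apply]
    rw [h0, h1, neg_zero]
  add_mem' := by
    intro p q hp hq φ hφ hc hU i
    have hd : Continuous fun x => fderiv ℝ φ x (EuclideanSpace.single i 1) :=
      (hφ.continuous_fderiv (by simp)).clm_apply continuous_const
    have hdc : HasCompactSupport fun x => fderiv ℝ φ x (EuclideanSpace.single i 1) :=
      hc.fderiv_apply ℝ _
    have key : ∀ (ψ : Plane → ℝ), Continuous ψ → HasCompactSupport ψ → ∀ f g : L2 U,
        ∫ x in U, ψ x • (f + g) x = (∫ x in U, ψ x • f x) + ∫ x in U, ψ x • g x := by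
      intro ψ h1 h2 f g
      rw [← integral_add (integrable_test_smul f h1 h2) (integrable_test_smul g h1 h2)]
      apply integral_congr_ae
      filter_upwards [Lp.coeFn_add f g] with x hx
      rw [hx, Pi.add_apply, smul_add]
    simp only [WithLp.add_fst, WithLp.add_snd, PiLp.add_apply]
    rw [key _ hd hdc, key _ hφ.continuous hc, hp φ hφ hc hU i, hq φ hφ hc hU i]
    ring
  smul_mem' := by
    intro c p hp φ hφ hc hU i
    have key : ∀ (ψ : Plane → ℝ) (f : L2 U),
        ∫ x in U, ψ x • (c • f) x = c • ∫ x in U, ψ x • f x := by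
      intro ψ f
      rw [← integral_smul]
      apply integral_congr_ae
      filter_upwards [Lp.coeFn_smul c f] with x hx
      simp only [hx, Pi.smul_apply]
      exact smul_comm _ _ _
    simp only [WithLp.smul_fst, WithLp.smul_snd, PiLp.smul_apply]
    rw [key, key, hp φ hφ hc hU i, smul_neg]

/-- The embedding `H¹(U) → L²(U)`. -/
def H1.toL2 (U : Set Plane) : H1 U →ₗ[ℂ] L2 U where
  toFun p := p.1.fst
  map_add' _ _ := rfl
  map_smul' _ _ := rfl

theorem norm_fst_le_norm {A B : Type*} [NormedAddCommGroup A] [NormedAddCommGroup B]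
    (p : WithLp 2 (A × B)) : ‖p.fst‖ ≤ ‖p‖ := by
  have h := WithLp.prod_norm_sq_eq_of_L2 p
  nlinarith [norm_nonneg p, norm_nonneg p.fst, sq_nonneg ‖p.snd‖]

theorem H1.norm_toL2_le (U : Set Plane) (p : H1 U) : ‖H1.toL2 U p‖ ≤ ‖p‖ :=
  norm_fst_le_norm p.1

/-! ### Near points, the skeleton, and the projection onto it -/

/-- The points of the boundary of `Ω` nearest to `x`. -/
def nearPoints (Ω : Set Plane) (x : Plane) : Set Plane :=
  {y ∈ frontier Ω | dist x y = Metric.infDist x (frontier Ω)}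

/-- The skeleton: the points of `Ω` with more than one near point. -/
def skeleton (Ω : Set Plane) : Set Plane := {x ∈ Ω | (nearPoints Ω x).Nontrivial}

open Classical in
/-- The map `τ : Ω → Γ`: `τ x` is the point `t` of the skeleton such that `x` lies on a segment
joining `t` to one of its near points (and `τ x = x` if there is none). -/
def tau (Ω : Set Plane) (x : Plane) : Plane :=
  if h : ∃ t ∈ skeleton Ω, ∃ y ∈ nearPoints Ω t, x ∈ segment ℝ t y then h.choose else x

/-- `|∇τ| = (|∇τ₁|² + |∇τ₂|²)^{1/2}`. -/
def gradTau (Ω : Set Plane) (x : Plane) : ℝ :=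
  √(‖gradient (fun z => tau Ω z 0) x‖ ^ 2 + ‖gradient (fun z => tau Ω z 1) x‖ ^ 2)

/-- The integral of `F` along the segments joining `t` to its near points, with respect to the
distance `s` from `t`. -/
def fibreIntegral (Ω : Set Plane) (F : Plane → ℝ) (t : Plane) : ℝ :=
  ∑ᶠ y ∈ nearPoints Ω t, ∫ s in (0 : ℝ)..dist t y, F (t + (s / dist t y) • (y - t))

/-! ### Rooms and Passages domains -/

/-- The left or the right wall of a room. -/
inductive Side
  | left
  | right

/-- The upper or the lower half of a room. -/
inductive Half
  | upper
  | lower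

/-- The data of a Rooms and Passages domain. The pieces are numbered by `i = 1, 2, 3, …`; for odd
`i` the piece is a room, a square of side `h i`; for even `i` it is a passage of length `h i`
and width `δ i`. Values of `h` and `δ` at other indices play no role. -/
structure Domain where
  h : ℕ → ℝ
  δ : ℕ → ℝ
  h_pos : ∀ i, 1 ≤ i → 0 < h i
  δ_pos : ∀ k, 0 < δ (2 * k + 2)
  δ_lt : ∀ k, δ (2 * k + 2) < min (h (2 * k + 1)) (h (2 * k + 3))
  h_lim : Tendsto h atTop (𝓝 0)

namespace Domain

variable (P : Domain)

/-- The abscissa of the left end of the `i`-th piece. -/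
def start (i : ℕ) : ℝ := ∑ j ∈ Finset.Ico 1 i, P.h j

/-- The side of the `k`-th room, `k = 0, 1, …` (this is the piece number `2 k + 1`). -/
def roomSide (k : ℕ) : ℝ := P.h (2 * k + 1)

/-- The `k`-th room. -/
def room (k : ℕ) : Set Plane :=
  {p | P.start (2 * k + 1) < p 0 ∧ p 0 < P.start (2 * k + 2) ∧ |p 1| < P.h (2 * k + 1) / 2}

/-- The `k`-th passage (piece number `2 k + 2`), with its two open ends, which join the `k`-th
room to the room number `k + 1`. -/
def passage (k : ℕ) : Set Plane :=
  {p | P.start (2 * k + 2) ≤ p 0 ∧ p 0 ≤ P.start (2 * k + 3) ∧ |p 1| < P.δ (2 * k + 2) / 2}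

/-- The Rooms and Passages domain. -/
def Omega : Set Plane := (⋃ k, P.room k) ∪ ⋃ k, P.passage k

/-- The width of the opening in a wall of the `k`-th room; the left wall of the first room has
none. -/
def gap (k : ℕ) : Side → ℝ
  | .left => if k = 0 then 0 else P.δ (2 * k)
  | .right => P.δ (2 * k + 2)

/-- The point of the plane whose distance from the given wall of the `k`-th room, measured into
the room, is `x`, and whose ordinate is `y`. -/
def fromWall (k : ℕ) : Side → ℝ → ℝ → Plane
  | .left, x, y => !₂[P.start (2 * k + 1) + x, y]
  | .right, x, y => !₂[P.start (2 * k + 2) - x, y]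

end Domain

/-- The sign of the ordinate. -/
def Half.sign : Half → ℝ
  | .upper => 1
  | .lower => -1

/-- The edges of the skeleton.
* `passage k` is the central line of the `k`-th passage;
* `centre k` is the horizontal edge in the centre of the `k`-th room;
* `diagonal k s v` is the edge on a diagonal of the `k`-th room that emanates from the corner on
  side `s` in the half `v`;
* `mouth k s` and `parabola k s v` are the edges associated with the re-entrant corners at an
  end of the `k`-th passage: for `s = left` the end on the left wall of the room number `k + 1`,
  for `s = right` the end on the right wall of the `k`-th room. `mouth` is the horizontal segment
  that begins at the end of the passage, `parabola` a parabolic arc. -/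
inductive Edge
  | passage (k : ℕ)
  | centre (k : ℕ)
  | diagonal (k : ℕ) (s : Side) (v : Half)
  | mouth (k : ℕ) (s : Side)
  | parabola (k : ℕ) (s : Side) (v : Half)

/-- The singular edges: those whose points have a re-entrant corner as a near point. -/
def Edge.IsSing : Edge → Prop
  | .mouth _ _ => True
  | .parabola _ _ _ => True
  | _ => False

/-- The room into which the `k`-th passage opens on the wall of the given side. -/
def mouthRoom (k : ℕ) : Side → ℕ
  | .left => k + 1
  | .right => k

namespace Domain

variable (P : Domain)

/-- Half of the third side of a right triangle with hypotenuse `h` and a leg `d`: the distance from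
a wall with an opening of width `d` of the point where the parabolas meet the central line. -/
def reach (h d : ℝ) : ℝ := √(h ^ 2 - d ^ 2) / 2

/-- The interval of parameters of an edge. On all edges except the parabolas the parameter is arc
length; on a parabola it is the distance from the wall. -/
def param : Edge → Set ℝ
  | .passage k => Ioo 0 (P.h (2 * k + 2))
  | .centre k => Ioo (reach (P.roomSide k) (P.gap k .left))
      (P.roomSide k - reach (P.roomSide k) (P.gap k .right))
  | .diagonal k s _ => Ioo 0 ((P.roomSide k - P.gap k s) / √2)
  | .mouth k s => Ioo 0 (reach (P.roomSide (mouthRoom k s)) (P.δ (2 * k + 2)))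
  | .parabola k s _ => Ioo ((P.roomSide (mouthRoom k s) - P.δ (2 * k + 2)) / 2)
      (reach (P.roomSide (mouthRoom k s)) (P.δ (2 * k + 2)))

/-- The parametrization of an edge. -/
def curve : Edge → ℝ → Plane
  | .passage k, u => !₂[P.start (2 * k + 2) + u, 0]
  | .centre k, u => P.fromWall k .left u 0
  | .diagonal k s v, u => P.fromWall k s (u / √2) (v.sign * (P.roomSide k / 2 - u / √2))
  | .mouth k s, u => P.fromWall (mouthRoom k s) s u 0
  | .parabola k s v, u => P.fromWall (mouthRoom k s) s u
      (v.sign * (-u ^ 2 / (P.roomSide (mouthRoom k s) - P.δ (2 * k + 2)) +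
        (P.roomSide (mouthRoom k s) + P.δ (2 * k + 2)) / 4))

/-- The set `τ⁻¹(e)`. -/
def cell (e : Edge) : Set Plane := {x ∈ P.Omega | tau P.Omega x ∈ P.curve e '' P.param e}

/-- `α = ∫ 1 / |∇τ| ds` at the point of `e` with parameter `u`. -/
def alpha (e : Edge) (u : ℝ) : ℝ :=
  fibreIntegral P.Omega (fun x => 1 / gradTau P.Omega x) (P.curve e u)

/-- `β = ∫ |∇τ| ds` at the point of `e` with parameter `u`. -/
def beta (e : Edge) (u : ℝ) : ℝ :=
  fibreIntegral P.Omega (fun x => gradTau P.Omega x) (P.curve e u)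

/-- The measure `w dσ` on the edge `e`, on the parameter interval; `σ` is arc length, so that
`dσ = |curve'(u)| du`. -/
def edgeMeasure (e : Edge) (w : ℝ → ℝ) : Measure ℝ :=
  (volume.restrict (P.param e)).withDensity fun u =>
    ENNReal.ofReal (w u * ‖deriv (P.curve e) u‖)

/-- `α dσ`. -/
abbrev muAlpha (e : Edge) : Measure ℝ := P.edgeMeasure e (P.alpha e)

/-- `β dσ`. -/
abbrev muBeta (e : Edge) : Measure ℝ := P.edgeMeasure e (P.beta e)

/-- The component on `e` of the space `L̃²(Γ)`: `L²(e; α dσ)` on a regular edge, its subspace of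
constants on a singular edge. -/
def edgeL2 (e : Edge) : Submodule ℂ (Lp ℂ 2 (P.muAlpha e)) where
  carrier := {f | e.IsSing → ∃ c : ℂ, f =ᵐ[P.muAlpha e] fun _ => c}
  zero_mem' _ := ⟨0, Lp.coeFn_zero ℂ 2 (P.muAlpha e)⟩
  add_mem' := by
    intro f g hf hg he
    obtain ⟨c, hc⟩ := hf he
    obtain ⟨d, hd⟩ := hg he
    exact ⟨c + d, (Lp.coeFn_add f g).trans (hc.add hd)⟩
  smul_mem' := by
    intro a f hf he
    obtain ⟨c, hc⟩ := hf he
    exact ⟨a • c, (Lp.coeFn_smul a f).trans (hc.const_smul a)⟩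

/-- `g` is the weak derivative of `f` with respect to arc length on the regular edge `e`
(on which the parameter is arc length); both are locally integrable, and they are considered up
to sets of measure zero. -/
def WeakDeriv (e : Edge) (f : Lp ℂ 2 (P.muAlpha e)) (g : Lp ℂ 2 (P.muBeta e)) : Prop :=
  ∃ F G : ℝ → ℂ, F =ᵐ[P.muAlpha e] f ∧ G =ᵐ[P.muBeta e] g ∧
    LocallyIntegrableOn F (P.param e) ∧ LocallyIntegrableOn G (P.param e) ∧
    ∀ φ : ℝ → ℝ, ContDiff ℝ ∞ φ → HasCompactSupport φ → tsupport φ ⊆ P.param e →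
      ∫ u in P.param e, deriv φ u • F u = -∫ u in P.param e, φ u • G u

theorem integrable_test_smul_edge {I : Set ℝ} {F : ℝ → ℂ} (hF : LocallyIntegrableOn F I)
    {ψ : ℝ → ℝ} (hψ : Continuous ψ) (hc : HasCompactSupport ψ) (hI : tsupport ψ ⊆ I) :
    IntegrableOn (fun u => ψ u • F u) I := by
  have h1 : IntegrableOn (fun u => ψ u • F u) (tsupport ψ) :=
    (hF.integrableOn_compact_subset hI hc).continuousOn_smul hψ.continuousOn hc
  have h2 : Integrable (fun u => ψ u • F u) := by
    rw [← integrableOn_iff_integrable_of_support_subset (s := tsupport ψ)]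
    · exact h1
    · exact (Function.support_smul_subset_left _ _).trans (subset_tsupport ψ)
  exact h2.integrableOn

/-- The component on `e` of the space `H̃¹(Γ)`: on a regular edge `H¹(e; α, β)`, that is, the
`f ∈ L²(e; α dσ)` with a weak derivative in `L²(e; β dσ)`; on a singular edge the constants, with
derivative zero. -/
def edgeH1 (e : Edge) :
    Submodule ℂ (WithLp 2 (Lp ℂ 2 (P.muAlpha e) × Lp ℂ 2 (P.muBeta e))) where
  carrier := {p | p.fst ∈ P.edgeL2 e ∧ (e.IsSing → p.snd = 0) ∧
    (¬ e.IsSing → P.WeakDeriv e p.fst p.snd)}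
  zero_mem' := by
    refine ⟨(P.edgeL2 e).zero_mem, fun _ => rfl, fun _ => ⟨0, 0, ?_, ?_, ?_, ?_, by simp⟩⟩
    · exact (Lp.coeFn_zero ℂ 2 (P.muAlpha e)).symm
    · exact (Lp.coeFn_zero ℂ 2 (P.muBeta e)).symm
    · exact (locallyIntegrable_zero).locallyIntegrableOn _
    · exact (locallyIntegrable_zero).locallyIntegrableOn _
  add_mem' := by
    rintro p q ⟨hp, hp', hp''⟩ ⟨hq, hq', hq''⟩
    refine ⟨(P.edgeL2 e).add_mem hp hq, fun he => ?_, fun he => ?_⟩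
    · simp [hp' he, hq' he]
    · obtain ⟨F, G, hF, hG, hF1, hG1, h⟩ := hp'' he
      obtain ⟨F', G', hF', hG', hF1', hG1', h'⟩ := hq'' he
      refine ⟨F + F', G + G', (hF.add hF').trans (Lp.coeFn_add _ _).symm,
        (hG.add hG').trans (Lp.coeFn_add _ _).symm, hF1.add hF1', hG1.add hG1', ?_⟩
      intro φ hφ hc hI
      have hd : Continuous (deriv φ) := hφ.continuous_deriv (by simp)
      have hdI : tsupport (deriv φ) ⊆ P.param e := tsupport_deriv_subset.trans hI
      simp only [Pi.add_apply, smul_add]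
      rw [integral_add (integrable_test_smul_edge hF1 hd hc.deriv hdI)
          (integrable_test_smul_edge hF1' hd hc.deriv hdI),
        integral_add (integrable_test_smul_edge hG1 hφ.continuous hc hI)
          (integrable_test_smul_edge hG1' hφ.continuous hc hI),
        h φ hφ hc hI, h' φ hφ hc hI]
      ring
  smul_mem' := by
    rintro c p ⟨hp, hp', hp''⟩
    refine ⟨(P.edgeL2 e).smul_mem c hp, fun he => ?_, fun he => ?_⟩
    · simp [hp' he]
    · obtain ⟨F, G, hF, hG, hF1, hG1, h⟩ := hp'' he
      refine ⟨c • F, c • G, (hF.const_smul c).trans (Lp.coeFn_smul _ _).symm,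
        (hG.const_smul c).trans (Lp.coeFn_smul _ _).symm, hF1.smul c, hG1.smul c, ?_⟩
      intro φ hφ hc hI
      simp only [Pi.smul_apply]
      simp_rw [smul_comm _ c]
      rw [integral_smul, integral_smul, h φ hφ hc hI, smul_neg]

/-- `L̃²(Γ)`. -/
abbrev L2Gamma : Type := lp (fun e : Edge => P.edgeL2 e) 2

/-- `H̃¹(Γ)`. -/
abbrev H1Gamma : Type := lp (fun e : Edge => P.edgeH1 e) 2

/-- `⨁ L²(τ⁻¹(e))`, that is, `L²(Ω)`. -/
abbrev L2Omega : Type := lp (fun e : Edge => L2 (P.cell e)) 2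

/-- `Ĥ¹(Ω) = ⨁ H¹(τ⁻¹(e))`. -/
abbrev H1Omega : Type := lp (fun e : Edge => H1 (P.cell e)) 2

/-- The embedding of `H̃¹(Γ)` into `L̃²(Γ)`, on one edge. -/
def edgeH1.toL2 (e : Edge) : P.edgeH1 e →ₗ[ℂ] P.edgeL2 e where
  toFun p := ⟨p.1.fst, p.2.1⟩
  map_add' _ _ := rfl
  map_smul' _ _ := rfl

/-- The embedding of `H̃¹(Γ)` into `L̃²(Γ)`. -/
def EGamma : P.H1Gamma →L[ℂ] P.L2Gamma :=
  sumMap (edgeH1.toL2 P) fun _ p => norm_fst_le_norm p.1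

/-- The embedding `E₁` of `Ĥ¹(Ω)` into `⨁ L²(τ⁻¹(e))`. -/
def E1 : P.H1Omega →L[ℂ] P.L2Omega :=
  sumMap (V := fun e : Edge => H1 (P.cell e)) (W := fun e : Edge => L2 (P.cell e))
    (fun e => H1.toL2 (P.cell e)) (fun e p => H1.norm_toL2_le (P.cell e) p)

/-- `H_Γ`. -/
def HGamma : P.L2Gamma →ₗ.[ℂ] P.L2Gamma := formOperator P.EGamma

/-- `H_Ω`. -/
def HOmega : P.L2Omega →ₗ.[ℂ] P.L2Omega := formOperator (V := P.H1Omega) (H := P.L2Omega) P.E1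

/-- The elements of `L̃²(Γ)` that vanish on the regular edges. -/
def singPart : Submodule ℂ P.L2Gamma where
  carrier := {f | ∀ e : Edge, ¬ e.IsSing → f e = 0}
  zero_mem' _ _ := rfl
  add_mem' := by
    intro f g hf hg e he
    simp [hf e he, hg e he]
  smul_mem' := by
    intro c f hf e he
    simp [hf e he]

/-- `T₁ f = f ∘ τ` for all `f ∈ H̃¹(Γ)`. -/
def IsT1 (T₁ : P.H1Gamma →L[ℂ] P.H1Omega) : Prop :=
  ∀ (f : P.H1Gamma) (e : Edge), ∀ᵐ x ∂(volume.restrict (P.cell e)), ∀ u ∈ P.param e,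
    P.curve e u = tau P.Omega x → (T₁ f e).1.fst x = (f e).1.fst u

end Domain

end RP

end

noncomputable section

namespace RP

section Operators

variable {V H W G : Type*} [NormedAddCommGroup V] [InnerProductSpace ℂ V]
  [NormedAddCommGroup H] [InnerProductSpace ℂ H]
  [NormedAddCommGroup W] [InnerProductSpace ℂ W]
  [NormedAddCommGroup G] [InnerProductSpace ℂ G]

theorem formGraph_snd_eq_zero {J : V →L[ℂ] H} (hJ : DenseRange J) :
    ∀ x ∈ formGraph J, x.1 = 0 → x.2 = 0 := by
  rintro ⟨u, f⟩ ⟨v, hv, hv'⟩ (rfl : u = 0)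
  simp only [add_zero] at hv hv'
  refine hJ.eq_of_inner_right ℂ ?_
  intro w
  have hv0 : v = 0 := by
    have h := hv' v
    rw [hv, inner_zero_left] at h
    exact inner_self_eq_zero.1 h
  rw [inner_zero_right, ← hv' w, hv0, inner_zero_right]

theorem graph_formOperator {J : V →L[ℂ] H} (hJ : DenseRange J) :
    (formOperator J).graph = formGraph J :=
  Submodule.toLinearPMap_graph_eq _ (formGraph_snd_eq_zero hJ)

/-- A weak solution of `(A + I) u = f + u` belongs to the domain of `A`, and `A u = f`. -/
theorem exists_domain_formOperator {J : V →L[ℂ] H} (hJ : DenseRange J) {v : V} {f : H}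
    (h : ∀ w : V, ⟪w, v⟫_ℂ = ⟪J w, f + J v⟫_ℂ) :
    ∃ u : (formOperator J).domain, (u : H) = J v ∧ formOperator J u = f := by
  have : (J v, f) ∈ (formOperator J).graph := by
    rw [graph_formOperator hJ]
    exact ⟨v, rfl, h⟩
  obtain ⟨u, hu, hu'⟩ := (LinearPMap.mem_graph_iff _).1 this
  exact ⟨u, hu, hu'⟩

theorem exists_form_of_domain {J : V →L[ℂ] H} (hJ : DenseRange J)
    (u : (formOperator J).domain) :
    ∃ v : V, J v = u ∧ ∀ w : V, ⟪w, v⟫_ℂ = ⟪J w, formOperator J u + u⟫_ℂ := by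
  have h := (formOperator J).mem_graph u
  rw [graph_formOperator hJ] at h
  exact h

/-- The adjoint of an operator whose domain is complete; the codomain need not be. -/
def rieszAdjoint [CompleteSpace V] (A : V →L[ℂ] H) : H →L[ℂ] V :=
  ((InnerProductSpace.toDual ℂ V).symm : StrongDual ℂ V →L⋆[ℂ] V).comp
    (ContinuousLinearMap.toSesqForm A : H →L⋆[ℂ] StrongDual ℂ V)

theorem inner_rieszAdjoint_left [CompleteSpace V] (A : V →L[ℂ] H) (x : V) (y : H) :
    ⟪rieszAdjoint A y, x⟫_ℂ = ⟪y, A x⟫_ℂ := by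
  simp [rieszAdjoint]

theorem inner_rieszAdjoint_right [CompleteSpace V] (A : V →L[ℂ] H) (x : V) (y : H) :
    ⟪x, rieszAdjoint A y⟫_ℂ = ⟪A x, y⟫_ℂ := by
  rw [← inner_conj_symm, inner_rieszAdjoint_left, inner_conj_symm]

theorem isInverseOfAddOne_formOperator [CompleteSpace V] {J : V →L[ℂ] H} (hJ : DenseRange J) :
    IsInverseOfAddOne (formOperator J) (J ∘L rieszAdjoint J) := by
  refine ⟨fun u => ?_, fun f => ?_⟩
  · obtain ⟨v, hv, hv'⟩ := exists_form_of_domain hJ u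
    have : rieszAdjoint J (formOperator J u + u) = v := by
      refine ext_inner_left ℂ fun w => ?_
      rw [inner_rieszAdjoint_right, hv' w]
    simp [this, hv]
  · obtain ⟨u, hu, hu'⟩ := exists_domain_formOperator hJ
      (v := rieszAdjoint J f)
      (f := f - J (rieszAdjoint J f))
      (fun w => by rw [inner_rieszAdjoint_right, sub_add_cancel])
    exact ⟨u, hu, by rw [hu', hu, sub_add_cancel]⟩

theorem mem_nullSpace_formOperator {J : V →L[ℂ] H} (hJ : DenseRange J) {v : V}
    (h : ∀ w : V, ⟪w, v⟫_ℂ = ⟪J w, J v⟫_ℂ) : J v ∈ nullSpace (formOperator J) := by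
  obtain ⟨u, hu, hu'⟩ := exists_domain_formOperator hJ (v := v) (f := 0)
    (fun w => by rw [zero_add, h w])
  exact ⟨u, hu', hu⟩

theorem tendsto_inner_orthonormal {u : ℕ → H} (hu : Orthonormal ℂ u) (v : H) :
    Tendsto (fun n => ⟪v, u n⟫_ℂ) atTop (𝓝 0) := by
  have h := (hu.inner_products_summable v).tendsto_atTop_zero
  rw [tendsto_zero_iff_norm_tendsto_zero]
  have h2 := h.sqrt
  simp only [Real.sqrt_zero, Real.sqrt_sq (norm_nonneg _)] at h2
  refine h2.congr fun n => ?_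
  rw [norm_inner_symm]

theorem zero_mem_essSpectrum {A : H →ₗ.[ℂ] H} {u : ℕ → H} (hu : Orthonormal ℂ u)
    (h : ∀ n, u n ∈ nullSpace A) : (0 : ℂ) ∈ essSpectrum A := by
  choose w hw hw' using h
  have hw2 : ∀ n, (w n : H) = u n := hw'
  refine ⟨w, fun n => by rw [hw2]; exact hu.1 n, fun v => ?_, ?_⟩
  · simp_rw [hw2]
    exact tendsto_inner_orthonormal hu v
  · have : ∀ n, A (w n) = 0 := fun n => hw n
    simp [this]

/-- A compact operator maps a bounded sequence with weakly null image to a null sequence. -/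
theorem tendsto_zero_of_isCompactOperator {C : V →L[ℂ] H} (hC : IsCompactOperator C)
    {x : ℕ → V} {M : ℝ} (hx : ∀ n, ‖x n‖ ≤ M)
    (hw : ∀ h : H, Tendsto (fun n => ⟪h, C (x n)⟫_ℂ) atTop (𝓝 0)) :
    Tendsto (fun n => C (x n)) atTop (𝓝 0) := by
  obtain ⟨K, hK, hKs⟩ := hC.image_closedBall_subset_compact (f := (C : V →ₗ[ℂ] H)) M
  refine tendsto_of_subseq_tendsto fun ns hns => ?_
  obtain ⟨y, -, φ, hφ, hy⟩ := hK.tendsto_subseq (x := fun n => C (x (ns n)))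
    (fun n => hKs ⟨x (ns n), by simpa using hx (ns n), rfl⟩)
  refine ⟨φ, ?_⟩
  have hy0 : y = 0 := by
    have h1 : Tendsto (fun n => ⟪y, C (x (ns (φ n)))⟫_ℂ) atTop (𝓝 ⟪y, y⟫_ℂ) :=
      tendsto_const_nhds.inner hy
    have h2 : Tendsto (fun n => ⟪y, C (x (ns (φ n)))⟫_ℂ) atTop (𝓝 0) :=
      (hw y).comp (hns.comp hφ.tendsto_atTop)
    exact inner_self_eq_zero.1 (tendsto_nhds_unique h1 h2)
  rw [← hy0]
  exact hy

theorem not_isCompactOperator_of_orthonormal {C : V →L[ℂ] H} {x : ℕ → V} {M : ℝ}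
    (hx : ∀ n, ‖x n‖ ≤ M) (h : Orthonormal ℂ fun n => C (x n)) : ¬ IsCompactOperator C := by
  intro hC
  have h1 := (tendsto_zero_of_isCompactOperator hC hx
    fun v => tendsto_inner_orthonormal h v).norm
  simp only [h.1, norm_zero] at h1
  exact one_ne_zero (tendsto_nhds_unique tendsto_const_nhds h1)

theorem not_finiteDimensional_of_orthonormal {S : Submodule ℂ H} {u : ℕ → H}
    (hu : Orthonormal ℂ u) (h : ∀ n, u n ∈ S) : ¬ FiniteDimensional ℂ S := by
  intro hS
  have hli : LinearIndependent ℂ fun n => (⟨u n, h n⟩ : S) :=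
    LinearIndependent.of_comp S.subtype hu.linearIndependent
  exact not_finite_iff_infinite.2 inferInstance (hli.finite : Finite ℕ)

theorem mem_essSpectrum_of_asymptotic {A : H →ₗ.[ℂ] H} {z : ℂ} (p : ℕ → A.domain)
    (h1 : Tendsto (fun n => ‖(p n : H)‖) atTop (𝓝 1))
    (h2 : ∀ v : H, Tendsto (fun n => ⟪v, (p n : H)⟫_ℂ) atTop (𝓝 0))
    (h3 : Tendsto (fun n => A (p n) - z • (p n : H)) atTop (𝓝 0)) : z ∈ essSpectrum A := by
  obtain ⟨N, hN⟩ := eventually_atTop.1 (h1.eventually_ne one_ne_zero)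
  have hs : Tendsto (fun n => n + N) atTop atTop := tendsto_add_atTop_nat N
  set c : ℕ → ℂ := fun n => ((‖(p (n + N) : H)‖⁻¹ : ℝ) : ℂ) with hc
  have hc1 : Tendsto c atTop (𝓝 1) := by
    have := ((h1.comp hs).inv₀ one_ne_zero)
    rw [inv_one] at this
    have := (Complex.continuous_ofReal.tendsto 1).comp this
    simpa [hc, Function.comp_def] using this
  refine ⟨fun n => c n • p (n + N), fun n => ?_, fun v => ?_, ?_⟩
  · have : ‖(p (n + N) : H)‖ ≠ 0 := hN _ (by omega)
    simp [hc, norm_smul, this]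
  · have := hc1.mul ((h2 v).comp hs)
    simp only [mul_zero] at this
    refine this.congr fun n => ?_
    simp
  · have := hc1.smul (h3.comp hs)
    simp only [smul_zero] at this
    refine this.congr fun n => ?_
    simp [smul_sub, LinearPMap.map_smul, smul_comm z]

/-- Comparison of the essential spectra of two operators given by forms on `V` and `W`, when
`W` is embedded into `V` by an operator `T` that preserves the norms of the ambient spaces and
`T T* - I` is compact. -/
theorem essSpectrum_formOperator_subset [CompleteSpace W] {J : V →L[ℂ] H} (hJ : DenseRange J)
    {K : W →L[ℂ] G} (hK : DenseRange K) {T : W →L[ℂ] V} {T' : V →L[ℂ] W}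
    (hT : ∀ f g, ⟪T f, g⟫_ℂ = ⟪f, T' g⟫_ℂ) (hn : ∀ f, ‖J (T f)‖ = ‖K f‖)
    (hC : IsCompactOperator (J ∘L (T ∘L T' - ContinuousLinearMap.id ℂ V))) :
    essSpectrum (formOperator J) ⊆ essSpectrum (formOperator K) := by
  rintro z ⟨u, hu1, hu2, hu3⟩
  choose v hv hv' using fun n => exists_form_of_domain hJ (u n)
  set g : ℕ → H := fun n => formOperator J (u n) + u n with hg
  have hin : ∀ f g, ⟪J (T f), J (T g)⟫_ℂ = ⟪K f, K g⟫_ℂ := by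
    intro f g
    rw [inner_eq_sum_norm_sq_div_four, inner_eq_sum_norm_sq_div_four]
    simp only [← map_add, ← map_sub, ← map_smul, hn]
  have hgε : Tendsto (fun n => g n - (z + 1) • (u n : H)) atTop (𝓝 0) := by
    refine hu3.congr fun n => ?_
    simp only [hg, add_smul, one_smul]
    abel
  have hgw : ∀ h : H, Tendsto (fun n => ⟪h, g n⟫_ℂ) atTop (𝓝 0) := by
    intro h
    have h1 := (tendsto_const_nhds (x := h) (f := atTop)).inner (𝕜 := ℂ) hgε
    have h2 := (hu2 h).const_mul (z + 1)
    have h3 := h1.add h2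
    simp only [inner_zero_right, mul_zero, add_zero] at h3
    refine h3.congr fun n => ?_
    rw [inner_sub_right, inner_smul_right]
    ring
  have hvw : ∀ w : V, Tendsto (fun n => ⟪w, v n⟫_ℂ) atTop (𝓝 0) := by
    intro w
    simp_rw [hv']
    exact hgw (J w)
  obtain ⟨M, hM⟩ : ∃ M, ∀ n, ‖g n‖ ≤ M := by
    have hb : Bornology.IsBounded (range fun n => g n - (z + 1) • (u n : H)) :=
      Metric.isBounded_range_of_tendsto _ hgε
    obtain ⟨M, hM⟩ := hb.exists_norm_le
    refine ⟨M + ‖z + 1‖, fun n => ?_⟩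
    calc ‖g n‖ = ‖(g n - (z + 1) • (u n : H)) + (z + 1) • (u n : H)‖ := by rw [sub_add_cancel]
      _ ≤ M + ‖z + 1‖ := (norm_add_le _ _).trans
          (add_le_add (hM _ ⟨n, rfl⟩) (by rw [norm_smul, hu1, mul_one]))
  have hvb : ∀ n, ‖v n‖ ≤ M + 1 := by
    intro n
    have h1 : ‖v n‖ ^ 2 ≤ M := by
      have h2 : ‖⟪v n, v n⟫_ℂ‖ ≤ ‖J (v n)‖ * ‖g n‖ := by
        rw [hv' n (v n)]
        exact norm_inner_le_norm _ _
      rw [hv n, hu1, one_mul, inner_self_eq_norm_sq_to_K] at h2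
      have h3 : ‖((‖v n‖ : ℂ)) ^ 2‖ = ‖v n‖ ^ 2 := by simp
      exact (h3.symm.le.trans h2).trans (hM n)
    have hM0 : 0 ≤ M := (sq_nonneg _).trans h1
    nlinarith [norm_nonneg (v n)]
  set x : ℕ → W := fun n => T' (v n) with hx
  have hxw : ∀ f : W, Tendsto (fun n => ⟪f, x n⟫_ℂ) atTop (𝓝 0) := by
    intro f
    simp_rw [hx, ← hT]
    exact hvw _
  have hCv : Tendsto (fun n => J (T (x n)) - u n) atTop (𝓝 0) := by
    have := tendsto_zero_of_isCompactOperator hC hvb (fun h => by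
      have h1 := (hxw (rieszAdjoint (J ∘L T) h)).sub (hu2 h)
      rw [sub_zero] at h1
      refine h1.congr fun n => ?_
      rw [inner_rieszAdjoint_left]
      simp [hv, hx])
    refine this.congr fun n => ?_
    simp [hv, hx]
  set S := rieszAdjoint (J ∘L T) with hS
  set K' := rieszAdjoint K with hK'
  set ε : ℕ → H := fun n => (g n - (z + 1) • (u n : H)) - (z + 1) • (J (T (x n)) - u n) with hε
  have hε0 : Tendsto ε atTop (𝓝 0) := by
    have := hgε.sub (hCv.const_smul (z + 1))
    simpa using this
  have hxeq : ∀ n, x n = (z + 1) • K' (K (x n)) + S (ε n) := by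
    intro n
    refine ext_inner_left ℂ fun f => ?_
    rw [inner_add_right, inner_smul_right, hK', hS, inner_rieszAdjoint_right,
      inner_rieszAdjoint_right, ← hin, hx, ← hT, hv' n (T f)]
    simp only [hε, inner_sub_right, inner_smul_right, ContinuousLinearMap.comp_apply, hx]
    ring
  choose p hp hp' using fun n => exists_domain_formOperator hK
      (v := K' ((z + 1) • K (x n)))
      (f := (z + 1) • K (x n) - K (K' ((z + 1) • K (x n))))
      (fun w => by rw [hK', inner_rieszAdjoint_right, sub_add_cancel])
  have hpx : ∀ n, K (x n) - (p n : G) = K (S (ε n)) := by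
    intro n
    rw [hp]
    nth_rewrite 1 [hxeq n]
    simp
  have hd : Tendsto (fun n => K (x n) - (p n : G)) atTop (𝓝 0) := by
    simp_rw [hpx]
    have := ((K ∘L S).continuous.tendsto 0).comp hε0
    simpa [Function.comp_def] using this
  refine mem_essSpectrum_of_asymptotic p ?_ ?_ ?_
  · have h1 : Tendsto (fun n => ‖J (T (x n))‖ - 1) atTop (𝓝 0) := by
      refine squeeze_zero_norm (fun n => ?_) (tendsto_zero_iff_norm_tendsto_zero.1 hCv)
      rw [← hu1 n]
      exact abs_norm_sub_norm_le _ _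
    have h2 : Tendsto (fun n => ‖(p n : G)‖ - ‖K (x n)‖) atTop (𝓝 0) := by
      refine squeeze_zero_norm (fun n => ?_) (tendsto_zero_iff_norm_tendsto_zero.1 hd)
      rw [norm_sub_rev (K (x n))]
      exact abs_norm_sub_norm_le _ _
    have h3 := (h1.add h2).add_const 1
    simp only [hn, zero_add, add_zero] at h3
    refine h3.congr fun n => ?_
    ring
  · intro h
    have h1 : Tendsto (fun n => ⟪h, K (x n)⟫_ℂ) atTop (𝓝 0) := by
      refine (hxw (K' h)).congr fun n => ?_
      rw [hK', inner_rieszAdjoint_left]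
    have h2 := h1.sub ((tendsto_const_nhds (x := h) (f := atTop)).inner (𝕜 := ℂ) hd)
    simp only [inner_zero_right, sub_zero] at h2
    refine h2.congr fun n => ?_
    rw [inner_sub_right]
    ring
  · have h1 := hd.const_smul (z + 1)
    rw [smul_zero] at h1
    refine h1.congr fun n => ?_
    rw [hp', ← hp]
    simp only [smul_sub, add_smul, one_smul]
    abel

end Operators

/-! ### Near points and the map `τ` -/

section NearPoints

variable {Ω : Set Plane} {t t' x y y' z : Plane}

theorem dist_le_of_mem_nearPoints (hy : y ∈ nearPoints Ω t) (hz : z ∈ frontier Ω) :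
    dist t y ≤ dist t z := by
  rw [hy.2]
  exact Metric.infDist_le_dist_of_mem hz

/-- A point `x ≠ t` on the segment joining `t` to a near point `y` has no other near point. -/
theorem eq_of_mem_nearPoints_of_mem_segment (hy : y ∈ nearPoints Ω t) (hx : x ∈ segment ℝ t y)
    (hxt : x ≠ t) (hz : z ∈ nearPoints Ω x) : z = y := by
  have h1 : dist x z ≤ dist x y := dist_le_of_mem_nearPoints hz hy.1
  have h2 : dist t y ≤ dist t z := dist_le_of_mem_nearPoints hy hz.1
  have h3 : dist t x + dist x y = dist t y := dist_add_dist_of_mem_segment hx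
  have h4 : dist t x + dist x z = dist t z :=
    le_antisymm (by linarith) (dist_triangle _ _ _)
  have h5 : dist x z = dist x y := by linarith
  have hw : Wbtw ℝ t x z := dist_add_dist_eq_iff.1 h4
  have hw' : Wbtw ℝ t x y := dist_add_dist_eq_iff.1 h3
  obtain ⟨a, ⟨ha0, ha1⟩, ha⟩ := hw
  obtain ⟨b, ⟨hb0, hb1⟩, hb⟩ := hw'
  have e1 : x - t = a • (z - t) := by rw [← ha]; simp [AffineMap.lineMap_apply]
  have e2 : x - t = b • (y - t) := by rw [← hb]; simp [AffineMap.lineMap_apply]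
  have hl : ‖z - t‖ = ‖y - t‖ := by
    rw [← dist_eq_norm, ← dist_eq_norm, dist_comm z, dist_comm y]; linarith
  have hne : x - t ≠ 0 := sub_ne_zero.2 hxt
  have hly : ‖y - t‖ ≠ 0 := by
    intro h
    rw [norm_eq_zero] at h
    rw [h, smul_zero] at e2
    exact hne e2
  have hab : a = b := by
    have h6 : ‖x - t‖ = a * ‖y - t‖ := by rw [e1, norm_smul, Real.norm_of_nonneg ha0, hl]
    have h7 : ‖x - t‖ = b * ‖y - t‖ := by rw [e2, norm_smul, Real.norm_of_nonneg hb0]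
    exact mul_right_cancel₀ hly (h6.symm.trans h7)
  have ha0' : a ≠ 0 := by
    rintro rfl
    rw [zero_smul] at e1
    exact hne e1
  rw [e1, hab] at e2
  have := smul_right_injective Plane (hab ▸ ha0') e2
  exact sub_left_injective this

theorem notMem_of_mem_nearPoints (hΩ : IsOpen Ω) (hy : y ∈ nearPoints Ω t) : y ∉ Ω := by
  have := hy.1
  rw [hΩ.frontier_eq] at this
  exact this.2

theorem mem_nearPoints_of_mem_segment (hy : y ∈ nearPoints Ω t) (hx : x ∈ segment ℝ t y) :
    y ∈ nearPoints Ω x := by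
  refine ⟨hy.1, le_antisymm ?_ (Metric.infDist_le_dist_of_mem hy.1)⟩
  refine (Metric.le_infDist ⟨y, hy.1⟩).2 fun z hz => ?_
  have h2 : dist t y ≤ dist t z := dist_le_of_mem_nearPoints hy hz
  have h3 : dist t x + dist x y = dist t y := dist_add_dist_of_mem_segment hx
  linarith [dist_triangle t x z]

theorem eq_of_mem_skeleton_of_mem_segment (ht : t ∈ skeleton Ω) (hy : y ∈ nearPoints Ω t')
    (hx : t ∈ segment ℝ t' y) : t = t' := by
  by_contra h
  obtain ⟨a, ha, b, hb, hab⟩ := ht.2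
  exact hab ((eq_of_mem_nearPoints_of_mem_segment hy hx h ha).trans
    (eq_of_mem_nearPoints_of_mem_segment hy hx h hb).symm)

theorem skeleton_point_unique (hΩ : IsOpen Ω) (hxΩ : x ∈ Ω) (ht : t ∈ skeleton Ω)
    (ht' : t' ∈ skeleton Ω) (hy : y ∈ nearPoints Ω t) (hy' : y' ∈ nearPoints Ω t')
    (hx : x ∈ segment ℝ t y) (hx' : x ∈ segment ℝ t' y') : t = t' := by
  by_cases h : x = t
  · subst h
    exact eq_of_mem_skeleton_of_mem_segment ht hy' hx'
  by_cases h' : x = t'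
  · subst h'
    exact (eq_of_mem_skeleton_of_mem_segment ht' hy hx).symm
  have hyy : y' = y :=
    eq_of_mem_nearPoints_of_mem_segment hy hx h (mem_nearPoints_of_mem_segment hy' hx')
  subst hyy
  have hxy : x ≠ y' := fun e => notMem_of_mem_nearPoints hΩ hy (e ▸ hxΩ)
  rw [segment_symm] at hx hx'
  obtain ⟨a, ⟨ha0, ha1⟩, ha⟩ := (mem_segment_iff_wbtw).1 hx
  obtain ⟨b, ⟨hb0, hb1⟩, hb⟩ := (mem_segment_iff_wbtw).1 hx'
  have e1 : x - y' = a • (t - y') := by rw [← ha]; simp [AffineMap.lineMap_apply]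
  have e2 : x - y' = b • (t' - y') := by rw [← hb]; simp [AffineMap.lineMap_apply]
  have hne : x - y' ≠ 0 := sub_ne_zero.2 hxy
  have ha' : 0 < a := ha0.lt_of_ne (by rintro rfl; exact hne (by rw [e1, zero_smul]))
  have hb' : 0 < b := hb0.lt_of_ne (by rintro rfl; exact hne (by rw [e2, zero_smul]))
  have key : ∀ {s s' : Plane} {a b : ℝ}, 0 < a → 0 < b → b ≤ a →
      a • (s - y') = b • (s' - y') → s ∈ segment ℝ s' y' := by
    intro s s' a b ha hb hba h
    rw [segment_symm]
    refine mem_segment_iff_wbtw.2 ⟨b / a, ⟨by positivity, (div_le_one ha).2 hba⟩, ?_⟩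
    have : s - y' = (b / a) • (s' - y') := by
      rw [div_eq_inv_mul, mul_smul, ← h, smul_smul, inv_mul_cancel₀ ha.ne', one_smul]
    simp [AffineMap.lineMap_apply, ← this]
  rcases le_total b a with hba | hba
  · exact eq_of_mem_skeleton_of_mem_segment ht hy' (key ha' hb' hba (e1.symm.trans e2))
  · exact (eq_of_mem_skeleton_of_mem_segment ht' hy (key hb' ha' hba (e2.symm.trans e1))).symm

theorem tau_eq (hΩ : IsOpen Ω) (hxΩ : x ∈ Ω) (ht : t ∈ skeleton Ω) (hy : y ∈ nearPoints Ω t)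
    (hx : x ∈ segment ℝ t y) : tau Ω x = t := by
  have h : ∃ t ∈ skeleton Ω, ∃ y ∈ nearPoints Ω t, x ∈ segment ℝ t y := ⟨t, ht, y, hy, hx⟩
  rw [tau, dif_pos h]
  obtain ⟨h1, y', h2, h3⟩ := h.choose_spec
  exact skeleton_point_unique hΩ hxΩ h1 ht h2 hy h3 hx

theorem exists_mem_segment_of_tau_mem_skeleton (hx : tau Ω x ∈ skeleton Ω) :
    ∃ y ∈ nearPoints Ω (tau Ω x), x ∈ segment ℝ (tau Ω x) y := by
  by_cases h : ∃ t ∈ skeleton Ω, ∃ y ∈ nearPoints Ω t, x ∈ segment ℝ t y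
  · rw [tau, dif_pos h]
    exact h.choose_spec.2
  · rw [tau, dif_neg h] at hx ⊢
    obtain ⟨y, hy, -⟩ := hx.2
    exact ⟨y, hy, left_mem_segment ℝ x y⟩

/-- The closed disc about `t` through `y` and `z` lies in `Ω`, except for `y` and `z`, which
do not belong to `Ω`. -/
structure NearPair (Ω : Set Plane) (t y z : Plane) : Prop where
  ne : y ≠ z
  dist_eq : dist t y = dist t z
  left_notMem : y ∉ Ω
  right_notMem : z ∉ Ω
  mem : ∀ p, dist p t ≤ dist t y → p ≠ y → p ≠ z → p ∈ Ω

namespace NearPair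

theorem symm (h : NearPair Ω t y z) : NearPair Ω t z y :=
  ⟨h.ne.symm, h.dist_eq.symm, h.right_notMem, h.left_notMem,
    fun p hp h1 h2 => h.mem p (h.dist_eq ▸ hp) h2 h1⟩

theorem dist_pos (h : NearPair Ω t y z) : 0 < dist t y := by
  rw [_root_.dist_pos]
  rintro rfl
  have := h.dist_eq
  rw [dist_self] at this
  exact h.ne (dist_eq_zero.1 this.symm)

theorem ball_subset (h : NearPair Ω t y z) : Metric.ball t (dist t y) ⊆ Ω := by
  intro p hp
  rw [Metric.mem_ball] at hp
  refine h.mem p hp.le ?_ ?_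
  · rintro rfl
    rw [dist_comm] at hp
    exact lt_irrefl _ hp
  · rintro rfl
    rw [dist_comm, ← h.dist_eq] at hp
    exact lt_irrefl _ hp

theorem mem_frontier (h : NearPair Ω t y z) (hΩ : IsOpen Ω) : y ∈ frontier Ω := by
  rw [hΩ.frontier_eq]
  refine ⟨closure_mono h.ball_subset ?_, h.left_notMem⟩
  rw [closure_ball _ h.dist_pos.ne', Metric.mem_closedBall, dist_comm]

theorem infDist_eq (h : NearPair Ω t y z) (hΩ : IsOpen Ω) :
    Metric.infDist t (frontier Ω) = dist t y := by
  refine le_antisymm (Metric.infDist_le_dist_of_mem (h.mem_frontier hΩ)) ?_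
  refine (Metric.le_infDist ⟨y, h.mem_frontier hΩ⟩).2 fun p hp => ?_
  by_contra hlt
  rw [hΩ.frontier_eq] at hp
  exact hp.2 (h.ball_subset (by rw [Metric.mem_ball, dist_comm]; exact not_le.1 hlt))

theorem nearPoints_eq (h : NearPair Ω t y z) (hΩ : IsOpen Ω) : nearPoints Ω t = {y, z} := by
  ext p
  simp only [nearPoints, h.infDist_eq hΩ, mem_ofPred_eq, mem_insert_iff, mem_singleton_iff]
  constructor
  · rintro ⟨hp, hd⟩
    by_contra hne
    push Not at hne
    rw [hΩ.frontier_eq] at hp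
    exact hp.2 (h.mem p (by rw [dist_comm, hd]) hne.1 hne.2)
  · rintro (rfl | rfl)
    · exact ⟨h.mem_frontier hΩ, rfl⟩
    · exact ⟨h.symm.mem_frontier hΩ, h.dist_eq.symm⟩

theorem mem_skeleton (h : NearPair Ω t y z) (hΩ : IsOpen Ω) : t ∈ skeleton Ω := by
  refine ⟨h.ball_subset (Metric.mem_ball_self h.dist_pos), ?_⟩
  rw [h.nearPoints_eq hΩ]
  exact nontrivial_pair h.ne

theorem mem_nearPoints (h : NearPair Ω t y z) (hΩ : IsOpen Ω) : y ∈ nearPoints Ω t := by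
  rw [h.nearPoints_eq hΩ]
  exact mem_insert _ _

theorem segment_point_mem (h : NearPair Ω t y z) {s : ℝ} (h0 : 0 ≤ s) (h1 : s < 1) :
    t + s • (y - t) ∈ Ω := by
  apply h.ball_subset
  rw [Metric.mem_ball, dist_self_add_left, norm_smul, Real.norm_of_nonneg h0, dist_eq_norm,
    norm_sub_rev t y]
  have : 0 < ‖y - t‖ := by rw [← dist_eq_norm, dist_comm]; exact h.dist_pos
  nlinarith

theorem tau_segment_point (h : NearPair Ω t y z) (hΩ : IsOpen Ω) {s : ℝ} (h0 : 0 ≤ s)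
    (h1 : s < 1) : tau Ω (t + s • (y - t)) = t := by
  refine tau_eq hΩ (h.segment_point_mem h0 h1) (h.mem_skeleton hΩ) (h.mem_nearPoints hΩ) ?_
  rw [segment_eq_image']
  exact ⟨s, ⟨h0, h1.le⟩, rfl⟩

end NearPair

end NearPoints

/-! ### Fans: the segments joining the points of an edge to their near points -/

/-- The cartesian coordinates of the plane. -/
def planeEquiv : Plane ≃ᵐ ℝ × ℝ :=
  (MeasurableEquiv.toLp 2 (Fin 2 → ℝ)).symm.trans MeasurableEquiv.finTwoArrow

theorem planeEquiv_apply (p : Plane) : planeEquiv p = (p 0, p 1) := rfl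

theorem measurePreserving_planeEquiv : MeasurePreserving planeEquiv volume volume :=
  (volume_preserving_finTwoArrow ℝ).comp
    (EuclideanSpace.volume_preserving_symm_measurableEquiv_toLp (Fin 2))

section Fan

/-- The point of parameter `s` on the segment from `γ u` to `y u`, where `p = (u, s)`. -/
def fan (γ y : ℝ → Plane) (p : Plane) : Plane := γ (p 0) + p 1 • (y (p 0) - γ (p 0))

/-- The Jacobian determinant of `fan`. -/
def fanJac (γ y : ℝ → Plane) (u s : ℝ) : ℝ :=
  ((1 - s) * deriv γ u 0 + s * deriv y u 0) * (y u 1 - γ u 1) -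
    ((1 - s) * deriv γ u 1 + s * deriv y u 1) * (y u 0 - γ u 0)

/-- The derivative of `fan`. -/
def fanDeriv (γ y : ℝ → Plane) (p : Plane) : Plane →L[ℝ] Plane :=
  (EuclideanSpace.proj (0 : Fin 2) : Plane →L[ℝ] ℝ).smulRight
      ((1 - p 1) • deriv γ (p 0) + p 1 • deriv y (p 0)) +
    (EuclideanSpace.proj (1 : Fin 2) : Plane →L[ℝ] ℝ).smulRight (y (p 0) - γ (p 0))

variable {γ y : ℝ → Plane}

theorem hasStrictFDerivAt_fan (hγ : ContDiff ℝ ∞ γ) (hy : ContDiff ℝ ∞ y) (p : Plane) :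
    HasStrictFDerivAt (fan γ y) (fanDeriv γ y p) p := by
  have h0 : HasStrictFDerivAt (fun q : Plane => q 0)
      (EuclideanSpace.proj (0 : Fin 2) : Plane →L[ℝ] ℝ) p :=
    (EuclideanSpace.proj (0 : Fin 2) : Plane →L[ℝ] ℝ).hasStrictFDerivAt
  have h1 : HasStrictFDerivAt (fun q : Plane => q 1)
      (EuclideanSpace.proj (1 : Fin 2) : Plane →L[ℝ] ℝ) p :=
    (EuclideanSpace.proj (1 : Fin 2) : Plane →L[ℝ] ℝ).hasStrictFDerivAt
  have hγ' : HasStrictDerivAt γ (deriv γ (p 0)) (p 0) :=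
    (hγ.contDiffAt.hasStrictDerivAt (by simp))
  have hy' : HasStrictDerivAt y (deriv y (p 0)) (p 0) :=
    (hy.contDiffAt.hasStrictDerivAt (by simp))
  have h2 := hγ'.hasStrictFDerivAt.comp p h0
  have h3 := hy'.hasStrictFDerivAt.comp p h0
  have h4 := h2.add (h1.smul (h3.sub h2))
  refine h4.congr_fderiv ?_
  ext v i
  simp [fanDeriv]
  ring

theorem det_fanDeriv (p : Plane) : (fanDeriv γ y p).det = fanJac γ y (p 0) (p 1) := by
  rw [ContinuousLinearMap.det, ← LinearMap.det_toMatrix (EuclideanSpace.basisFun (Fin 2) ℝ).toBasis,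
    Matrix.det_fin_two]
  simp [LinearMap.toMatrix_apply, fanDeriv, fanJac]
  ring

theorem continuous_fanJac (hγ : ContDiff ℝ ∞ γ) (hy : ContDiff ℝ ∞ y) :
    Continuous fun q : ℝ × ℝ => fanJac γ y q.1 q.2 := by
  have h1 : Continuous (deriv γ) := hγ.continuous_deriv (by simp)
  have h2 : Continuous (deriv y) := hy.continuous_deriv (by simp)
  have h3 := hγ.continuous
  have h4 := hy.continuous
  unfold fanJac
  fun_prop

/-- The parameters `(u, s)` with `u ∈ I`, `0 < s < 1`. -/
def fanDom (I : Set ℝ) : Set Plane := {p | p 0 ∈ I ∧ p 1 ∈ Ioo (0 : ℝ) 1}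

theorem isOpen_fanDom {I : Set ℝ} (hI : IsOpen I) : IsOpen (fanDom I) :=
  (hI.preimage (by fun_prop : Continuous fun p : Plane => p 0)).inter
    (isOpen_Ioo.preimage (by fun_prop : Continuous fun p : Plane => p 1))

theorem measurableSet_fanDom {I : Set ℝ} (hI : MeasurableSet I) : MeasurableSet (fanDom I) :=
  (hI.preimage (by fun_prop : Continuous fun p : Plane => p 0).measurable).inter
    (measurableSet_Ioo.preimage (by fun_prop : Continuous fun p : Plane => p 1).measurable)

variable {Ω : Set Plane} {I : Set ℝ}

theorem isOpen_fan_image (hγ : ContDiff ℝ ∞ γ) (hy : ContDiff ℝ ∞ y) (hI : IsOpen I)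
    (hJ : ∀ u ∈ I, ∀ s ∈ Ioo (0 : ℝ) 1, fanJac γ y u s ≠ 0) :
    IsOpen (fan γ y '' fanDom I) := by
  rw [isOpen_iff_mem_nhds]
  rintro _ ⟨p, hp, rfl⟩
  have hd : (fanDeriv γ y p).det ≠ 0 := by
    rw [det_fanDeriv]
    exact hJ _ hp.1 _ hp.2
  have h := hasStrictFDerivAt_fan hγ hy p
  rw [← (fanDeriv γ y p).coe_toContinuousLinearEquivOfDetNeZero hd] at h
  rw [← h.map_nhds_eq_of_equiv]
  exact image_mem_map ((isOpen_fanDom hI).mem_nhds hp)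

/-- The derivative of `τ` at the points of a fan. -/
theorem hasFDerivAt_tau_fan (hγ : ContDiff ℝ ∞ γ) (hy : ContDiff ℝ ∞ y) (hI : IsOpen I)
    (hJ : ∀ u ∈ I, ∀ s ∈ Ioo (0 : ℝ) 1, fanJac γ y u s ≠ 0)
    (ht : ∀ p ∈ fanDom I, tau Ω (fan γ y p) = γ (p 0)) {p : Plane} (hp : p ∈ fanDom I) :
    HasFDerivAt (tau Ω) ((innerSL ℝ ((fanJac γ y (p 0) (p 1))⁻¹ •
      (!₂[(y (p 0) - γ (p 0)) 1, -(y (p 0) - γ (p 0)) 0] : Plane))).smulRight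
        (deriv γ (p 0))) (fan γ y p) := by
  have hd : (fanDeriv γ y p).det ≠ 0 := by
    rw [det_fanDeriv]
    exact hJ _ hp.1 _ hp.2
  have h := hasStrictFDerivAt_fan hγ hy p
  have hco := (fanDeriv γ y p).coe_toContinuousLinearEquivOfDetNeZero hd
  set A := (fanDeriv γ y p).toContinuousLinearEquivOfDetNeZero hd with hA
  rw [← hco] at h
  have hinv := h.to_localInverse.hasFDerivAt
  set g := h.localInverse with hg
  have hgp : g (fan γ y p) = p := h.localInverse_apply_image
  have h0 : HasFDerivAt (fun q : Plane => q 0)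
      (EuclideanSpace.proj (0 : Fin 2) : Plane →L[ℝ] ℝ) (g (fan γ y p)) :=
    (EuclideanSpace.proj (0 : Fin 2) : Plane →L[ℝ] ℝ).hasFDerivAt
  have hγ' : HasDerivAt γ (deriv γ (p 0)) (p 0) :=
    (hγ.differentiable (by simp)).differentiableAt.hasDerivAt
  have h1 := h0.comp _ hinv
  rw [← hgp] at hγ'
  have h2 := hγ'.hasFDerivAt.comp (fan γ y p) h1
  rw [hgp] at h2
  have hev : tau Ω =ᶠ[𝓝 (fan γ y p)] fun x => γ (g x 0) := by
    have ht' : Tendsto g (𝓝 (fan γ y p)) (𝓝 p) := h.localInverse_tendsto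
    filter_upwards [h.eventually_right_inverse, ht' ((isOpen_fanDom hI).mem_nhds hp)]
      with x hx hx'
    rw [← ht _ hx', hx]
  refine (h2.congr_of_eventuallyEq hev).congr_fderiv ?_
  have hsurj : Function.Surjective (fanDeriv γ y p) := by
    rw [← hco]
    exact A.surjective
  ext1 w
  obtain ⟨v, rfl⟩ := hsurj w
  have hAv : A.symm (fanDeriv γ y p v) = v := by
    rw [← hco]
    exact A.symm_apply_apply v
  have hJp := hJ _ hp.1 _ hp.2
  simp only [ContinuousLinearMap.comp_apply, ContinuousLinearEquiv.coe_coe, hAv,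
    ContinuousLinearMap.smulRight_apply, ContinuousLinearMap.toSpanSingleton_apply]
  congr 1
  simp only [innerSL_apply_apply, inner_smul_left, PiLp.inner_apply, Fin.sum_univ_two]
  simp [fanDeriv]
  field_simp
  simp only [fanJac]
  ring

theorem gradTau_fan (hγ : ContDiff ℝ ∞ γ) (hy : ContDiff ℝ ∞ y) (hI : IsOpen I)
    (hJ : ∀ u ∈ I, ∀ s ∈ Ioo (0 : ℝ) 1, fanJac γ y u s ≠ 0)
    (ht : ∀ p ∈ fanDom I, tau Ω (fan γ y p) = γ (p 0)) {p : Plane} (hp : p ∈ fanDom I) :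
    gradTau Ω (fan γ y p) =
      ‖deriv γ (p 0)‖ * (dist (γ (p 0)) (y (p 0)) / |fanJac γ y (p 0) (p 1)|) := by
  have h := hasFDerivAt_tau_fan hγ hy hI hJ ht hp
  set n : Plane := (fanJac γ y (p 0) (p 1))⁻¹ •
      (!₂[(y (p 0) - γ (p 0)) 1, -(y (p 0) - γ (p 0)) 0] : Plane) with hn
  have hi : ∀ i, ‖gradient (fun z => tau Ω z i) (fan γ y p)‖ = |deriv γ (p 0) i| * ‖n‖ := by
    intro i
    have h1 : HasFDerivAt (fun z => tau Ω z i) ((EuclideanSpace.proj i : Plane →L[ℝ] ℝ).comp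
        ((innerSL ℝ n).smulRight (deriv γ (p 0)))) (fan γ y p) :=
      (EuclideanSpace.proj i : Plane →L[ℝ] ℝ).hasFDerivAt.comp _ h
    have h2 : (EuclideanSpace.proj i : Plane →L[ℝ] ℝ).comp
        ((innerSL ℝ n).smulRight (deriv γ (p 0))) = (deriv γ (p 0) i) • innerSL ℝ n := by
      ext v
      simp [mul_comm]
    rw [gradient, LinearIsometryEquiv.norm_map, h1.fderiv, h2, norm_smul, innerSL_apply_norm,
      Real.norm_eq_abs]
  have hnn : ‖n‖ = dist (γ (p 0)) (y (p 0)) / |fanJac γ y (p 0) (p 1)| := by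
    rw [hn, norm_smul, norm_inv, Real.norm_eq_abs, div_eq_inv_mul, EuclideanSpace.norm_eq,
      EuclideanSpace.dist_eq]
    congr 2
    simp [Real.dist_eq]
    ring
  rw [gradTau, hi, hi, ← hnn, mul_pow, mul_pow, sq_abs, sq_abs, ← add_mul,
    Real.sqrt_mul (by positivity), Real.sqrt_sq (norm_nonneg _), EuclideanSpace.norm_eq
      (deriv γ (p 0))]
  simp

/-- Integration along a segment, with the parameter rescaled to `[0, 1]`. -/
theorem integral_segment (F : Plane → ℝ) {t y : Plane} (h : 0 < dist t y) :
    ∫ s in (0 : ℝ)..dist t y, F (t + (s / dist t y) • (y - t)) =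
      dist t y * ∫ s in (0 : ℝ)..1, F (t + s • (y - t)) := by
  rw [intervalIntegral.integral_comp_div (fun s => F (t + s • (y - t))) h.ne', zero_div,
    div_self h.ne', smul_eq_mul]

theorem intervalIntegral_congr_Ioo {f g : ℝ → ℝ} (h : ∀ s ∈ Ioo (0 : ℝ) 1, f s = g s) :
    ∫ s in (0 : ℝ)..1, f s = ∫ s in (0 : ℝ)..1, g s := by
  rw [intervalIntegral.integral_of_le zero_le_one, intervalIntegral.integral_of_le zero_le_one,
    integral_Ioc_eq_integral_Ioo, integral_Ioc_eq_integral_Ioo]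
  exact setIntegral_congr_fun measurableSet_Ioo h

/-- The area of a part of a fan. -/
theorem volume_fan_image (hγ : ContDiff ℝ ∞ γ) (hy : ContDiff ℝ ∞ y)
    {B : Set ℝ} (hB : MeasurableSet B) (hinj : InjOn (fan γ y) (fanDom B)) :
    volume (fan γ y '' fanDom B) =
      ∫⁻ u in B, ENNReal.ofReal (∫ s in (0 : ℝ)..1, |fanJac γ y u s|) := by
  rw [← lintegral_abs_det_fderiv_eq_addHaar_image volume (measurableSet_fanDom hB)
    (fun p _ => (hasStrictFDerivAt_fan hγ hy p).hasFDerivAt.hasFDerivWithinAt) hinj]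
  simp_rw [det_fanDeriv]
  have hc := continuous_fanJac hγ hy
  have h1 := measurePreserving_planeEquiv.setLIntegral_comp_preimage
    (hB.prod (measurableSet_Ioo (a := (0 : ℝ)) (b := 1)))
    (f := fun q => ENNReal.ofReal |fanJac γ y q.1 q.2|) (by fun_prop)
  have h2 : planeEquiv ⁻¹' (B ×ˢ Ioo (0 : ℝ) 1) = fanDom B := rfl
  simp only [planeEquiv_apply, h2] at h1
  rw [h1, Measure.volume_eq_prod, ← Measure.prod_restrict, lintegral_prod _ (by fun_prop)]
  refine lintegral_congr fun u => ?_
  rw [intervalIntegral.integral_of_le zero_le_one, integral_Ioc_eq_integral_Ioo,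
    ofReal_integral_eq_lintegral_ofReal]
  · have : Continuous fun s => |fanJac γ y u s| :=
      (hc.comp (by fun_prop : Continuous fun s : ℝ => (u, s))).abs
    exact (this.integrableOn_Icc).mono_set Ioo_subset_Icc_self
  · exact ae_of_all _ fun s => abs_nonneg _

/-- The data of an edge of the skeleton: its points `γ u`, with `u` in the open set `I`, have the
two near points `y u` and `z u`, and the abscissa of `γ u` is `a + b u`. -/
structure FanPair (Ω : Set Plane) (I : Set ℝ) (γ y z : ℝ → Plane) (a b : ℝ) : Prop where
  isOpen_Ω : IsOpen Ω
  isOpen_I : IsOpen I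
  contDiff_γ : ContDiff ℝ ∞ γ
  contDiff_y : ContDiff ℝ ∞ y
  contDiff_z : ContDiff ℝ ∞ z
  slope_ne : b ≠ 0
  abscissa : ∀ u, γ u 0 = a + b * u
  near : ∀ u ∈ I, NearPair Ω (γ u) (y u) (z u)
  jac_left : ∀ u ∈ I, ∀ s ∈ Ioo (0 : ℝ) 1, fanJac γ y u s ≠ 0
  jac_right : ∀ u ∈ I, ∀ s ∈ Ioo (0 : ℝ) 1, fanJac γ z u s ≠ 0

namespace FanPair

variable {z : ℝ → Plane} {a b : ℝ}

theorem symm (h : FanPair Ω I γ y z a b) : FanPair Ω I γ z y a b :=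
  ⟨h.isOpen_Ω, h.isOpen_I, h.contDiff_γ, h.contDiff_z, h.contDiff_y, h.slope_ne, h.abscissa,
    fun u hu => (h.near u hu).symm, h.jac_right, h.jac_left⟩

theorem tau_fan (h : FanPair Ω I γ y z a b) {p : Plane} (hp : p ∈ fanDom I) :
    tau Ω (fan γ y p) = γ (p 0) :=
  (h.near _ hp.1).tau_segment_point h.isOpen_Ω hp.2.1.le hp.2.2

theorem fan_mem (h : FanPair Ω I γ y z a b) {p : Plane} (hp : p ∈ fanDom I) : fan γ y p ∈ Ω :=
  (h.near _ hp.1).segment_point_mem hp.2.1.le hp.2.2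

theorem injective_curve (h : FanPair Ω I γ y z a b) : Function.Injective γ := by
  intro u v huv
  have h1 : γ u 0 = γ v 0 := by rw [huv]
  rw [h.abscissa, h.abscissa] at h1
  exact mul_left_cancel₀ h.slope_ne (add_left_cancel h1)

theorem injOn_fan (h : FanPair Ω I γ y z a b) : InjOn (fan γ y) (fanDom I) := by
  intro p hp q hq hpq
  have h0 : p 0 = q 0 := h.injective_curve (by rw [← h.tau_fan hp, ← h.tau_fan hq, hpq])
  have hne : y (p 0) - γ (p 0) ≠ 0 :=
    sub_ne_zero.2 (dist_pos.1 (h.near _ hp.1).dist_pos).symm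
  have h1 : p 1 = q 1 := by
    simp only [fan, ← h0] at hpq
    exact smul_left_injective ℝ hne (add_left_cancel hpq)
  ext i
  fin_cases i
  · exact h0
  · exact h1

theorem disjoint_fan (h : FanPair Ω I γ y z a b) :
    Disjoint (fan γ y '' fanDom I) (fan γ z '' fanDom I) := by
  rw [Set.disjoint_left]
  rintro _ ⟨p, hp, rfl⟩ ⟨q, hq, hpq⟩
  have h0 : q 0 = p 0 :=
    h.injective_curve (by rw [← h.tau_fan hp, ← h.symm.tau_fan hq, hpq])
  have hn := h.near _ hp.1
  have hy := hn.mem_nearPoints h.isOpen_Ω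
  have hz := hn.symm.mem_nearPoints h.isOpen_Ω
  have hsy : fan γ y p ∈ segment ℝ (γ (p 0)) (y (p 0)) := by
    rw [segment_eq_image']
    exact ⟨p 1, ⟨hp.2.1.le, hp.2.2.le⟩, rfl⟩
  have hsz : fan γ y p ∈ segment ℝ (γ (p 0)) (z (p 0)) := by
    rw [segment_eq_image', ← hpq]
    refine ⟨q 1, ⟨hq.2.1.le, hq.2.2.le⟩, ?_⟩
    simp only [fan, h0]
  have hne : fan γ y p ≠ γ (p 0) := by
    intro he
    have h1 : p 1 • (y (p 0) - γ (p 0)) = 0 := by simpa [fan] using he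
    rcases smul_eq_zero.1 h1 with h2 | h2
    · exact hp.2.1.ne' h2
    · exact (sub_ne_zero.2 (dist_pos.1 hn.dist_pos).symm) h2
  exact hn.ne (eq_of_mem_nearPoints_of_mem_segment hy hsy hne
    (mem_nearPoints_of_mem_segment hz hsz)).symm

/-- The set of the points `x ∈ Ω` with `τ x` on the edge. -/
theorem preimage_eq (h : FanPair Ω I γ y z a b) :
    {x ∈ Ω | tau Ω x ∈ γ '' I} =
      (fan γ y '' fanDom I ∪ fan γ z '' fanDom I) ∪ γ '' I := by
  ext x
  constructor
  · rintro ⟨hx, u, hu, hut⟩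
    have hn := h.near u hu
    obtain ⟨w, hw, hxw⟩ := exists_mem_segment_of_tau_mem_skeleton
      (hut ▸ hn.mem_skeleton h.isOpen_Ω : tau Ω x ∈ skeleton Ω)
    rw [← hut, segment_eq_image'] at hxw
    rw [← hut, hn.nearPoints_eq h.isOpen_Ω] at hw
    obtain ⟨s, ⟨hs0, hs1⟩, rfl⟩ := hxw
    rcases hs0.eq_or_lt with rfl | hs0
    · right
      exact ⟨u, hu, by simp⟩
    · left
      have hs1' : s < 1 := by
        refine hs1.lt_of_ne ?_
        rintro rfl
        simp only [one_smul, add_sub_cancel] at hx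
        rcases hw with rfl | hw
        · exact hn.left_notMem hx
        · rw [mem_singleton_iff] at hw
          subst hw
          exact hn.right_notMem hx
      have hp : (!₂[u, s] : Plane) ∈ fanDom I := ⟨by simpa using hu, by simp [hs0, hs1']⟩
      rcases hw with rfl | hw
      · left
        exact ⟨_, hp, by simp [fan]⟩
      · right
        rw [mem_singleton_iff] at hw
        subst hw
        exact ⟨_, hp, by simp [fan]⟩
  · rintro ((⟨p, hp, rfl⟩ | ⟨p, hp, rfl⟩) | ⟨u, hu, rfl⟩)
    · exact ⟨h.fan_mem hp, p 0, hp.1, (h.tau_fan hp).symm⟩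
    · exact ⟨h.symm.fan_mem hp, p 0, hp.1, (h.symm.tau_fan hp).symm⟩
    · have hn := h.near u hu
      have h1 := hn.segment_point_mem le_rfl zero_lt_one
      have h2 := hn.tau_segment_point h.isOpen_Ω le_rfl zero_lt_one
      rw [zero_smul, add_zero] at h1 h2
      exact ⟨h1, u, hu, h2.symm⟩

theorem volume_curve (h : FanPair Ω I γ y z a b) : volume (γ '' I) = 0 := by
  have hd : Differentiable ℝ fun p : Plane => γ (p 0) :=
    (h.contDiff_γ.differentiable (by simp)).comp (by fun_prop)
  have h0 : volume {p : Plane | p 1 = 0} = 0 := by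
    have h1 := measurePreserving_planeEquiv.measure_preimage
      (s := univ ×ˢ {0}) (MeasurableSet.univ.prod (measurableSet_singleton 0)).nullMeasurableSet
    rw [Measure.volume_eq_prod, Measure.prod_prod, Real.volume_singleton, mul_zero] at h1
    convert h1 using 2
    ext p
    simp [planeEquiv_apply]
  refine measure_mono_null ?_
    (addHaar_image_eq_zero_of_differentiableOn_of_addHaar_eq_zero volume hd.differentiableOn h0)
  rintro _ ⟨u, -, rfl⟩
  exact ⟨!₂[u, 0], by simp, by simp⟩

/-- The part of `τ⁻¹` of the edge off the edge itself. -/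
def openPart (_ : FanPair Ω I γ y z a b) : Set Plane :=
  fan γ y '' fanDom I ∪ fan γ z '' fanDom I

theorem isOpen_openPart (h : FanPair Ω I γ y z a b) : IsOpen h.openPart :=
  (isOpen_fan_image h.contDiff_γ h.contDiff_y h.isOpen_I h.jac_left).union
    (isOpen_fan_image h.contDiff_γ h.contDiff_z h.isOpen_I h.jac_right)

theorem openPart_subset (h : FanPair Ω I γ y z a b) :
    h.openPart ⊆ {x ∈ Ω | tau Ω x ∈ γ '' I} := by
  rw [h.preimage_eq]
  exact subset_union_left

theorem preimage_ae_eq (h : FanPair Ω I γ y z a b) :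
    ({x ∈ Ω | tau Ω x ∈ γ '' I} : Set Plane) =ᵐ[volume] h.openPart := by
  rw [h.preimage_eq]
  exact union_ae_eq_left_of_ae_eq_empty (ae_eq_empty.2 h.volume_curve)

open Classical in
/-- The parameter of `τ x`. -/
def coord (h : FanPair Ω I γ y z a b) : Plane → ℝ :=
  h.openPart.piecewise (fun x => (tau Ω x 0 - a) / b) 0

theorem coord_eq (h : FanPair Ω I γ y z a b) {x : Plane} (hx : x ∈ h.openPart) {u : ℝ}
    (hu : γ u = tau Ω x) : h.coord x = u := by
  classical
  rw [coord, piecewise_eq_of_mem _ _ _ hx, ← hu, h.abscissa]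
  field_simp [h.slope_ne]
  ring

theorem coord_fan (h : FanPair Ω I γ y z a b) {p : Plane} (hp : p ∈ fanDom I) :
    h.coord (fan γ y p) = p 0 :=
  h.coord_eq (Or.inl ⟨p, hp, rfl⟩) (h.tau_fan hp).symm

theorem coord_fan' (h : FanPair Ω I γ y z a b) {p : Plane} (hp : p ∈ fanDom I) :
    h.coord (fan γ z p) = p 0 :=
  h.coord_eq (Or.inr ⟨p, hp, rfl⟩) (h.symm.tau_fan hp).symm

theorem measurable_coord (h : FanPair Ω I γ y z a b) : Measurable h.coord := by
  classical
  refine ContinuousOn.measurable_piecewise ?_ continuous_zero.continuousOn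
    h.isOpen_openPart.measurableSet
  have ht : ∀ x ∈ h.openPart, ContinuousAt (tau Ω) x := by
    rintro _ (⟨p, hp, rfl⟩ | ⟨p, hp, rfl⟩)
    · exact (hasFDerivAt_tau_fan h.contDiff_γ h.contDiff_y h.isOpen_I h.jac_left
        (fun _ hq => h.tau_fan hq) hp).continuousAt
    · exact (hasFDerivAt_tau_fan h.contDiff_γ h.contDiff_z h.isOpen_I h.jac_right
        (fun _ hq => h.symm.tau_fan hq) hp).continuousAt
  intro x hx
  have h0 : ContinuousAt (fun x => tau Ω x 0) x :=
    (by fun_prop : Continuous fun q : Plane => q 0).continuousAt.comp (ht x hx)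
  exact ((h0.sub continuousAt_const).div_const b).continuousWithinAt

/-- The density of the image under the parameter of `τ` of the area. -/
def density (_ : FanPair Ω I γ y z a b) (u : ℝ) : ℝ :=
  (∫ s in (0 : ℝ)..1, |fanJac γ y u s|) + ∫ s in (0 : ℝ)..1, |fanJac γ z u s|

theorem map_coord (h : FanPair Ω I γ y z a b) :
    Measure.map h.coord (volume.restrict h.openPart) =
      (volume.restrict I).withDensity fun u => ENNReal.ofReal (h.density u) := by
  ext B hB
  have hIB : MeasurableSet (B ∩ I) := hB.inter h.isOpen_I.measurableSet
  have hsub : fanDom (B ∩ I) ⊆ fanDom I := fun p hp => ⟨hp.1.2, hp.2⟩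
  rw [Measure.map_apply h.measurable_coord hB, withDensity_apply _ hB,
    Measure.restrict_apply (h.measurable_coord hB), Measure.restrict_restrict hB]
  have hset : h.coord ⁻¹' B ∩ h.openPart =
      fan γ y '' fanDom (B ∩ I) ∪ fan γ z '' fanDom (B ∩ I) := by
    ext x
    constructor
    · rintro ⟨hxB, ⟨p, hp, rfl⟩ | ⟨p, hp, rfl⟩⟩
      · exact Or.inl ⟨p, ⟨⟨by rw [mem_preimage, h.coord_fan hp] at hxB; exact hxB, hp.1⟩, hp.2⟩,
          rfl⟩
      · exact Or.inr ⟨p, ⟨⟨by rw [mem_preimage, h.coord_fan' hp] at hxB; exact hxB, hp.1⟩, hp.2⟩,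
          rfl⟩
    · rintro (⟨p, hp, rfl⟩ | ⟨p, hp, rfl⟩)
      · exact ⟨by rw [mem_preimage, h.coord_fan (hsub hp)]; exact hp.1.1,
          Or.inl ⟨p, hsub hp, rfl⟩⟩
      · exact ⟨by rw [mem_preimage, h.coord_fan' (hsub hp)]; exact hp.1.1,
          Or.inr ⟨p, hsub hp, rfl⟩⟩
  have hmz : MeasurableSet (fan γ z '' fanDom (B ∩ I)) :=
    measurable_image_of_fderivWithin (measurableSet_fanDom hIB)
      (fun p _ => (hasStrictFDerivAt_fan h.contDiff_γ h.contDiff_z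
        p).hasFDerivAt.hasFDerivWithinAt) (h.symm.injOn_fan.mono hsub)
  rw [hset, measure_union (h.disjoint_fan.mono (image_mono hsub) (image_mono hsub)) hmz,
    volume_fan_image h.contDiff_γ h.contDiff_y hIB (h.injOn_fan.mono hsub),
    volume_fan_image h.contDiff_γ h.contDiff_z hIB (h.symm.injOn_fan.mono hsub),
    ← lintegral_add_left]
  · refine lintegral_congr fun u => ?_
    rw [density, ENNReal.ofReal_add]
    · exact intervalIntegral.integral_nonneg zero_le_one fun s _ => abs_nonneg _
    · exact intervalIntegral.integral_nonneg zero_le_one fun s _ => abs_nonneg _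
  · have hc := continuous_fanJac h.contDiff_γ h.contDiff_y
    have : Continuous fun u => ∫ s in (0 : ℝ)..1, |fanJac γ y u s| :=
      intervalIntegral.continuous_parametric_intervalIntegral_of_continuous' hc.abs 0 1
    exact (ENNReal.continuous_ofReal.comp this).measurable

theorem continuous_density (h : FanPair Ω I γ y z a b) : Continuous h.density :=
  (intervalIntegral.continuous_parametric_intervalIntegral_of_continuous'
      (continuous_fanJac h.contDiff_γ h.contDiff_y).abs 0 1).add
    (intervalIntegral.continuous_parametric_intervalIntegral_of_continuous'
      (continuous_fanJac h.contDiff_γ h.contDiff_z).abs 0 1)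

theorem density_pos (h : FanPair Ω I γ y z a b) {u : ℝ} (hu : u ∈ I) : 0 < h.density u := by
  refine add_pos_of_pos_of_nonneg ?_
    (intervalIntegral.integral_nonneg zero_le_one fun s _ => abs_nonneg _)
  have hc : Continuous fun s => |fanJac γ y u s| :=
    ((continuous_fanJac h.contDiff_γ h.contDiff_y).comp
      (by fun_prop : Continuous fun s : ℝ => (u, s))).abs
  exact intervalIntegral.intervalIntegral_pos_of_pos_on (hc.intervalIntegrable _ _)
    (fun s hs => abs_pos.2 (h.jac_left u hu s hs)) zero_lt_one

theorem norm_deriv_pos (h : FanPair Ω I γ y z a b) (u : ℝ) : 0 < ‖deriv γ u‖ := by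
  rw [norm_pos_iff]
  intro h0
  have h1 : HasDerivAt γ (deriv γ u) u :=
    (h.contDiff_γ.differentiable (by simp)).differentiableAt.hasDerivAt
  have h2 : HasDerivAt (fun u => γ u 0) (deriv γ u 0) u :=
    (EuclideanSpace.proj (0 : Fin 2) : Plane →L[ℝ] ℝ).hasFDerivAt.comp_hasDerivAt u h1
  have h3 : HasDerivAt (fun u => γ u 0) b u := by
    simp_rw [h.abscissa]
    simpa using ((hasDerivAt_id u).const_mul b).const_add a
  have h4 := h2.unique h3
  rw [h0] at h4
  exact h.slope_ne (by simpa using h4.symm)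

theorem fibreIntegral_eq (h : FanPair Ω I γ y z a b) (F : Plane → ℝ) {u : ℝ} (hu : u ∈ I) :
    fibreIntegral Ω F (γ u) =
      dist (γ u) (y u) * (∫ s in (0 : ℝ)..1, F (fan γ y !₂[u, s])) +
      dist (γ u) (z u) * ∫ s in (0 : ℝ)..1, F (fan γ z !₂[u, s]) := by
  have hn := h.near u hu
  rw [fibreIntegral, hn.nearPoints_eq h.isOpen_Ω, finsum_mem_pair hn.ne,
    integral_segment F hn.dist_pos, integral_segment F hn.symm.dist_pos]
  simp [fan]

theorem gradTau_fan (h : FanPair Ω I γ y z a b) {p : Plane} (hp : p ∈ fanDom I) :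
    gradTau Ω (fan γ y p) =
      ‖deriv γ (p 0)‖ * (dist (γ (p 0)) (y (p 0)) / |fanJac γ y (p 0) (p 1)|) :=
  RP.gradTau_fan h.contDiff_γ h.contDiff_y h.isOpen_I h.jac_left (fun _ hq => h.tau_fan hq) hp

theorem integral_inv_gradTau (h : FanPair Ω I γ y z a b) {u : ℝ} (hu : u ∈ I) :
    dist (γ u) (y u) * (∫ s in (0 : ℝ)..1, 1 / gradTau Ω (fan γ y !₂[u, s])) * ‖deriv γ u‖ =
      ∫ s in (0 : ℝ)..1, |fanJac γ y u s| := by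
  have hl := (h.near u hu).dist_pos
  have hd := h.norm_deriv_pos u
  have : ∀ s ∈ Ioo (0 : ℝ) 1, 1 / gradTau Ω (fan γ y !₂[u, s]) =
      (dist (γ u) (y u) * ‖deriv γ u‖)⁻¹ * |fanJac γ y u s| := by
    intro s hs
    have hp : (!₂[u, s] : Plane) ∈ fanDom I := ⟨by simpa using hu, by simpa using hs⟩
    have hJ := abs_pos.2 (h.jac_left u hu s hs)
    rw [h.gradTau_fan hp]
    simp only [Matrix.cons_val_zero, Matrix.cons_val_one]
    field_simp
  rw [intervalIntegral_congr_Ioo this, intervalIntegral.integral_const_mul]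
  field_simp

/-- `α |γ'|` is the density of the image of the area. -/
theorem fibreIntegral_inv_mul_norm_deriv (h : FanPair Ω I γ y z a b) {u : ℝ} (hu : u ∈ I) :
    fibreIntegral Ω (fun x => 1 / gradTau Ω x) (γ u) * ‖deriv γ u‖ = h.density u := by
  rw [h.fibreIntegral_eq _ hu, add_mul, h.integral_inv_gradTau hu, h.symm.integral_inv_gradTau hu,
    density]

/-- If `|∇τ|` is constant on the fan, then `β` is a multiple of `α`. -/
theorem fibreIntegral_gradTau (h : FanPair Ω I γ y z a b) {c u : ℝ} (hu : u ∈ I)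
    (hy : ∀ s ∈ Ioo (0 : ℝ) 1, gradTau Ω (fan γ y !₂[u, s]) = c)
    (hz : ∀ s ∈ Ioo (0 : ℝ) 1, gradTau Ω (fan γ z !₂[u, s]) = c) (hc : c ≠ 0) :
    fibreIntegral Ω (fun x => gradTau Ω x) (γ u) =
      c ^ 2 * fibreIntegral Ω (fun x => 1 / gradTau Ω x) (γ u) := by
  have hy' : ∀ s ∈ Ioo (0 : ℝ) 1, 1 / gradTau Ω (fan γ y !₂[u, s]) = 1 / c :=
    fun s hs => by rw [hy s hs]
  have hz' : ∀ s ∈ Ioo (0 : ℝ) 1, 1 / gradTau Ω (fan γ z !₂[u, s]) = 1 / c :=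
    fun s hs => by rw [hz s hs]
  rw [h.fibreIntegral_eq _ hu, h.fibreIntegral_eq _ hu, intervalIntegral_congr_Ioo hy,
    intervalIntegral_congr_Ioo hz, intervalIntegral_congr_Ioo hy', intervalIntegral_congr_Ioo hz']
  simp only [intervalIntegral.integral_const, sub_zero, one_smul]
  field_simp

end FanPair

end Fan

/-! ### The geometry of Rooms and Passages domains -/

/-- The orientation of the axis that points into the room from the wall on a given side. -/
def Side.dir : Side → ℝ
  | .left => 1
  | .right => -1

theorem Side.dir_mul_self (s : Side) : s.dir * s.dir = 1 := by cases s <;> norm_num [Side.dir]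

theorem Side.abs_dir (s : Side) : |s.dir| = 1 := by cases s <;> norm_num [Side.dir]

theorem Side.dir_ne_zero (s : Side) : s.dir ≠ 0 := by cases s <;> norm_num [Side.dir]

theorem Half.sign_mul_self (v : Half) : v.sign * v.sign = 1 := by cases v <;> norm_num [Half.sign]

theorem Half.abs_sign (v : Half) : |v.sign| = 1 := by cases v <;> norm_num [Half.sign]

theorem Half.abs_sign_mul (v : Half) (y : ℝ) : |v.sign * y| = |y| := by
  rw [abs_mul, v.abs_sign, one_mul]

theorem Half.sign_ne_zero (v : Half) : v.sign ≠ 0 := by cases v <;> norm_num [Half.sign]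

namespace Domain

variable (P : Domain)

theorem start_succ {i : ℕ} (hi : 1 ≤ i) : P.start (i + 1) = P.start i + P.h i := by
  rw [start, start, Finset.sum_Ico_succ_top hi]

theorem strictMono_start : StrictMono fun n => P.start (n + 1) :=
  strictMono_nat_of_lt_succ fun n => by
    have h1 := P.start_succ (i := n + 1) (by omega)
    have h2 := P.h_pos (n + 1) (by omega)
    show P.start (n + 1) < P.start (n + 1 + 1)
    linarith

theorem start_lt {i j : ℕ} : P.start (i + 1) < P.start (j + 1) ↔ i < j :=
  P.strictMono_start.lt_iff_lt

theorem start_le {i j : ℕ} : P.start (i + 1) ≤ P.start (j + 1) ↔ i ≤ j :=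
  P.strictMono_start.le_iff_le

theorem start_passage (k : ℕ) : P.start (2 * k + 2) = P.start (2 * k + 1) + P.roomSide k :=
  P.start_succ (by omega)

theorem start_room (k : ℕ) : P.start (2 * k + 3) = P.start (2 * k + 2) + P.h (2 * k + 2) :=
  P.start_succ (by omega)

theorem start_room_succ (k : ℕ) :
    P.start (2 * k + 4) = P.start (2 * k + 3) + P.roomSide (k + 1) :=
  P.start_succ (by omega)

theorem roomSide_pos (k : ℕ) : 0 < P.roomSide k := P.h_pos _ (by omega)

theorem δ_lt_roomSide (k : ℕ) : P.δ (2 * k + 2) < P.roomSide k :=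
  (P.δ_lt k).trans_le (min_le_left _ _)

theorem δ_lt_roomSide_succ (k : ℕ) : P.δ (2 * k + 2) < P.roomSide (k + 1) :=
  (P.δ_lt k).trans_le (min_le_right _ _)

theorem gap_nonneg (k : ℕ) (s : Side) : 0 ≤ P.gap k s := by
  cases s with
  | left =>
    cases k with
    | zero => simp [gap]
    | succ k => exact (P.δ_pos k).le
  | right => exact (P.δ_pos k).le

theorem gap_lt_roomSide (k : ℕ) (s : Side) : P.gap k s < P.roomSide k := by
  cases s with
  | left =>
    cases k with
    | zero => simpa [gap] using P.roomSide_pos 0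
    | succ k => exact P.δ_lt_roomSide_succ k
  | right => exact P.δ_lt_roomSide k

theorem gap_mouthRoom (k : ℕ) (s : Side) : P.gap (mouthRoom k s) s = P.δ (2 * k + 2) := by
  cases s with
  | left => rfl
  | right => rfl

/-- The passage extended into the two adjacent rooms. -/
theorem mem_Omega_of_extended_passage {k : ℕ} {p : Plane} (h0 : P.start (2 * k + 1) < p 0)
    (h1 : p 0 < P.start (2 * k + 4)) (h2 : |p 1| < P.δ (2 * k + 2) / 2) : p ∈ P.Omega := by
  have h3 := P.δ_lt_roomSide k
  have h4 := P.δ_lt_roomSide_succ k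
  rcases lt_or_ge (p 0) (P.start (2 * k + 2)) with ha | ha
  · exact Or.inl (mem_iUnion.2 ⟨k, h0, ha, by rw [roomSide] at h3; linarith⟩)
  rcases le_or_gt (p 0) (P.start (2 * k + 3)) with hb | hb
  · exact Or.inr (mem_iUnion.2 ⟨k, ha, hb, h2⟩)
  · exact Or.inl (mem_iUnion.2 ⟨k + 1, hb, h1, by rw [roomSide] at h4; linarith⟩)

theorem isOpen_Omega : IsOpen P.Omega := by
  have hc0 : Continuous fun p : Plane => p 0 := by fun_prop
  have hc1 : Continuous fun p : Plane => |p 1| := by fun_prop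
  have h : P.Omega = (⋃ k, P.room k) ∪ ⋃ k, {p : Plane | P.start (2 * k + 1) < p 0 ∧
      p 0 < P.start (2 * k + 4) ∧ |p 1| < P.δ (2 * k + 2) / 2} := by
    refine Subset.antisymm (union_subset_union_right _ (iUnion_mono fun k p hp => ?_)) ?_
    · exact ⟨(P.start_lt.2 (by omega)).trans_le hp.1, hp.2.1.trans_lt (P.start_lt.2 (by omega)),
        hp.2.2⟩
    · refine union_subset subset_union_left (iUnion_subset fun k p hp => ?_)
      exact P.mem_Omega_of_extended_passage hp.1 hp.2.1 hp.2.2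
  rw [h]
  refine (isOpen_iUnion fun k => ?_).union (isOpen_iUnion fun k => ?_)
  · exact (isOpen_lt continuous_const hc0).inter
      ((isOpen_lt hc0 continuous_const).inter (isOpen_lt hc1 continuous_const))
  · exact (isOpen_lt continuous_const hc0).inter
      ((isOpen_lt hc0 continuous_const).inter (isOpen_lt hc1 continuous_const))

theorem notMem_Omega_of_room {k : ℕ} {p : Plane} (h0 : P.start (2 * k + 1) < p 0)
    (h1 : p 0 < P.start (2 * k + 2)) (h2 : P.roomSide k / 2 ≤ |p 1|) : p ∉ P.Omega := by
  rintro (h | h)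
  · obtain ⟨j, hj0, hj1, hj2⟩ := mem_iUnion.1 h
    have ha := P.start_lt.1 (h0.trans hj1)
    have hb := P.start_lt.1 (hj0.trans h1)
    obtain rfl : j = k := by omega
    exact h2.not_gt hj2
  · obtain ⟨j, hj0, hj1, hj2⟩ := mem_iUnion.1 h
    have ha := P.start_lt.1 (h0.trans_le hj1)
    have hb := P.start_lt.1 (hj0.trans_lt h1)
    omega

theorem notMem_Omega_of_passage {k : ℕ} {p : Plane} (h0 : P.start (2 * k + 2) < p 0)
    (h1 : p 0 < P.start (2 * k + 3)) (h2 : P.δ (2 * k + 2) / 2 ≤ |p 1|) : p ∉ P.Omega := by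
  rintro (h | h)
  · obtain ⟨j, hj0, hj1, hj2⟩ := mem_iUnion.1 h
    have ha := P.start_lt.1 (h0.trans hj1)
    have hb := P.start_lt.1 (hj0.trans h1)
    omega
  · obtain ⟨j, hj0, hj1, hj2⟩ := mem_iUnion.1 h
    have ha := P.start_lt.1 (h0.trans_le hj1)
    have hb := P.start_lt.1 (hj0.trans_lt h1)
    obtain rfl : j = k := by omega
    exact h2.not_gt hj2

theorem fromWall_one (k : ℕ) (s : Side) (x y : ℝ) : P.fromWall k s x y 1 = y := by
  cases s <;> rfl

/-- The abscissa of the wall on a given side of a room. -/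
def wall (k : ℕ) : Side → ℝ
  | .left => P.start (2 * k + 1)
  | .right => P.start (2 * k + 2)

theorem fromWall_zero (k : ℕ) (s : Side) (x y : ℝ) :
    P.fromWall k s x y 0 = P.wall k s + s.dir * x := by
  cases s
  · simp [fromWall, wall, Side.dir]
  · simp [fromWall, wall, Side.dir, sub_eq_add_neg]

theorem fromWall_inj {k : ℕ} {s : Side} {x y x' y' : ℝ}
    (h : P.fromWall k s x y = P.fromWall k s x' y') : x = x' ∧ y = y' := by
  have h0 : P.fromWall k s x y 0 = P.fromWall k s x' y' 0 := by rw [h]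
  have h1 : P.fromWall k s x y 1 = P.fromWall k s x' y' 1 := by rw [h]
  rw [fromWall_zero, fromWall_zero] at h0
  rw [fromWall_one, fromWall_one] at h1
  exact ⟨mul_left_cancel₀ s.dir_ne_zero (add_left_cancel h0), h1⟩

theorem exists_eq_fromWall (k : ℕ) (s : Side) (v : Half) (p : Plane) :
    ∃ x y, p = P.fromWall k s x (v.sign * y) := by
  refine ⟨s.dir * (p 0 - P.wall k s), v.sign * p 1, ?_⟩
  ext i
  fin_cases i
  · show p 0 = P.fromWall _ _ _ _ 0
    rw [fromWall_zero, ← mul_assoc, s.dir_mul_self]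
    ring
  · show p 1 = P.fromWall _ _ _ _ 1
    rw [fromWall_one, ← mul_assoc, v.sign_mul_self, one_mul]

theorem dist_fromWall (k : ℕ) (s : Side) (v : Half) (x y x' y' : ℝ) :
    dist (P.fromWall k s x (v.sign * y)) (P.fromWall k s x' (v.sign * y')) =
      √((x - x') ^ 2 + (y - y') ^ 2) := by
  rw [EuclideanSpace.dist_eq, Fin.sum_univ_two, fromWall_zero, fromWall_zero, fromWall_one,
    fromWall_one, Real.dist_eq, Real.dist_eq, sq_abs, sq_abs]
  congr 1
  linear_combination (x - x') ^ 2 * s.dir_mul_self + (y - y') ^ 2 * v.sign_mul_self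

theorem fromWall_mem_of_room {k : ℕ} {s : Side} {x y : ℝ} (h0 : 0 < x) (h1 : x < P.roomSide k)
    (h2 : |y| < P.roomSide k / 2) : P.fromWall k s x y ∈ P.Omega := by
  refine Or.inl (mem_iUnion.2 ⟨k, ?_⟩)
  have h3 := P.start_passage k
  cases s with
  | left =>
    refine ⟨?_, ?_, h2⟩
    · simpa [fromWall] using h0
    · simp only [fromWall, Matrix.cons_val_zero]
      linarith
  | right =>
    refine ⟨?_, ?_, h2⟩
    · simp only [fromWall, Matrix.cons_val_zero]
      linarith
    · simpa [fromWall] using h0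

theorem fromWall_mem_of_gap {k : ℕ} {s : Side} {x y : ℝ} (h0 : -(P.gap k s / 2) < x) (h1 : x ≤ 0)
    (h2 : |y| < P.gap k s / 2) : P.fromWall k s x y ∈ P.Omega := by
  cases s with
  | left =>
    cases k with
    | zero =>
      simp only [gap, if_true, zero_div] at h2
      exact absurd h2 (not_lt.2 (abs_nonneg y))
    | succ k =>
      change -(P.δ (2 * k + 2) / 2) < x at h0
      have h3 := P.δ_lt_roomSide k
      have h4 := P.h_pos (2 * k + 2) (by omega)
      have h5 := P.start_room_succ k
      have h6 := P.start_room k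
      have h7 := P.start_passage k
      have h8 := P.δ_pos k
      have h9 := P.roomSide_pos (k + 1)
      refine P.mem_Omega_of_extended_passage (k := k) ?_ ?_ h2
      · show P.start (2 * k + 1) < P.start (2 * k + 3) + x
        linarith
      · show P.start (2 * k + 3) + x < P.start (2 * k + 4)
        linarith
  | right =>
    change -(P.δ (2 * k + 2) / 2) < x at h0
    have h3 := P.δ_lt_roomSide_succ k
    have h4 := P.h_pos (2 * k + 2) (by omega)
    have h5 := P.start_room_succ k
    have h6 := P.start_room k
    have h7 := P.start_passage k
    have h8 := P.δ_pos k
    have h9 := P.roomSide_pos k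
    refine P.mem_Omega_of_extended_passage (k := k) ?_ ?_ h2
    · show P.start (2 * k + 1) < P.start (2 * k + 2) - x
      linarith
    · show P.start (2 * k + 2) - x < P.start (2 * k + 4)
      linarith

theorem fromWall_notMem_of_top {k : ℕ} {s : Side} {x y : ℝ} (h0 : 0 < x) (h1 : x < P.roomSide k)
    (h2 : P.roomSide k / 2 ≤ |y|) : P.fromWall k s x y ∉ P.Omega := by
  have h3 := P.start_passage k
  cases s with
  | left =>
    refine P.notMem_Omega_of_room (k := k) ?_ ?_ h2
    · simpa [fromWall] using h0
    · simp only [fromWall, Matrix.cons_val_zero]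
      linarith
  | right =>
    refine P.notMem_Omega_of_room (k := k) ?_ ?_ h2
    · simp only [fromWall, Matrix.cons_val_zero]
      linarith
    · simpa [fromWall] using h0

theorem fromWall_notMem_of_wall {k : ℕ} {s : Side} {y : ℝ} (h2 : P.gap k s / 2 ≤ |y|) :
    P.fromWall k s 0 y ∉ P.Omega := by
  cases s with
  | left =>
    have e0 : P.fromWall k .left 0 y 0 = P.start (2 * k + 1) := by simp [fromWall]
    rintro (h | h)
    · obtain ⟨j, hj0, hj1, hj2⟩ := mem_iUnion.1 h
      rw [e0] at hj0 hj1
      have ha := P.start_lt.1 hj0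
      have hb := P.start_lt.1 hj1
      omega
    · obtain ⟨j, hj0, hj1, hj2⟩ := mem_iUnion.1 h
      rw [e0] at hj0 hj1
      have ha := P.start_le.1 hj0
      have hb := P.start_le.1 hj1
      obtain rfl : k = j + 1 := by omega
      exact h2.not_gt hj2
  | right =>
    have e0 : P.fromWall k .right 0 y 0 = P.start (2 * k + 2) := by simp [fromWall]
    rintro (h | h)
    · obtain ⟨j, hj0, hj1, hj2⟩ := mem_iUnion.1 h
      rw [e0] at hj0 hj1
      have ha := P.start_lt.1 hj0
      have hb := P.start_lt.1 hj1
      omega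
    · obtain ⟨j, hj0, hj1, hj2⟩ := mem_iUnion.1 h
      rw [e0] at hj0 hj1
      have ha := P.start_le.1 hj0
      have hb := P.start_le.1 hj1
      obtain rfl : k = j := by omega
      exact h2.not_gt hj2

/-- A criterion for near points in the coordinates attached to a wall. -/
theorem nearPair_of_wall (k : ℕ) (s : Side) (v : Half) {t₀ t₁ a₀ a₁ b₀ b₁ : ℝ}
    (hne : ¬ (a₀ = b₀ ∧ a₁ = b₁))
    (hd : (t₀ - a₀) ^ 2 + (t₁ - a₁) ^ 2 = (t₀ - b₀) ^ 2 + (t₁ - b₁) ^ 2)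
    (ha : P.fromWall k s a₀ (v.sign * a₁) ∉ P.Omega)
    (hb : P.fromWall k s b₀ (v.sign * b₁) ∉ P.Omega)
    (hmem : ∀ x y, (x - t₀) ^ 2 + (y - t₁) ^ 2 ≤ (t₀ - a₀) ^ 2 + (t₁ - a₁) ^ 2 →
      ¬ (x = a₀ ∧ y = a₁) → ¬ (x = b₀ ∧ y = b₁) → P.fromWall k s x (v.sign * y) ∈ P.Omega) :
    NearPair P.Omega (P.fromWall k s t₀ (v.sign * t₁)) (P.fromWall k s a₀ (v.sign * a₁))
      (P.fromWall k s b₀ (v.sign * b₁)) := by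
  refine ⟨fun h => hne ?_, ?_, ha, hb, fun p hp h1 h2 => ?_⟩
  · obtain ⟨e1, e2⟩ := P.fromWall_inj h
    exact ⟨e1, mul_left_cancel₀ v.sign_ne_zero e2⟩
  · rw [dist_fromWall, dist_fromWall, hd]
  · obtain ⟨x, y, rfl⟩ := P.exists_eq_fromWall k s v p
    rw [dist_fromWall, dist_fromWall] at hp
    refine hmem x y ((Real.sqrt_le_sqrt_iff (by positivity)).1 hp) ?_ ?_
    · rintro ⟨rfl, rfl⟩
      exact h1 rfl
    · rintro ⟨rfl, rfl⟩
      exact h2 rfl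

theorem fromWall_mem_cases {k : ℕ} {s : Side} {v : Half} {x y : ℝ} (h1 : x < P.roomSide k)
    (hroom : 0 < x → |y| < P.roomSide k / 2)
    (hgap : x ≤ 0 → -(P.gap k s / 2) < x ∧ |y| < P.gap k s / 2) :
    P.fromWall k s x (v.sign * y) ∈ P.Omega := by
  rcases lt_or_ge 0 x with h | h
  · exact P.fromWall_mem_of_room h h1 (by rw [v.abs_sign_mul]; exact hroom h)
  · exact P.fromWall_mem_of_gap (hgap h).1 h (by rw [v.abs_sign_mul]; exact (hgap h).2)

theorem nearPair_diagonal (k : ℕ) (s : Side) (v : Half) {d : ℝ} (h0 : 0 < d)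
    (h1 : d < (P.roomSide k - P.gap k s) / 2) :
    NearPair P.Omega (P.fromWall k s d (v.sign * (P.roomSide k / 2 - d)))
      (P.fromWall k s d (v.sign * (P.roomSide k / 2)))
      (P.fromWall k s 0 (v.sign * (P.roomSide k / 2 - d))) := by
  have hg := P.gap_nonneg k s
  set h := P.roomSide k
  set g := P.gap k s
  refine P.nearPair_of_wall k s v (fun e => h0.ne' e.1) (by ring) ?_ ?_ ?_
  · exact P.fromWall_notMem_of_top h0 (by linarith)
      (by rw [v.abs_sign_mul, abs_of_pos (by linarith)])
  · exact P.fromWall_notMem_of_wall (by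
      rw [v.abs_sign_mul, abs_of_pos (by linarith)]; linarith)
  · intro x y hxy hA hB
    have hx0 : 0 < x := by
      have h2 : 0 ≤ x := by nlinarith [sq_nonneg (y - (h / 2 - d))]
      refine h2.lt_of_ne ?_
      rintro rfl
      refine hB ⟨rfl, ?_⟩
      have h3 : (y - (h / 2 - d)) ^ 2 ≤ 0 := by nlinarith
      have h4 := pow_eq_zero_iff two_ne_zero |>.1 (le_antisymm h3 (sq_nonneg _))
      linarith
    have hy : y < h / 2 := by
      have h2 : y ≤ h / 2 := by nlinarith [sq_nonneg (x - d)]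
      refine h2.lt_of_ne ?_
      rintro rfl
      refine hA ⟨?_, rfl⟩
      have h3 : (x - d) ^ 2 ≤ 0 := by nlinarith
      have h4 := pow_eq_zero_iff two_ne_zero |>.1 (le_antisymm h3 (sq_nonneg _))
      linarith
    have hy' : -(h / 2) < y := by nlinarith [sq_nonneg (x - d)]
    have hx1 : x < h := by nlinarith [sq_nonneg (y - (h / 2 - d))]
    exact P.fromWall_mem_cases hx1 (fun _ => abs_lt.2 ⟨hy', hy⟩) (fun h => absurd hx0 h.not_gt)

theorem reach_sq {h d : ℝ} (hd : 0 ≤ d) (hdh : d < h) : (2 * reach h d) ^ 2 = h ^ 2 - d ^ 2 := by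
  rw [reach, mul_div_cancel₀ _ two_ne_zero, Real.sq_sqrt]
  nlinarith

theorem reach_pos {h d : ℝ} (hd : 0 ≤ d) (hdh : d < h) : 0 < reach h d :=
  div_pos (Real.sqrt_pos.2 (by nlinarith)) two_pos

theorem nearPair_mouth (k : ℕ) (s : Side) (v : Half) (hg : 0 < P.gap k s) {u : ℝ} (h0 : 0 < u)
    (h1 : u < reach (P.roomSide k) (P.gap k s)) :
    NearPair P.Omega (P.fromWall k s u (v.sign * 0))
      (P.fromWall k s 0 (v.sign * (P.gap k s / 2)))
      (P.fromWall k s 0 (v.sign * (-(P.gap k s / 2)))) := by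
  have hgh := P.gap_lt_roomSide k s
  have hr := reach_sq hg.le hgh
  set h := P.roomSide k
  set g := P.gap k s
  set r := reach h g
  have hl : u ^ 2 + (g / 2) ^ 2 < (h / 2) ^ 2 := by nlinarith
  refine P.nearPair_of_wall k s v (fun e => by linarith [e.2]) (by ring) ?_ ?_ ?_
  · exact P.fromWall_notMem_of_wall (by rw [v.abs_sign_mul, abs_of_pos (by linarith)])
  · exact P.fromWall_notMem_of_wall (by rw [v.abs_sign_mul, abs_neg, abs_of_pos (by linarith)])
  · intro x y hxy hA hB
    have hy : |y| < h / 2 := abs_lt_of_sq_lt_sq (by nlinarith [sq_nonneg (x - u)]) (by linarith)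
    have huh : u < h / 2 := by nlinarith
    have hx1 : x - u < h / 2 := by nlinarith [sq_nonneg y]
    refine P.fromWall_mem_cases (by linarith) (fun _ => hy) (fun hx => ?_)
    have hy2 : y ^ 2 ≤ (g / 2) ^ 2 := by nlinarith
    refine ⟨by nlinarith [sq_nonneg y], ?_⟩
    have hyg : |y| ≤ g / 2 := abs_le_of_sq_le_sq hy2 (by linarith)
    refine hyg.lt_of_ne fun e => ?_
    have hx0 : x = 0 := by
      have e2 : y ^ 2 = (g / 2) ^ 2 := by rw [← e, sq_abs]
      nlinarith
    rcases abs_choice y with hc | hc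
    · exact hA ⟨hx0, by rw [← e, hc]⟩
    · exact hB ⟨hx0, by rw [← e, hc, neg_neg]⟩

theorem nearPair_parabola (k : ℕ) (s : Side) (v : Half) (hg : 0 < P.gap k s) {u : ℝ}
    (h0 : (P.roomSide k - P.gap k s) / 2 < u)
    (h1 : u < reach (P.roomSide k) (P.gap k s)) :
    NearPair P.Omega (P.fromWall k s u (v.sign * (-u ^ 2 / (P.roomSide k - P.gap k s) +
        (P.roomSide k + P.gap k s) / 4)))
      (P.fromWall k s u (v.sign * (P.roomSide k / 2)))
      (P.fromWall k s 0 (v.sign * (P.gap k s / 2))) := by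
  have hgh := P.gap_lt_roomSide k s
  have hr := reach_sq hg.le hgh
  set h := P.roomSide k
  set g := P.gap k s
  set r := reach h g
  have hm : 0 < h - g := by linarith
  set p := -u ^ 2 / (h - g) + (h + g) / 4 with hp
  have hpu : u ^ 2 = ((h + g) / 4 - p) * (h - g) := by
    rw [hp]
    field_simp
    ring
  have hu0 : 0 < u := by linarith
  have hp0 : 0 < p := by
    by_contra hc
    nlinarith
  have hpg : p < g / 2 := by
    by_contra hc
    nlinarith
  have huh : u < h / 2 := by nlinarith
  have hd : u ^ 2 + (g / 2 - p) ^ 2 = (h / 2 - p) ^ 2 := by rw [hpu]; ring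
  refine P.nearPair_of_wall k s v (fun e => hu0.ne' e.1) (by linarith [hd]) ?_ ?_ ?_
  · exact P.fromWall_notMem_of_top hu0 (by linarith)
      (by rw [v.abs_sign_mul, abs_of_pos (by linarith)])
  · exact P.fromWall_notMem_of_wall (by rw [v.abs_sign_mul, abs_of_pos (by linarith)])
  · intro x y hxy hA hB
    have hy : y < h / 2 := by
      have h2 : y ≤ h / 2 := by nlinarith [sq_nonneg (x - u)]
      refine h2.lt_of_ne ?_
      rintro rfl
      refine hA ⟨?_, rfl⟩
      have h3 : (x - u) ^ 2 ≤ 0 := by nlinarith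
      have h4 := pow_eq_zero_iff two_ne_zero |>.1 (le_antisymm h3 (sq_nonneg _))
      linarith
    have hy' : -(h / 2) < y := by nlinarith [sq_nonneg (x - u)]
    have hx1 : x - u < h / 2 := by nlinarith [sq_nonneg (y - p)]
    refine P.fromWall_mem_cases (by linarith) (fun _ => abs_lt.2 ⟨hy', hy⟩) (fun hx => ?_)
    have hy2 : (y - p) ^ 2 ≤ (g / 2 - p) ^ 2 - x ^ 2 + 2 * x * u := by nlinarith
    have hyg : (y - p) ^ 2 ≤ (g / 2 - p) ^ 2 := by nlinarith
    have hyg' : |y - p| ≤ g / 2 - p := abs_le_of_sq_le_sq hyg (by linarith)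
    rw [abs_le] at hyg'
    refine ⟨?_, abs_lt.2 ⟨by linarith, ?_⟩⟩
    · have h5 : h / 2 - p < u + (g / 2) := by nlinarith
      nlinarith [sq_nonneg (y - p)]
    · refine (by linarith : y ≤ g / 2).lt_of_ne ?_
      rintro rfl
      refine hB ⟨?_, rfl⟩
      have hxu : 0 ≤ -x * u := mul_nonneg (neg_nonneg.2 hx) hu0.le
      have hx2 : x ^ 2 ≤ 0 := by linarith
      exact pow_eq_zero_iff two_ne_zero |>.1 (le_antisymm hx2 (sq_nonneg _))

theorem nearPair_centre (k : ℕ) {u : ℝ}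
    (h0 : reach (P.roomSide k) (P.gap k .left) < u)
    (h1 : u < P.roomSide k - reach (P.roomSide k) (P.gap k .right)) :
    NearPair P.Omega (P.fromWall k .left u (Half.upper.sign * 0))
      (P.fromWall k .left u (Half.upper.sign * (P.roomSide k / 2)))
      (P.fromWall k .left u (Half.upper.sign * (-(P.roomSide k / 2)))) := by
  have hgl := P.gap_nonneg k .left
  have hgr := P.gap_nonneg k .right
  have hglh := P.gap_lt_roomSide k .left
  have hgrh := P.gap_lt_roomSide k .right
  have hrl := reach_sq hgl hglh
  have hrr := reach_sq hgr hgrh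
  have hrl0 := reach_pos hgl hglh
  have hrr0 := reach_pos hgr hgrh
  have hflip : ∀ x y, P.fromWall k .left x y = P.fromWall k .right (P.roomSide k - x) y := by
    intro x y
    ext i
    fin_cases i
    · simp [fromWall, P.start_passage k]
      ring
    · simp [fromWall]
  have hmemr := fun x y => P.fromWall_mem_of_gap (k := k) (s := .right) (x := x) (y := y)
  have hmeml := fun x y => P.fromWall_mem_of_gap (k := k) (s := .left) (x := x) (y := y)
  set h := P.roomSide k with hh
  set gl := P.gap k .left
  set gr := P.gap k .right
  set rl := reach h gl
  set rr := reach h gr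
  have hhpos : 0 < h := by linarith
  refine P.nearPair_of_wall k .left .upper (fun e => by linarith [e.2]) (by ring) ?_ ?_ ?_
  · exact P.fromWall_notMem_of_top (by linarith) (by linarith)
      (by rw [Half.abs_sign_mul, abs_of_pos (by linarith)])
  · exact P.fromWall_notMem_of_top (by linarith) (by linarith)
      (by rw [Half.abs_sign_mul, abs_neg, abs_of_pos (by linarith)])
  · intro x y hxy hA hB
    have hxy' : (x - u) ^ 2 + y ^ 2 ≤ (h / 2) ^ 2 := by nlinarith
    have hy : |y| < h / 2 := by
      have h2 : |y| ≤ h / 2 := abs_le_of_sq_le_sq (by nlinarith [sq_nonneg (x - u)]) (by linarith)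
      refine h2.lt_of_ne fun e => ?_
      have e2 : y ^ 2 = (h / 2) ^ 2 := by rw [← e, sq_abs]
      have h3 : (x - u) ^ 2 ≤ 0 := by nlinarith
      have h4 := pow_eq_zero_iff two_ne_zero |>.1 (le_antisymm h3 (sq_nonneg _))
      rcases abs_choice y with hc | hc
      · exact hA ⟨by linarith, by rw [← e, hc]⟩
      · exact hB ⟨by linarith, by rw [← e, hc, neg_neg]⟩
    have key : ∀ g r w x : ℝ, 0 ≤ g → g < h → 0 < r → (2 * r) ^ 2 = h ^ 2 - g ^ 2 → r < w →
        x ≤ 0 → (x - w) ^ 2 + y ^ 2 ≤ (h / 2) ^ 2 → -(g / 2) < x ∧ |y| < g / 2 := by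
      intro g r w x hg hgh hr hr2 hrw hx hxw
      have hrg : h - g ≤ 2 * r := by nlinarith
      refine ⟨by nlinarith [sq_nonneg y], abs_lt_of_sq_lt_sq (by nlinarith) (by linarith)⟩
    have hsgn : Half.upper.sign * y = y := by simp [Half.sign]
    rw [hsgn]
    rcases le_or_gt x 0 with hx | hx
    · obtain ⟨h2, h3⟩ := key gl rl u x hgl hglh hrl0 hrl h0 hx hxy'
      exact hmeml x y h2 hx h3
    rcases le_or_gt h x with hx' | hx'
    · obtain ⟨h2, h3⟩ := key gr rr (h - u) (h - x) hgr hgrh hrr0 hrr (by linarith) (by linarith)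
        (by linarith)
      rw [hflip]
      exact hmemr (h - x) y h2 (by linarith) h3
    · exact P.fromWall_mem_of_room hx hx' hy

theorem nearPair_passage (k : ℕ) {u : ℝ} (h0 : 0 < u) (h1 : u < P.h (2 * k + 2)) :
    NearPair P.Omega (P.fromWall k .right (-u) (Half.upper.sign * 0))
      (P.fromWall k .right (-u) (Half.upper.sign * (P.δ (2 * k + 2) / 2)))
      (P.fromWall k .right (-u) (Half.upper.sign * (-(P.δ (2 * k + 2) / 2)))) := by
  have hδ := P.δ_pos k
  have h3 := P.δ_lt_roomSide_succ k
  have h3' := P.δ_lt_roomSide k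
  have h5 := P.start_room_succ k
  have h6 := P.start_room k
  have h7 := P.start_passage k
  have hout : ∀ y, P.δ (2 * k + 2) / 2 ≤ |y| → P.fromWall k .right (-u) y ∉ P.Omega := by
    intro y hy
    refine P.notMem_Omega_of_passage (k := k) ?_ ?_ hy
    · simp only [fromWall, Matrix.cons_val_zero]
      linarith
    · simp only [fromWall, Matrix.cons_val_zero]
      linarith
  set d := P.δ (2 * k + 2) with hd
  refine P.nearPair_of_wall k .right .upper (fun e => by linarith [e.2]) (by ring) ?_ ?_ ?_
  · exact hout _ (by rw [Half.abs_sign_mul, abs_of_pos (by linarith)])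
  · exact hout _ (by rw [Half.abs_sign_mul, abs_neg, abs_of_pos (by linarith)])
  · intro x y hxy hA hB
    have hxy' : (x + u) ^ 2 + y ^ 2 ≤ (d / 2) ^ 2 := by nlinarith
    have hy : |y| < d / 2 := by
      have h2 : |y| ≤ d / 2 := abs_le_of_sq_le_sq (by nlinarith [sq_nonneg (x + u)]) (by linarith)
      refine h2.lt_of_ne fun e => ?_
      have e2 : y ^ 2 = (d / 2) ^ 2 := by rw [← e, sq_abs]
      have h3 : (x + u) ^ 2 ≤ 0 := by nlinarith
      have h4 := pow_eq_zero_iff two_ne_zero |>.1 (le_antisymm h3 (sq_nonneg _))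
      rcases abs_choice y with hc | hc
      · exact hA ⟨by linarith, by rw [← e, hc]⟩
      · exact hB ⟨by linarith, by rw [← e, hc, neg_neg]⟩
    have hxu : |x + u| ≤ d / 2 := abs_le_of_sq_le_sq (by nlinarith [sq_nonneg y]) (by linarith)
    rw [abs_le] at hxu
    refine P.mem_Omega_of_extended_passage (k := k) ?_ ?_ ?_
    · simp only [fromWall, Matrix.cons_val_zero]
      linarith
    · simp only [fromWall, Matrix.cons_val_zero]
      linarith
    · rw [fromWall_one, Half.abs_sign_mul]
      exact hy

/-! ### The fans of the edges -/

/-- A curve in the coordinates attached to a wall. -/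
def wallCurve (k : ℕ) (s : Side) (v : Half) (f g : ℝ → ℝ) (u : ℝ) : Plane :=
  P.fromWall k s (f u) (v.sign * g u)

theorem contDiff_wallCurve (k : ℕ) (s : Side) (v : Half) {f g : ℝ → ℝ} (hf : ContDiff ℝ ∞ f)
    (hg : ContDiff ℝ ∞ g) : ContDiff ℝ ∞ (P.wallCurve k s v f g) := by
  rw [contDiff_euclidean]
  intro i
  fin_cases i
  · show ContDiff ℝ ∞ fun u => P.fromWall k s (f u) (v.sign * g u) 0
    simp_rw [fromWall_zero]
    fun_prop
  · show ContDiff ℝ ∞ fun u => P.fromWall k s (f u) (v.sign * g u) 1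
    simp_rw [fromWall_one]
    fun_prop

theorem deriv_apply {γ : ℝ → Plane} (hγ : ContDiff ℝ ∞ γ) (u : ℝ) (i : Fin 2) {c : ℝ}
    (h : HasDerivAt (fun u => γ u i) c u) : deriv γ u i = c := by
  have h1 : HasDerivAt γ (deriv γ u) u :=
    (hγ.differentiable (by simp)).differentiableAt.hasDerivAt
  have h2 : HasDerivAt (fun u => γ u i) (deriv γ u i) u :=
    (EuclideanSpace.proj i : Plane →L[ℝ] ℝ).hasFDerivAt.comp_hasDerivAt u h1
  exact h2.unique h

theorem deriv_wallCurve_zero (k : ℕ) (s : Side) (v : Half) {f g : ℝ → ℝ} (hf : ContDiff ℝ ∞ f)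
    (hg : ContDiff ℝ ∞ g) (u : ℝ) : deriv (P.wallCurve k s v f g) u 0 = s.dir * deriv f u := by
  refine deriv_apply (P.contDiff_wallCurve k s v hf hg) u 0 ?_
  simp_rw [wallCurve, fromWall_zero]
  exact (((hf.differentiable (by simp)).differentiableAt.hasDerivAt).const_mul _).const_add _

theorem deriv_wallCurve_one (k : ℕ) (s : Side) (v : Half) {f g : ℝ → ℝ} (hf : ContDiff ℝ ∞ f)
    (hg : ContDiff ℝ ∞ g) (u : ℝ) : deriv (P.wallCurve k s v f g) u 1 = v.sign * deriv g u := by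
  refine deriv_apply (P.contDiff_wallCurve k s v hf hg) u 1 ?_
  simp_rw [wallCurve, fromWall_one]
  exact ((hg.differentiable (by simp)).differentiableAt.hasDerivAt).const_mul _

theorem norm_deriv_wallCurve (k : ℕ) (s : Side) (v : Half) {f g : ℝ → ℝ} (hf : ContDiff ℝ ∞ f)
    (hg : ContDiff ℝ ∞ g) (u : ℝ) :
    ‖deriv (P.wallCurve k s v f g) u‖ = √(deriv f u ^ 2 + deriv g u ^ 2) := by
  rw [EuclideanSpace.norm_eq, Fin.sum_univ_two, P.deriv_wallCurve_zero k s v hf hg,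
    P.deriv_wallCurve_one k s v hf hg, Real.norm_eq_abs, Real.norm_eq_abs, sq_abs, sq_abs]
  congr 1
  linear_combination deriv f u ^ 2 * s.dir_mul_self + deriv g u ^ 2 * v.sign_mul_self

/-- The Jacobian of a fan in the coordinates attached to a wall. -/
def wallJac (f g f₁ g₁ : ℝ → ℝ) (u t : ℝ) : ℝ :=
  ((1 - t) * deriv f u + t * deriv f₁ u) * (g₁ u - g u) -
    ((1 - t) * deriv g u + t * deriv g₁ u) * (f₁ u - f u)

theorem fanJac_wallCurve (k : ℕ) (s : Side) (v : Half) {f g f₁ g₁ : ℝ → ℝ}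
    (hf : ContDiff ℝ ∞ f) (hg : ContDiff ℝ ∞ g) (hf₁ : ContDiff ℝ ∞ f₁) (hg₁ : ContDiff ℝ ∞ g₁)
    (u t : ℝ) :
    fanJac (P.wallCurve k s v f g) (P.wallCurve k s v f₁ g₁) u t =
      s.dir * v.sign * wallJac f g f₁ g₁ u t := by
  rw [fanJac, P.deriv_wallCurve_zero k s v hf hg, P.deriv_wallCurve_zero k s v hf₁ hg₁,
    P.deriv_wallCurve_one k s v hf hg, P.deriv_wallCurve_one k s v hf₁ hg₁]
  simp only [wallCurve, fromWall_zero, fromWall_one, wallJac]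
  ring

theorem abs_fanJac_wallCurve (k : ℕ) (s : Side) (v : Half) {f g f₁ g₁ : ℝ → ℝ}
    (hf : ContDiff ℝ ∞ f) (hg : ContDiff ℝ ∞ g) (hf₁ : ContDiff ℝ ∞ f₁) (hg₁ : ContDiff ℝ ∞ g₁)
    (u t : ℝ) :
    |fanJac (P.wallCurve k s v f g) (P.wallCurve k s v f₁ g₁) u t| = |wallJac f g f₁ g₁ u t| := by
  rw [P.fanJac_wallCurve k s v hf hg hf₁ hg₁, abs_mul, abs_mul, s.abs_dir, v.abs_sign, one_mul,
    one_mul]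

theorem fanPair_of_wall (k : ℕ) (s : Side) (v : Half) {I : Set ℝ} (hI : IsOpen I)
    {f g f₁ g₁ f₂ g₂ : ℝ → ℝ} {c : ℝ} (hc : c ≠ 0) (hfc : ∀ u, f u = c * u)
    (hg : ContDiff ℝ ∞ g) (hf₁ : ContDiff ℝ ∞ f₁) (hg₁ : ContDiff ℝ ∞ g₁)
    (hf₂ : ContDiff ℝ ∞ f₂) (hg₂ : ContDiff ℝ ∞ g₂)
    (hnear : ∀ u ∈ I, NearPair P.Omega (P.wallCurve k s v f g u) (P.wallCurve k s v f₁ g₁ u)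
      (P.wallCurve k s v f₂ g₂ u))
    (hJ₁ : ∀ u ∈ I, ∀ t ∈ Ioo (0 : ℝ) 1, wallJac f g f₁ g₁ u t ≠ 0)
    (hJ₂ : ∀ u ∈ I, ∀ t ∈ Ioo (0 : ℝ) 1, wallJac f g f₂ g₂ u t ≠ 0) :
    FanPair P.Omega I (P.wallCurve k s v f g) (P.wallCurve k s v f₁ g₁)
      (P.wallCurve k s v f₂ g₂) (P.wall k s) (s.dir * c) := by
  have hf : ContDiff ℝ ∞ f := by
    rw [funext hfc]
    fun_prop
  refine ⟨P.isOpen_Omega, hI, P.contDiff_wallCurve k s v hf hg, P.contDiff_wallCurve k s v hf₁ hg₁,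
    P.contDiff_wallCurve k s v hf₂ hg₂, mul_ne_zero s.dir_ne_zero hc, fun u => ?_, hnear,
    fun u hu t ht => ?_, fun u hu t ht => ?_⟩
  · rw [wallCurve, fromWall_zero, hfc]
    ring
  · rw [P.fanJac_wallCurve k s v hf hg hf₁ hg₁]
    exact mul_ne_zero (mul_ne_zero s.dir_ne_zero v.sign_ne_zero) (hJ₁ u hu t ht)
  · rw [P.fanJac_wallCurve k s v hf hg hf₂ hg₂]
    exact mul_ne_zero (mul_ne_zero s.dir_ne_zero v.sign_ne_zero) (hJ₂ u hu t ht)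

/-- The ordinate of the parabola with the corner of a passage as focus. -/
def parabolaFun (h d u : ℝ) : ℝ := -u ^ 2 / (h - d) + (h + d) / 4

/-- The room, the wall and the half of the room that carry the coordinates used on an edge. -/
def frame : Edge → ℕ × Side × Half
  | .passage k => (k, .right, .upper)
  | .centre k => (k, .left, .upper)
  | .diagonal k s v => (k, s, v)
  | .mouth k s => (mouthRoom k s, s, .upper)
  | .parabola k s v => (mouthRoom k s, s, v)

/-- The coordinate expression of an edge. -/
def curveFun : Edge → (ℝ → ℝ) × (ℝ → ℝ)
  | .passage _ => (fun u => -u, fun _ => 0)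
  | .centre _ => (fun u => u, fun _ => 0)
  | .diagonal k _ _ => (fun u => u / √2, fun u => P.roomSide k / 2 - u / √2)
  | .mouth _ _ => (fun u => u, fun _ => 0)
  | .parabola k s _ =>
    (fun u => u, parabolaFun (P.roomSide (mouthRoom k s)) (P.δ (2 * k + 2)))

/-- The coordinate expression of the first near point of the points of an edge. -/
def nearFun₁ : Edge → (ℝ → ℝ) × (ℝ → ℝ)
  | .passage k => (fun u => -u, fun _ => P.δ (2 * k + 2) / 2)
  | .centre k => (fun u => u, fun _ => P.roomSide k / 2)
  | .diagonal k _ _ => (fun u => u / √2, fun _ => P.roomSide k / 2)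
  | .mouth k _ => (fun _ => 0, fun _ => P.δ (2 * k + 2) / 2)
  | .parabola k s _ => (fun u => u, fun _ => P.roomSide (mouthRoom k s) / 2)

/-- The coordinate expression of the second near point of the points of an edge. -/
def nearFun₂ : Edge → (ℝ → ℝ) × (ℝ → ℝ)
  | .passage k => (fun u => -u, fun _ => -(P.δ (2 * k + 2) / 2))
  | .centre k => (fun u => u, fun _ => -(P.roomSide k / 2))
  | .diagonal k _ _ => (fun _ => 0, fun u => P.roomSide k / 2 - u / √2)
  | .mouth k _ => (fun _ => 0, fun _ => -(P.δ (2 * k + 2) / 2))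
  | .parabola k _ _ => (fun _ => 0, fun _ => P.δ (2 * k + 2) / 2)

/-- The ratio of the distance from the wall to the parameter. -/
def ratio : Edge → ℝ
  | .passage _ => -1
  | .diagonal _ _ _ => 1 / √2
  | _ => 1

/-- The curve in the coordinates used on the edge `e`. -/
def frameCurve (e : Edge) (F : (ℝ → ℝ) × (ℝ → ℝ)) : ℝ → Plane :=
  P.wallCurve (frame e).1 (frame e).2.1 (frame e).2.2 F.1 F.2

theorem curve_eq (e : Edge) : P.curve e = P.frameCurve e (P.curveFun e) := by
  funext u
  cases e with
  | passage k => simp [frameCurve, frame, curveFun, wallCurve, curve, fromWall]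
  | centre k => simp [frameCurve, frame, curveFun, wallCurve, curve]
  | diagonal k s v => rfl
  | mouth k s => simp [frameCurve, frame, curveFun, wallCurve, curve]
  | parabola k s v => rfl

theorem contDiff_parabolaFun (h d : ℝ) : ContDiff ℝ ∞ (parabolaFun h d) := by
  unfold parabolaFun
  fun_prop

theorem deriv_parabolaFun (h d u : ℝ) : deriv (parabolaFun h d) u = -(2 * u) / (h - d) := by
  have : HasDerivAt (parabolaFun h d) (-(2 * u) / (h - d)) u := by
    have h1 := (((hasDerivAt_pow 2 u).neg.div_const (h - d)).add_const ((h + d) / 4))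
    refine (h1.congr_deriv (by simp)).congr_of_eventuallyEq (Eventually.of_forall fun x => ?_)
    simp [parabolaFun]
  exact this.deriv

theorem curveFun_fst (e : Edge) (u : ℝ) : (P.curveFun e).1 u = ratio e * u := by
  cases e <;> simp [curveFun, ratio]
  ring

theorem ratio_ne_zero (e : Edge) : ratio e ≠ 0 := by
  cases e <;> simp [ratio]

theorem contDiff_curveFun_snd (e : Edge) : ContDiff ℝ ∞ (P.curveFun e).2 := by
  cases e with
  | parabola k s v => exact contDiff_parabolaFun _ _
  | _ => simp only [curveFun]; fun_prop

theorem contDiff_nearFun₁ (e : Edge) :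
    ContDiff ℝ ∞ (P.nearFun₁ e).1 ∧ ContDiff ℝ ∞ (P.nearFun₁ e).2 := by
  cases e <;> simp only [nearFun₁] <;> constructor <;> fun_prop

theorem contDiff_nearFun₂ (e : Edge) :
    ContDiff ℝ ∞ (P.nearFun₂ e).1 ∧ ContDiff ℝ ∞ (P.nearFun₂ e).2 := by
  cases e <;> simp only [nearFun₂] <;> constructor <;> fun_prop

theorem isOpen_param (e : Edge) : IsOpen (P.param e) := by
  cases e <;> exact isOpen_Ioo

theorem div_sqrt_two_lt {u c : ℝ} (h : u < c / √2) : u / √2 < c / 2 := by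
  have h2 : (0 : ℝ) < √2 := by positivity
  have h3 : √2 * √2 = 2 := Real.mul_self_sqrt (by norm_num)
  rw [lt_div_iff₀ h2] at h
  rw [div_lt_iff₀ h2]
  have h4 := mul_lt_mul_of_pos_right h h2
  rw [mul_assoc, h3] at h4
  linarith

theorem nearPair_edge (e : Edge) (u : ℝ) (hu : u ∈ P.param e) :
    NearPair P.Omega (P.frameCurve e (P.curveFun e) u) (P.frameCurve e (P.nearFun₁ e) u)
      (P.frameCurve e (P.nearFun₂ e) u) := by
  cases e with
  | passage k => exact P.nearPair_passage k hu.1 hu.2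
  | centre k => exact P.nearPair_centre k hu.1 hu.2
  | diagonal k s v =>
    exact P.nearPair_diagonal k s v (d := u / √2) (div_pos hu.1 (by positivity))
      (div_sqrt_two_lt hu.2)
  | mouth k s =>
    have hg : P.gap (mouthRoom k s) s = P.δ (2 * k + 2) := P.gap_mouthRoom k s
    have h := P.nearPair_mouth (mouthRoom k s) s .upper (by rw [hg]; exact P.δ_pos k) hu.1
      (by rw [hg]; exact hu.2)
    rw [hg] at h
    exact h
  | parabola k s v =>
    have hg : P.gap (mouthRoom k s) s = P.δ (2 * k + 2) := P.gap_mouthRoom k s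
    have h := P.nearPair_parabola (mouthRoom k s) s v (by rw [hg]; exact P.δ_pos k)
      (by rw [hg]; exact hu.1) (by rw [hg]; exact hu.2)
    rw [hg] at h
    exact h

theorem δ_lt_roomSide_mouthRoom (k : ℕ) (s : Side) :
    P.δ (2 * k + 2) < P.roomSide (mouthRoom k s) := by
  rw [← P.gap_mouthRoom k s]
  exact P.gap_lt_roomSide _ _

theorem sqrt_two_inv_mul (u : ℝ) : 1 / √2 * (u / √2) = u / 2 := by
  have h3 : √2 * √2 = 2 := Real.mul_self_sqrt (by norm_num)
  field_simp
  rw [Real.sq_sqrt (by norm_num)]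
  ring

theorem wallJac_edge₁ (e : Edge) (u t : ℝ) :
    wallJac (P.curveFun e).1 (P.curveFun e).2 (P.nearFun₁ e).1 (P.nearFun₁ e).2 u t =
      match e with
      | .passage k => -(P.δ (2 * k + 2) / 2)
      | .centre k => P.roomSide k / 2
      | .diagonal _ _ _ => u / 2
      | .mouth k _ => (1 - t) * (P.δ (2 * k + 2) / 2)
      | .parabola k s _ => P.roomSide (mouthRoom k s) / 2 -
          parabolaFun (P.roomSide (mouthRoom k s)) (P.δ (2 * k + 2)) u := by
  cases e with
  | diagonal k s v =>
    simp only [wallJac, curveFun, nearFun₁]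
    rw [← sqrt_two_inv_mul u]
    simp [← add_mul]
  | parabola k s v => simp [wallJac, curveFun, nearFun₁, deriv_id'']
  | _ => simp [wallJac, curveFun, nearFun₁, deriv_id''] <;> ring

theorem wallJac_edge₂ (e : Edge) (u t : ℝ) :
    wallJac (P.curveFun e).1 (P.curveFun e).2 (P.nearFun₂ e).1 (P.nearFun₂ e).2 u t =
      match e with
      | .passage k => P.δ (2 * k + 2) / 2
      | .centre k => -(P.roomSide k / 2)
      | .diagonal _ _ _ => -(u / 2)
      | .mouth k _ => (1 - t) * (-(P.δ (2 * k + 2) / 2))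
      | .parabola k s _ => -((1 - t) * (P.roomSide (mouthRoom k s) / 2 -
          parabolaFun (P.roomSide (mouthRoom k s)) (P.δ (2 * k + 2)) u)) := by
  cases e with
  | diagonal k s v =>
    simp only [wallJac, curveFun, nearFun₂]
    rw [← sqrt_two_inv_mul u]
    simp
    ring
  | parabola k s v =>
    have := P.δ_lt_roomSide_mouthRoom k s
    simp only [wallJac, curveFun, nearFun₂, deriv_id'', deriv_parabolaFun, deriv_const]
    have h0 : P.roomSide (mouthRoom k s) - P.δ (2 * k + 2) ≠ 0 := by linarith
    simp only [parabolaFun]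
    field_simp
    ring
  | _ => simp [wallJac, curveFun, nearFun₂, deriv_id''] <;> ring

theorem parabolaFun_lt {h d : ℝ} (hd : d < h) (u : ℝ) : 0 < h / 2 - parabolaFun h d u := by
  have h0 : 0 < h - d := by linarith
  have h1 : 0 ≤ u ^ 2 / (h - d) := by positivity
  rw [parabolaFun, neg_div]
  linarith

/-- The first near point of the points of an edge. -/
def near₁ (e : Edge) : ℝ → Plane := P.frameCurve e (P.nearFun₁ e)

/-- The second near point of the points of an edge. -/
def near₂ (e : Edge) : ℝ → Plane := P.frameCurve e (P.nearFun₂ e)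

theorem fanPair (e : Edge) :
    FanPair P.Omega (P.param e) (P.curve e) (P.near₁ e) (P.near₂ e)
      (P.wall (frame e).1 (frame e).2.1) ((frame e).2.1.dir * ratio e) := by
  rw [P.curve_eq]
  refine P.fanPair_of_wall _ _ _ (P.isOpen_param e) (ratio_ne_zero e) (P.curveFun_fst e)
    (P.contDiff_curveFun_snd e) (P.contDiff_nearFun₁ e).1 (P.contDiff_nearFun₁ e).2
    (P.contDiff_nearFun₂ e).1 (P.contDiff_nearFun₂ e).2 (P.nearPair_edge e) ?_ ?_
  · intro u hu t ht
    rw [wallJac_edge₁]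
    have ht1 : 0 < 1 - t := by linarith [ht.2]
    cases e with
    | passage k => exact neg_ne_zero.2 (half_pos (P.δ_pos k)).ne'
    | centre k => exact (half_pos (P.roomSide_pos k)).ne'
    | diagonal k s v => exact (half_pos hu.1).ne'
    | mouth k s => exact (mul_pos ht1 (half_pos (P.δ_pos k))).ne'
    | parabola k s v => exact (parabolaFun_lt (P.δ_lt_roomSide_mouthRoom k s) u).ne'
  · intro u hu t ht
    rw [wallJac_edge₂]
    have ht1 : 0 < 1 - t := by linarith [ht.2]
    cases e with
    | passage k => exact (half_pos (P.δ_pos k)).ne'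
    | centre k => exact neg_ne_zero.2 (half_pos (P.roomSide_pos k)).ne'
    | diagonal k s v => exact neg_ne_zero.2 (half_pos hu.1).ne'
    | mouth k s => exact (mul_ne_zero ht1.ne' (neg_ne_zero.2 (half_pos (P.δ_pos k)).ne'))
    | parabola k s v =>
      exact neg_ne_zero.2 (mul_pos ht1 (parabolaFun_lt (P.δ_lt_roomSide_mouthRoom k s) u)).ne'

/-! ### The regular edges -/

/-- The value of `|∇τ|` on the set `τ⁻¹(e)`, for a regular edge `e`. -/
def gradConst : Edge → ℝ
  | .diagonal _ _ _ => √2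
  | _ => 1

theorem gradConst_pos (e : Edge) : 0 < gradConst e := by
  cases e <;> simp [gradConst]

theorem dist_frameCurve (e : Edge) (F G : (ℝ → ℝ) × (ℝ → ℝ)) (u : ℝ) :
    dist (P.frameCurve e F u) (P.frameCurve e G u) =
      √((F.1 u - G.1 u) ^ 2 + (F.2 u - G.2 u) ^ 2) :=
  P.dist_fromWall _ _ _ _ _ _ _

theorem contDiff_curveFun_fst (e : Edge) : ContDiff ℝ ∞ (P.curveFun e).1 := by
  rw [funext (P.curveFun_fst e)]
  fun_prop

theorem norm_deriv_curve {e : Edge} (he : ¬ e.IsSing) (u : ℝ) : ‖deriv (P.curve e) u‖ = 1 := by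
  rw [P.curve_eq, frameCurve, P.norm_deriv_wallCurve _ _ _ (P.contDiff_curveFun_fst e)
    (P.contDiff_curveFun_snd e)]
  cases e with
  | passage k => simp [curveFun]
  | centre k => simp [curveFun, deriv_id'']
  | diagonal k s v =>
    simp [curveFun]
    norm_num
  | mouth k s => exact absurd trivial he
  | parabola k s v => exact absurd trivial he

theorem gradTau_regular₁ {e : Edge} (he : ¬ e.IsSing) {u t : ℝ} (hu : u ∈ P.param e)
    (ht : t ∈ Ioo (0 : ℝ) 1) :
    gradTau P.Omega (fan (P.curve e) (P.near₁ e) !₂[u, t]) = gradConst e := by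
  have hp : (!₂[u, t] : Plane) ∈ fanDom (P.param e) := ⟨by simpa using hu, by simpa using ht⟩
  rw [(P.fanPair e).gradTau_fan hp]
  simp only [Matrix.cons_val_zero, Matrix.cons_val_one]
  rw [P.norm_deriv_curve he, P.curve_eq, near₁, dist_frameCurve, frameCurve, frameCurve,
    P.abs_fanJac_wallCurve _ _ _ (P.contDiff_curveFun_fst e)
    (P.contDiff_curveFun_snd e) (P.contDiff_nearFun₁ e).1 (P.contDiff_nearFun₁ e).2,
    wallJac_edge₁]
  cases e with
  | passage k =>
    have h := half_pos (P.δ_pos k)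
    simp [curveFun, nearFun₁, gradConst, Real.sqrt_sq_eq_abs, h.ne']
  | centre k =>
    have h := half_pos (P.roomSide_pos k)
    simp [curveFun, nearFun₁, gradConst, Real.sqrt_sq_eq_abs, (P.roomSide_pos k).ne']
  | diagonal k s v =>
    have h0 : 0 < u := hu.1
    have h3 : √2 * √2 = 2 := Real.mul_self_sqrt (by norm_num)
    simp only [curveFun, nearFun₁, gradConst]
    rw [show (u / √2 - u / √2) ^ 2 + (P.roomSide k / 2 - u / √2 - P.roomSide k / 2) ^ 2 =
      (u / √2) ^ 2 by ring, Real.sqrt_sq (by positivity), abs_of_pos (by positivity)]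
    field_simp
    linarith
  | mouth k s => exact absurd trivial he
  | parabola k s v => exact absurd trivial he

theorem gradTau_regular₂ {e : Edge} (he : ¬ e.IsSing) {u t : ℝ} (hu : u ∈ P.param e)
    (ht : t ∈ Ioo (0 : ℝ) 1) :
    gradTau P.Omega (fan (P.curve e) (P.near₂ e) !₂[u, t]) = gradConst e := by
  have hp : (!₂[u, t] : Plane) ∈ fanDom (P.param e) := ⟨by simpa using hu, by simpa using ht⟩
  rw [(P.fanPair e).symm.gradTau_fan hp]
  simp only [Matrix.cons_val_zero, Matrix.cons_val_one]
  rw [P.norm_deriv_curve he, P.curve_eq, near₂, dist_frameCurve, frameCurve, frameCurve,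
    P.abs_fanJac_wallCurve _ _ _ (P.contDiff_curveFun_fst e)
    (P.contDiff_curveFun_snd e) (P.contDiff_nearFun₂ e).1 (P.contDiff_nearFun₂ e).2,
    wallJac_edge₂]
  cases e with
  | passage k =>
    have h := half_pos (P.δ_pos k)
    simp [curveFun, nearFun₂, gradConst, Real.sqrt_sq_eq_abs, h.ne']
  | centre k =>
    have h := half_pos (P.roomSide_pos k)
    simp [curveFun, nearFun₂, gradConst, Real.sqrt_sq_eq_abs, (P.roomSide_pos k).ne']
  | diagonal k s v =>
    have h0 : 0 < u := hu.1
    have h3 : √2 * √2 = 2 := Real.mul_self_sqrt (by norm_num)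
    simp only [curveFun, nearFun₂, gradConst]
    rw [show (u / √2 - 0) ^ 2 + (P.roomSide k / 2 - u / √2 - (P.roomSide k / 2 - u / √2)) ^ 2 =
      (u / √2) ^ 2 by ring, Real.sqrt_sq (by positivity), abs_neg, abs_of_pos (by positivity)]
    field_simp
    linarith
  | mouth k s => exact absurd trivial he
  | parabola k s v => exact absurd trivial he

/-- The coefficients of the two affine functions, `σ p 0 + c` and `σ p 1 + c`, whose maximum is,
up to the factor `|∇τ|`, the parameter of `τ p`, on a regular edge. -/
def coeff : Edge → Fin 2 → ℝ × ℝ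
  | .passage k => ![(1, -P.start (2 * k + 2)), (1, -P.δ (2 * k + 2))]
  | .centre k => ![(1, -P.start (2 * k + 1)), (1, -P.roomSide k)]
  | .diagonal k s v => ![(s.dir, -(s.dir * P.wall k s)), (-v.sign, P.roomSide k / 2)]
  | _ => ![(1, 0), (1, 0)]

/-- The affine functions whose maximum is, up to a factor, the parameter of `τ p`. -/
def height (e : Edge) (i : Fin 2) (p : Plane) : ℝ := (P.coeff e i).1 * p i + (P.coeff e i).2

theorem coeff_mul_self (e : Edge) (i : Fin 2) : (P.coeff e i).1 * (P.coeff e i).1 = 1 := by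
  cases e <;> fin_cases i <;> simp [coeff, Side.dir_mul_self, Half.sign_mul_self]

theorem fan_frameCurve (e : Edge) (F G : (ℝ → ℝ) × (ℝ → ℝ)) (u t : ℝ) :
    fan (P.frameCurve e F) (P.frameCurve e G) !₂[u, t] =
      P.fromWall (frame e).1 (frame e).2.1 (F.1 u + t * (G.1 u - F.1 u))
        ((frame e).2.2.sign * (F.2 u + t * (G.2 u - F.2 u))) := by
  ext i
  fin_cases i
  · show fan _ _ _ 0 = P.fromWall _ _ _ _ 0
    simp [fan, frameCurve, wallCurve, fromWall_zero]
    ring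
  · show fan _ _ _ 1 = P.fromWall _ _ _ _ 1
    simp [fan, frameCurve, wallCurve, fromWall_one]
    ring

theorem max_height_fromWall {e : Edge} (he : ¬ e.IsSing) (x y : ℝ) :
    max (P.height e 0 (P.fromWall (frame e).1 (frame e).2.1 x ((frame e).2.2.sign * y)))
      (P.height e 1 (P.fromWall (frame e).1 (frame e).2.1 x ((frame e).2.2.sign * y))) =
      match e with
      | .passage k => max (-x) (y - P.δ (2 * k + 2))
      | .centre k => max x (y - P.roomSide k)
      | .diagonal k _ _ => max x (P.roomSide k / 2 - y)
      | _ => 0 := by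
  simp only [height, fromWall_zero, fromWall_one]
  cases e with
  | passage k =>
    simp only [frame, coeff, wall, Side.dir, Half.sign, Matrix.cons_val_zero, Matrix.cons_val_one]
    congr 1 <;> ring
  | centre k =>
    simp only [frame, coeff, wall, Side.dir, Half.sign, Matrix.cons_val_zero, Matrix.cons_val_one]
    congr 1 <;> ring
  | diagonal k s v =>
    simp only [frame, coeff, Matrix.cons_val_zero, Matrix.cons_val_one]
    congr 1
    · linear_combination x * s.dir_mul_self
    · linear_combination -y * v.sign_mul_self
  | mouth k s => exact absurd trivial he
  | parabola k s v => exact absurd trivial he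

theorem max_height_fan₁ {e : Edge} (he : ¬ e.IsSing) {u t : ℝ} (hu : u ∈ P.param e)
    (h0 : 0 ≤ t) (h1 : t < 1) :
    gradConst e * max (P.height e 0 (fan (P.curve e) (P.near₁ e) !₂[u, t]))
      (P.height e 1 (fan (P.curve e) (P.near₁ e) !₂[u, t])) = u := by
  rw [P.curve_eq, near₁, fan_frameCurve, P.max_height_fromWall he]
  cases e with
  | passage k =>
    have hδ := P.δ_pos k
    have hu0 : 0 < u := hu.1
    simp only [curveFun, nearFun₁, gradConst]
    rw [max_eq_left (by nlinarith)]
    ring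
  | centre k =>
    have hh := P.roomSide_pos k
    have hu0 : 0 < u :=
      (reach_pos (P.gap_nonneg k .left) (P.gap_lt_roomSide k .left)).trans hu.1
    simp only [curveFun, nearFun₁, gradConst]
    rw [max_eq_left (by nlinarith)]
    ring
  | diagonal k s v =>
    have hu0 : 0 < u := hu.1
    have hu2 : 0 < u / √2 := by positivity
    simp only [curveFun, nearFun₁, gradConst]
    rw [max_eq_left (by nlinarith)]
    field_simp
    ring
  | mouth k s => exact absurd trivial he
  | parabola k s v => exact absurd trivial he

theorem max_height_fan₂ {e : Edge} (he : ¬ e.IsSing) {u t : ℝ} (hu : u ∈ P.param e)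
    (h0 : 0 ≤ t) :
    gradConst e * max (P.height e 0 (fan (P.curve e) (P.near₂ e) !₂[u, t]))
      (P.height e 1 (fan (P.curve e) (P.near₂ e) !₂[u, t])) = u := by
  rw [P.curve_eq, near₂, fan_frameCurve, P.max_height_fromWall he]
  cases e with
  | passage k =>
    have hδ := P.δ_pos k
    have hu0 : 0 < u := hu.1
    simp only [curveFun, nearFun₂, gradConst]
    rw [max_eq_left (by nlinarith)]
    ring
  | centre k =>
    have hh := P.roomSide_pos k
    have hu0 : 0 < u :=
      (reach_pos (P.gap_nonneg k .left) (P.gap_lt_roomSide k .left)).trans hu.1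
    simp only [curveFun, nearFun₂, gradConst]
    rw [max_eq_left (by nlinarith)]
    ring
  | diagonal k s v =>
    have hu0 : 0 < u := hu.1
    have hu2 : 0 < u / √2 := by positivity
    simp only [curveFun, nearFun₂, gradConst]
    rw [max_eq_right (by nlinarith)]
    field_simp
    ring
  | mouth k s => exact absurd trivial he
  | parabola k s v => exact absurd trivial he

end Domain

/-! ### Weighted `L²` spaces on an open set of reals -/

section Weighted

variable {I : Set ℝ} {ρ : ℝ → ℝ}

/-- The measure `ρ du` on `I`. -/
abbrev weighted (I : Set ℝ) (ρ : ℝ → ℝ) : Measure ℝ :=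
  (volume.restrict I).withDensity fun u => ENNReal.ofReal (ρ u)

theorem volume_absolutelyContinuous_weighted (hI : IsOpen I) (hρ : Continuous ρ)
    (hpos : ∀ u ∈ I, 0 < ρ u) : volume.restrict I ≪ weighted I ρ := by
  refine withDensity_absolutelyContinuous' ?_ ?_
  · exact (ENNReal.continuous_ofReal.comp hρ).measurable.aemeasurable
  · exact (ae_restrict_iff' hI.measurableSet).2
      (ae_of_all _ fun u hu => (ENNReal.ofReal_pos.2 (hpos u hu)).ne')

theorem locallyIntegrableOn_of_Lp_weighted (hI : IsOpen I) (hρ : Continuous ρ)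
    (hpos : ∀ u ∈ I, 0 < ρ u) [IsFiniteMeasure (weighted I ρ)] (f : Lp ℂ 2 (weighted I ρ)) :
    LocallyIntegrableOn f I := by
  rw [locallyIntegrableOn_iff hI.isLocallyClosed]
  intro K hK hKc
  rcases K.eq_empty_or_nonempty with rfl | hne
  · simp
  obtain ⟨u₀, hu₀, hmin⟩ := hKc.exists_isMinOn hne hρ.continuousOn
  have hε : 0 < ρ u₀ := hpos u₀ (hK hu₀)
  have hf : Integrable f (weighted I ρ) := (Lp.memLp f).integrable (by norm_num)
  have hle : volume.restrict K ≤ (ENNReal.ofReal (ρ u₀))⁻¹ • weighted I ρ := by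
    refine Measure.le_iff.2 fun B hB => ?_
    rw [Measure.smul_apply, smul_eq_mul, withDensity_apply _ hB, Measure.restrict_apply hB,
      Measure.restrict_restrict hB]
    have h1 : ENNReal.ofReal (ρ u₀) * volume (B ∩ K) ≤
        ∫⁻ u in B ∩ I, ENNReal.ofReal (ρ u) := by
      rw [← setLIntegral_const]
      refine (setLIntegral_mono' (hB.inter hKc.measurableSet) fun u hu => ?_).trans
        (lintegral_mono_set (inter_subset_inter_right B hK))
      exact ENNReal.ofReal_le_ofReal (hmin hu.2)
    have h2 : ENNReal.ofReal (ρ u₀) ≠ 0 := (ENNReal.ofReal_pos.2 hε).ne'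
    calc volume (B ∩ K) = (ENNReal.ofReal (ρ u₀))⁻¹ * (ENNReal.ofReal (ρ u₀) * volume (B ∩ K)) := by
          rw [← mul_assoc, ENNReal.inv_mul_cancel h2 ENNReal.ofReal_ne_top, one_mul]
      _ ≤ _ := by gcongr
  exact (hf.smul_measure (ENNReal.inv_ne_top.2 (ENNReal.ofReal_pos.2 hε).ne')).mono_measure hle

/-- The pairing with a test function is continuous on the weighted `L²` space. -/
theorem exists_inner_eq_integral (hI : IsOpen I) (hρ : Continuous ρ)
    (hpos : ∀ u ∈ I, 0 < ρ u) [IsFiniteMeasure (weighted I ρ)] {φ : ℝ → ℝ} (hφ : Continuous φ)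
    (hc : HasCompactSupport φ) (hs : tsupport φ ⊆ I) :
    ∃ ψ : Lp ℂ 2 (weighted I ρ), ∀ f : Lp ℂ 2 (weighted I ρ),
      ∫ u in I, φ u • f u = ⟪ψ, f⟫_ℂ := by
  set ψ : ℝ → ℂ := fun u => ((φ u / ρ u : ℝ) : ℂ) with hψ
  have hz : ∀ u, u ∉ tsupport φ → φ u = 0 := fun u hu => image_eq_zero_of_notMem_tsupport hu
  obtain ⟨C, hC⟩ : ∃ C, ∀ u, ‖ψ u‖ ≤ C := by
    have hco : ContinuousOn (fun u => φ u / ρ u) (tsupport φ) :=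
      hφ.continuousOn.div hρ.continuousOn fun u hu => (hpos u (hs hu)).ne'
    obtain ⟨C, hC⟩ := hc.isCompact.exists_bound_of_continuousOn hco
    refine ⟨max C 0, fun u => ?_⟩
    by_cases hu : u ∈ tsupport φ
    · rw [hψ, Complex.norm_real]
      exact (hC u hu).trans (le_max_left _ _)
    · simp [hψ, hz u hu]
  have hm : Measurable ψ :=
    Complex.measurable_ofReal.comp (hφ.measurable.div hρ.measurable)
  have hL : MemLp ψ 2 (weighted I ρ) :=
    MemLp.of_bound hm.aestronglyMeasurable C (ae_of_all _ hC)
  refine ⟨hL.toLp ψ, fun f => ?_⟩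
  rw [L2.inner_def]
  have h1 : ∫ u, ⟪(hL.toLp ψ) u, f u⟫_ℂ ∂(weighted I ρ) =
      ∫ u, ⟪ψ u, f u⟫_ℂ ∂(weighted I ρ) := by
    refine integral_congr_ae ?_
    filter_upwards [hL.coeFn_toLp] with u hu
    rw [hu]
  rw [h1, integral_withDensity_eq_integral_toReal_smul
    hρ.measurable.ennreal_ofReal (ae_of_all _ fun u => ENNReal.ofReal_lt_top)]
  refine setIntegral_congr_fun hI.measurableSet fun u hu => ?_
  have hu0 := (hpos u hu)
  simp only [hψ, ENNReal.toReal_ofReal hu0.le, RCLike.inner_apply, Complex.conj_ofReal,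
    Complex.real_smul]
  push_cast
  have : (ρ u : ℂ) ≠ 0 := Complex.ofReal_ne_zero.2 hu0.ne'
  field_simp

end Weighted

theorem denseRange_of_orthogonal {V H : Type*} [AddCommMonoid V] [Module ℂ V]
    [NormedAddCommGroup H] [InnerProductSpace ℂ H] [CompleteSpace H] (J : V →ₗ[ℂ] H)
    (h : ∀ f : H, (∀ v, ⟪J v, f⟫_ℂ = 0) → f = 0) : DenseRange J := by
  have h1 : (LinearMap.range J)ᗮ = ⊥ := by
    rw [Submodule.eq_bot_iff]
    intro f hf
    exact h f fun v => (Submodule.mem_orthogonal _ _).1 hf _ ⟨v, rfl⟩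
  have h2 := (Submodule.topologicalClosure_eq_top_iff (K := LinearMap.range J)).2 h1
  have h3 := (Submodule.dense_iff_topologicalClosure_eq_top).2 h2
  exact h3

theorem denseRange_sumMap {ι : Type*} {V W : ι → Type*}
    [∀ i, NormedAddCommGroup (V i)] [∀ i, InnerProductSpace ℂ (V i)]
    [∀ i, NormedAddCommGroup (W i)] [∀ i, InnerProductSpace ℂ (W i)]
    [∀ i, CompleteSpace (W i)]
    (J : ∀ i, V i →ₗ[ℂ] W i) (hJ : ∀ i v, ‖J i v‖ ≤ ‖v‖) (hd : ∀ i, DenseRange (J i)) :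
    DenseRange (sumMap J hJ) := by
  classical
  refine denseRange_of_orthogonal (sumMap J hJ : lp V 2 →ₗ[ℂ] lp W 2) fun f hf => ?_
  ext i
  refine (hd i).eq_zero_of_inner_right ℂ fun v => ?_
  have h1 := hf (lp.single 2 i v)
  have h2 : (sumMap J hJ) (lp.single 2 i v) = lp.single 2 i (J i v) := by
    ext j
    change J j (lp.single 2 i v j) = lp.single 2 i (J i v) j
    rcases eq_or_ne j i with rfl | hne
    · rw [lp.single_apply_self, lp.single_apply_self]
    · rw [lp.single_apply_ne _ _ _ hne, lp.single_apply_ne _ _ _ hne, map_zero]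
  rw [ContinuousLinearMap.coe_coe, h2, lp.inner_single_left] at h1
  exact h1

/-! ### The Sobolev space of an essentially open set -/

section Sobolev

variable {U O : Set Plane}

/-- A smooth function with compact support as an element of `H¹`. -/
theorem exists_H1_of_contDiff {φ : Plane → ℝ} (hφ : ContDiff ℝ ∞ φ) (hc : HasCompactSupport φ) :
    ∃ p : H1 U, H1.toL2 U p =ᵐ[volume.restrict U] fun x => (φ x : ℂ) := by
  have hL : ∀ {ψ : Plane → ℝ}, Continuous ψ → HasCompactSupport ψ →
      MemLp (fun x => (ψ x : ℂ)) 2 (volume.restrict U) := fun h1 h2 =>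
    (Complex.continuous_ofReal.comp h1).memLp_of_hasCompactSupport
      (h2.comp_left (g := Complex.ofReal) rfl)
  have hd : ∀ {η : Plane → ℝ}, ContDiff ℝ ∞ η → ∀ i : Fin 2,
      Continuous fun x => fderiv ℝ η x (EuclideanSpace.single i 1) := fun hη i =>
    (hη.continuous_fderiv (by simp)).clm_apply continuous_const
  have hdc : ∀ {η : Plane → ℝ}, HasCompactSupport η → ∀ i : Fin 2,
      HasCompactSupport fun x => fderiv ℝ η x (EuclideanSpace.single i 1) := fun hη i =>
    hη.fderiv_apply ℝ _
  set p : WithLp 2 (L2 U × PiLp 2 fun _ : Fin 2 => L2 U) :=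
    WithLp.toLp 2 ((hL hφ.continuous hc).toLp _,
      WithLp.toLp 2 fun i => (hL (hd hφ i) (hdc hc i)).toLp _) with hp
  have hp1 : (p.fst : Plane → ℂ) =ᵐ[volume.restrict U] fun x => (φ x : ℂ) :=
    (hL hφ.continuous hc).coeFn_toLp
  have hp2 : ∀ i, (p.snd i : Plane → ℂ) =ᵐ[volume.restrict U]
      fun x => ((fderiv ℝ φ x (EuclideanSpace.single i 1) : ℝ) : ℂ) :=
    fun i => (hL (hd hφ i) (hdc hc i)).coeFn_toLp
  refine ⟨⟨p, ?_⟩, hp1⟩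
  intro η hη hηc hηU i
  have hz : ∀ x, x ∉ U → η x = 0 := fun x hx =>
    image_eq_zero_of_notMem_tsupport fun h => hx (hηU h)
  have hz' : ∀ x, x ∉ U → fderiv ℝ η x (EuclideanSpace.single i 1) = 0 := fun x hx => by
    rw [image_eq_zero_of_notMem_tsupport (f := fderiv ℝ η)
      fun h => hx (hηU (tsupport_fderiv_subset ℝ h))]
    rfl
  have e1 : ∫ x in U, (fderiv ℝ η x (EuclideanSpace.single i 1)) • p.fst x =
      ∫ x, ((fderiv ℝ η x (EuclideanSpace.single i 1) * φ x : ℝ) : ℂ) := by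
    refine Eq.trans (integral_congr_ae ?_)
      (setIntegral_eq_integral_of_forall_compl_eq_zero (s := U)
        (fun x hx => by rw [hz' x hx]; simp))
    filter_upwards [hp1] with x hx
    rw [hx, Complex.real_smul, Complex.ofReal_mul]
  have e2 : ∫ x in U, η x • p.snd i x =
      ∫ x, ((η x * fderiv ℝ φ x (EuclideanSpace.single i 1) : ℝ) : ℂ) := by
    refine Eq.trans (integral_congr_ae ?_)
      (setIntegral_eq_integral_of_forall_compl_eq_zero (s := U)
        (fun x hx => by rw [hz x hx]; simp))
    filter_upwards [hp2 i] with x hx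
    rw [hx, Complex.real_smul, Complex.ofReal_mul]
  rw [e1, e2, integral_complex_ofReal, integral_complex_ofReal, ← Complex.ofReal_neg]
  congr 1
  have := integral_mul_fderiv_eq_neg_fderiv_mul_of_integrable (μ := volume) (f := η) (g := φ)
    (v := EuclideanSpace.single i (1 : ℝ))
    (((hd hη i).mul hφ.continuous).integrable_of_hasCompactSupport ((hdc hηc i).mul_right))
    ((hη.continuous.mul (hd hφ i)).integrable_of_hasCompactSupport (hηc.mul_right))
    ((hη.continuous.mul hφ.continuous).integrable_of_hasCompactSupport (hηc.mul_right))
    (fun x _ => (hη.differentiable (by simp)) x) (fun x _ => (hφ.differentiable (by simp)) x)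
  rw [this, neg_neg]

theorem denseRange_toL2 (hO : IsOpen O) (hOU : U =ᵐ[volume] O) : DenseRange (H1.toL2 U) := by
  refine denseRange_of_orthogonal (V := H1 U) (H := L2 U) (H1.toL2 U) fun f hf => ?_
  have hres : volume.restrict U = volume.restrict O := Measure.restrict_congr_set hOU
  have hfl : LocallyIntegrableOn f O (volume.restrict U) := by
    have : LocallyIntegrable f (volume.restrict U) :=
      (Lp.memLp f).locallyIntegrable (by norm_num)
    exact this.locallyIntegrableOn O
  have h0 := hO.ae_eq_zero_of_integral_contDiff_smul_eq_zero hfl (fun φ hφ hc _ => by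
    obtain ⟨p, hp⟩ := exists_H1_of_contDiff (U := U) hφ hc
    have h1 := hf p
    rw [L2.inner_def] at h1
    rw [← h1]
    refine integral_congr_ae ?_
    filter_upwards [hp] with x hx
    rw [hx, RCLike.inner_apply, Complex.conj_ofReal, Complex.real_smul, mul_comm])
  rw [Lp.eq_zero_iff_ae_eq_zero]
  have hm : ∀ᵐ x ∂(volume.restrict U), x ∈ O := by
    rw [hres]
    exact ae_restrict_mem hO.measurableSet
  filter_upwards [h0, hm] with x hx hx'
  exact hx hx'

end Sobolev

namespace Domain

variable (P : Domain)

/-! ### The measures on the edges -/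

theorem muAlpha_eq (e : Edge) : P.muAlpha e = weighted (P.param e) (P.fanPair e).density := by
  refine withDensity_congr_ae ?_
  filter_upwards [ae_restrict_mem (P.isOpen_param e).measurableSet] with u hu
  rw [alpha, (P.fanPair e).fibreIntegral_inv_mul_norm_deriv hu]

theorem muBeta_eq {e : Edge} (he : ¬ e.IsSing) : P.muBeta e =
    weighted (P.param e) (fun u => gradConst e ^ 2 * (P.fanPair e).density u) := by
  refine withDensity_congr_ae ?_
  filter_upwards [ae_restrict_mem (P.isOpen_param e).measurableSet] with u hu
  rw [beta, (P.fanPair e).fibreIntegral_gradTau hu (fun s hs => P.gradTau_regular₁ he hu hs)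
    (fun s hs => P.gradTau_regular₂ he hu hs) (gradConst_pos e).ne', mul_assoc,
    (P.fanPair e).fibreIntegral_inv_mul_norm_deriv hu]

theorem muBeta_eq_smul {e : Edge} (he : ¬ e.IsSing) :
    P.muBeta e = ENNReal.ofReal (gradConst e ^ 2) • P.muAlpha e := by
  rw [P.muBeta_eq he, P.muAlpha_eq, weighted, weighted, ← withDensity_smul' _ _
    ENNReal.ofReal_ne_top]
  congr 1
  funext u
  rw [Pi.smul_apply, smul_eq_mul, ENNReal.ofReal_mul (sq_nonneg _)]

theorem isBounded_param (e : Edge) : Bornology.IsBounded (P.param e) := by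
  cases e <;> exact Metric.isBounded_Ioo _ _

instance isFiniteMeasure_muAlpha (e : Edge) : IsFiniteMeasure (P.muAlpha e) := by
  rw [P.muAlpha_eq]
  refine isFiniteMeasure_withDensity_ofReal ?_
  obtain ⟨R, hR⟩ := (P.isBounded_param e).subset_closedBall 0
  have h1 : IntegrableOn (P.fanPair e).density (Metric.closedBall 0 R) :=
    (P.fanPair e).continuous_density.continuousOn.integrableOn_compact (isCompact_closedBall _ _)
  exact (h1.mono_set hR).2

theorem isFiniteMeasure_muBeta {e : Edge} (he : ¬ e.IsSing) : IsFiniteMeasure (P.muBeta e) := by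
  rw [P.muBeta_eq_smul he]
  exact Measure.smul_finite _ ENNReal.ofReal_ne_top

theorem cell_ae_eq (e : Edge) : P.cell e =ᵐ[volume] (P.fanPair e).openPart :=
  (P.fanPair e).preimage_ae_eq

theorem restrict_cell (e : Edge) :
    volume.restrict (P.cell e) = volume.restrict (P.fanPair e).openPart :=
  Measure.restrict_congr_set (P.cell_ae_eq e)

/-- The parameter of `τ x` on the edge `e`. -/
def edgeCoord (e : Edge) : Plane → ℝ := (P.fanPair e).coord

theorem measurePreserving_edgeCoord (e : Edge) :
    MeasurePreserving (P.edgeCoord e) (volume.restrict (P.cell e)) (P.muAlpha e) :=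
  ⟨(P.fanPair e).measurable_coord, by
    rw [P.restrict_cell, P.muAlpha_eq]
    exact (P.fanPair e).map_coord⟩

theorem edgeCoord_eq (e : Edge) : ∀ᵐ x ∂(volume.restrict (P.cell e)), ∀ u ∈ P.param e,
    P.curve e u = tau P.Omega x → P.edgeCoord e x = u := by
  rw [P.restrict_cell]
  filter_upwards [ae_restrict_mem (P.fanPair e).isOpen_openPart.measurableSet] with x hx u _ hut
  exact (P.fanPair e).coord_eq hx hut

instance isFiniteMeasure_cell (e : Edge) : IsFiniteMeasure (volume.restrict (P.cell e)) := by
  refine ⟨?_⟩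
  have h := (P.measurePreserving_edgeCoord e).measure_preimage
    MeasurableSet.univ.nullMeasurableSet
  rw [preimage_univ] at h
  rw [h]
  exact measure_lt_top _ _

theorem muAlpha_univ (e : Edge) : P.muAlpha e univ = volume (P.cell e) := by
  have h := (P.measurePreserving_edgeCoord e).measure_preimage
    MeasurableSet.univ.nullMeasurableSet
  rw [← h, preimage_univ, Measure.restrict_apply_univ]

theorem volume_cell_pos {e : Edge} (he : (P.param e).Nonempty) : 0 < volume (P.cell e) := by
  obtain ⟨u, hu⟩ := he
  refine lt_of_lt_of_le ?_ (measure_mono (P.fanPair e).openPart_subset)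
  refine (P.fanPair e).isOpen_openPart.measure_pos volume ?_
  exact ⟨_, Or.inl ⟨!₂[u, 1 / 2], ⟨by simpa using hu, by norm_num⟩, rfl⟩⟩

theorem volume_absolutelyContinuous_muAlpha (e : Edge) :
    volume.restrict (P.param e) ≪ P.muAlpha e := by
  rw [P.muAlpha_eq]
  exact volume_absolutelyContinuous_weighted (P.isOpen_param e)
    (P.fanPair e).continuous_density fun u hu => (P.fanPair e).density_pos hu

theorem volume_absolutelyContinuous_muBeta {e : Edge} (he : ¬ e.IsSing) :
    volume.restrict (P.param e) ≪ P.muBeta e := by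
  rw [P.muBeta_eq he]
  exact volume_absolutelyContinuous_weighted (P.isOpen_param e)
    ((P.fanPair e).continuous_density.const_mul _)
    fun u hu => mul_pos (pow_pos (gradConst_pos e) 2) ((P.fanPair e).density_pos hu)

theorem denseRange_E1 : DenseRange P.E1 :=
  denseRange_sumMap _ _ fun e =>
    denseRange_toL2 (P.fanPair e).isOpen_openPart (P.cell_ae_eq e)

/-! ### Completeness of the spaces on the edges -/

theorem locallyIntegrableOn_alpha (e : Edge) (f : Lp ℂ 2 (P.muAlpha e)) :
    LocallyIntegrableOn f (P.param e) := by
  have key : ∀ (ν : Measure ℝ), ν = weighted (P.param e) (P.fanPair e).density →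
      IsFiniteMeasure ν → ∀ f : Lp ℂ 2 ν, LocallyIntegrableOn f (P.param e) := by
    rintro _ rfl _ f
    exact locallyIntegrableOn_of_Lp_weighted (P.isOpen_param e) (P.fanPair e).continuous_density
      (fun u hu => (P.fanPair e).density_pos hu) f
  exact key _ (P.muAlpha_eq e) inferInstance f

theorem locallyIntegrableOn_beta {e : Edge} (he : ¬ e.IsSing) (f : Lp ℂ 2 (P.muBeta e)) :
    LocallyIntegrableOn f (P.param e) := by
  have key : ∀ (ν : Measure ℝ),
      ν = weighted (P.param e) (fun u => gradConst e ^ 2 * (P.fanPair e).density u) →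
      IsFiniteMeasure ν → ∀ f : Lp ℂ 2 ν, LocallyIntegrableOn f (P.param e) := by
    rintro _ rfl _ f
    exact locallyIntegrableOn_of_Lp_weighted (P.isOpen_param e)
      ((P.fanPair e).continuous_density.const_mul _)
      (fun u hu => mul_pos (pow_pos (gradConst_pos e) 2) ((P.fanPair e).density_pos hu)) f
  exact key _ (P.muBeta_eq he) (P.isFiniteMeasure_muBeta he) f

theorem exists_inner_eq_integral_alpha (e : Edge) {φ : ℝ → ℝ} (hφ : Continuous φ)
    (hc : HasCompactSupport φ) (hs : tsupport φ ⊆ P.param e) :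
    ∃ ψ : Lp ℂ 2 (P.muAlpha e), ∀ f : Lp ℂ 2 (P.muAlpha e),
      ∫ u in P.param e, φ u • f u = ⟪ψ, f⟫_ℂ := by
  have key : ∀ (ν : Measure ℝ), ν = weighted (P.param e) (P.fanPair e).density →
      IsFiniteMeasure ν → ∃ ψ : Lp ℂ 2 ν, ∀ f : Lp ℂ 2 ν,
        ∫ u in P.param e, φ u • f u = ⟪ψ, f⟫_ℂ := by
    rintro _ rfl _
    exact exists_inner_eq_integral (P.isOpen_param e) (P.fanPair e).continuous_density
      (fun u hu => (P.fanPair e).density_pos hu) hφ hc hs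
  exact key _ (P.muAlpha_eq e) inferInstance

theorem exists_inner_eq_integral_beta {e : Edge} (he : ¬ e.IsSing) {φ : ℝ → ℝ}
    (hφ : Continuous φ) (hc : HasCompactSupport φ) (hs : tsupport φ ⊆ P.param e) :
    ∃ ψ : Lp ℂ 2 (P.muBeta e), ∀ f : Lp ℂ 2 (P.muBeta e),
      ∫ u in P.param e, φ u • f u = ⟪ψ, f⟫_ℂ := by
  have key : ∀ (ν : Measure ℝ),
      ν = weighted (P.param e) (fun u => gradConst e ^ 2 * (P.fanPair e).density u) →
      IsFiniteMeasure ν → ∃ ψ : Lp ℂ 2 ν, ∀ f : Lp ℂ 2 ν,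
        ∫ u in P.param e, φ u • f u = ⟪ψ, f⟫_ℂ := by
    rintro _ rfl _
    exact exists_inner_eq_integral (P.isOpen_param e)
      ((P.fanPair e).continuous_density.const_mul _)
      (fun u hu => mul_pos (pow_pos (gradConst_pos e) 2) ((P.fanPair e).density_pos hu)) hφ hc hs
  exact key _ (P.muBeta_eq he) (P.isFiniteMeasure_muBeta he)

theorem weakDeriv_iff {e : Edge} (he : ¬ e.IsSing) (f : Lp ℂ 2 (P.muAlpha e))
    (g : Lp ℂ 2 (P.muBeta e)) :
    P.WeakDeriv e f g ↔ ∀ φ : ℝ → ℝ, ContDiff ℝ ∞ φ → HasCompactSupport φ →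
      tsupport φ ⊆ P.param e →
      ∫ u in P.param e, deriv φ u • f u = -∫ u in P.param e, φ u • g u := by
  constructor
  · rintro ⟨F, G, hF, hG, -, -, h⟩ φ hφ hc hs
    have hF' : F =ᵐ[volume.restrict (P.param e)] f :=
      (P.volume_absolutelyContinuous_muAlpha e).ae_eq hF
    have hG' : G =ᵐ[volume.restrict (P.param e)] g :=
      (P.volume_absolutelyContinuous_muBeta he).ae_eq hG
    have e1 : ∫ u in P.param e, deriv φ u • f u = ∫ u in P.param e, deriv φ u • F u := by
      refine integral_congr_ae ?_
      filter_upwards [hF'] with u hu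
      rw [hu]
    have e2 : ∫ u in P.param e, φ u • g u = ∫ u in P.param e, φ u • G u := by
      refine integral_congr_ae ?_
      filter_upwards [hG'] with u hu
      rw [hu]
    rw [e1, e2]
    exact h φ hφ hc hs
  · intro h
    exact ⟨f, g, ae_eq_rfl, ae_eq_rfl, P.locallyIntegrableOn_alpha e f,
      P.locallyIntegrableOn_beta he g, h⟩

/-- The constant function `1` on an edge. -/
def edgeOne (e : Edge) : Lp ℂ 2 (P.muAlpha e) :=
  (memLp_const (1 : ℂ)).toLp _

theorem coeFn_smul_edgeOne (e : Edge) (c : ℂ) :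
    (c • P.edgeOne e : Lp ℂ 2 (P.muAlpha e)) =ᵐ[P.muAlpha e] fun _ => c := by
  filter_upwards [Lp.coeFn_smul c (P.edgeOne e), (memLp_const (1 : ℂ)).coeFn_toLp
    (μ := P.muAlpha e) (p := 2)] with u h1 h2
  rw [h1, Pi.smul_apply, edgeOne, h2, smul_eq_mul, mul_one]

theorem isClosed_edgeL2 (e : Edge) : IsClosed (P.edgeL2 e : Set (Lp ℂ 2 (P.muAlpha e))) := by
  by_cases he : e.IsSing
  · have h : P.edgeL2 e = Submodule.span ℂ {P.edgeOne e} := by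
      ext f
      rw [Submodule.mem_span_singleton]
      constructor
      · intro hf
        obtain ⟨c, hc⟩ := hf he
        exact ⟨c, Lp.ext ((P.coeFn_smul_edgeOne e c).trans hc.symm)⟩
      · rintro ⟨c, rfl⟩ _
        exact ⟨c, P.coeFn_smul_edgeOne e c⟩
    rw [h]
    exact Submodule.closed_of_finiteDimensional _
  · have h : (P.edgeL2 e : Set (Lp ℂ 2 (P.muAlpha e))) = univ :=
      eq_univ_of_forall fun f h => absurd h he
    rw [h]
    exact isClosed_univ

instance completeSpace_edgeL2 (e : Edge) : CompleteSpace (P.edgeL2 e) :=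
  (P.isClosed_edgeL2 e).completeSpace_coe

theorem isClosed_edgeH1 (e : Edge) :
    IsClosed (P.edgeH1 e : Set (WithLp 2 (Lp ℂ 2 (P.muAlpha e) × Lp ℂ 2 (P.muBeta e)))) := by
  have hc1 : Continuous fun p : WithLp 2 (Lp ℂ 2 (P.muAlpha e) × Lp ℂ 2 (P.muBeta e)) =>
      p.fst := by fun_prop
  have hc2 : Continuous fun p : WithLp 2 (Lp ℂ 2 (P.muAlpha e) × Lp ℂ 2 (P.muBeta e)) =>
      p.snd := by fun_prop
  by_cases he : e.IsSing
  · have h : (P.edgeH1 e : Set (WithLp 2 (Lp ℂ 2 (P.muAlpha e) × Lp ℂ 2 (P.muBeta e)))) =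
        {p | p.fst ∈ P.edgeL2 e} ∩ {p | p.snd = 0} := by
      ext p
      exact ⟨fun h => ⟨h.1, h.2.1 he⟩, fun h => ⟨h.1, fun _ => h.2, fun h' => absurd he h'⟩⟩
    rw [h]
    exact ((P.isClosed_edgeL2 e).preimage hc1).inter (isClosed_eq hc2 continuous_const)
  · have h : (P.edgeH1 e : Set (WithLp 2 (Lp ℂ 2 (P.muAlpha e) × Lp ℂ 2 (P.muBeta e)))) =
        ⋂ φ : {φ : ℝ → ℝ // ContDiff ℝ ∞ φ ∧ HasCompactSupport φ ∧ tsupport φ ⊆ P.param e},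
          {p | ∫ u in P.param e, deriv φ.1 u • p.fst u =
            -∫ u in P.param e, φ.1 u • p.snd u} := by
      ext p
      rw [mem_iInter]
      constructor
      · intro h φ
        exact (P.weakDeriv_iff he _ _).1 (h.2.2 he) φ.1 φ.2.1 φ.2.2.1 φ.2.2.2
      · intro h
        exact ⟨fun h' => absurd h' he, fun h' => absurd h' he, fun _ =>
          (P.weakDeriv_iff he _ _).2 fun φ h1 h2 h3 => h ⟨φ, h1, h2, h3⟩⟩
    rw [h]
    refine isClosed_iInter fun ⟨φ, h1, h2, h3⟩ => ?_
    obtain ⟨ψ₁, hψ₁⟩ := P.exists_inner_eq_integral_alpha e (h1.continuous_deriv (by simp))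
      h2.deriv (tsupport_deriv_subset.trans h3)
    obtain ⟨ψ₂, hψ₂⟩ := P.exists_inner_eq_integral_beta he h1.continuous h2 h3
    simp only [hψ₁, hψ₂]
    exact isClosed_eq (continuous_const.inner hc1) (continuous_const.inner hc2).neg

instance completeSpace_edgeH1 (e : Edge) : CompleteSpace (P.edgeH1 e) :=
  (P.isClosed_edgeH1 e).completeSpace_coe

/-! ### Density of `H̃¹(Γ)` in `L̃²(Γ)` -/

theorem exists_edgeH1_of_contDiff {e : Edge} (he : ¬ e.IsSing) {φ : ℝ → ℝ}
    (hφ : ContDiff ℝ ∞ φ) (hc : HasCompactSupport φ) :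
    ∃ p : P.edgeH1 e, p.1.fst =ᵐ[P.muAlpha e] fun u => (φ u : ℂ) := by
  have := P.isFiniteMeasure_muBeta he
  have hL : ∀ {ψ : ℝ → ℝ} (ν : Measure ℝ) [IsFiniteMeasure ν], Continuous ψ →
      HasCompactSupport ψ → MemLp (fun x => (ψ x : ℂ)) 2 ν := fun ν _ h1 h2 =>
    (Complex.continuous_ofReal.comp h1).memLp_of_hasCompactSupport
      (h2.comp_left (g := Complex.ofReal) rfl)
  have hd : Continuous (deriv φ) := hφ.continuous_deriv (by simp)
  set p : WithLp 2 (Lp ℂ 2 (P.muAlpha e) × Lp ℂ 2 (P.muBeta e)) :=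
    WithLp.toLp 2 ((hL _ hφ.continuous hc).toLp _, (hL _ hd hc.deriv).toLp _)
  have hp1 : (p.fst : ℝ → ℂ) =ᵐ[P.muAlpha e] fun x => (φ x : ℂ) :=
    (hL _ hφ.continuous hc).coeFn_toLp
  have hp2 : (p.snd : ℝ → ℂ) =ᵐ[P.muBeta e] fun x => ((deriv φ x : ℝ) : ℂ) :=
    (hL _ hd hc.deriv).coeFn_toLp
  refine ⟨⟨p, fun h => absurd h he, fun h => absurd h he, fun _ => ?_⟩, hp1⟩
  refine ⟨fun x => (φ x : ℂ), fun x => ((deriv φ x : ℝ) : ℂ), hp1.symm, hp2.symm,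
    (Complex.continuous_ofReal.comp hφ.continuous).locallyIntegrable.locallyIntegrableOn _,
    (Complex.continuous_ofReal.comp hd).locallyIntegrable.locallyIntegrableOn _, ?_⟩
  intro η hη hηc hηs
  have hdη : Continuous (deriv η) := hη.continuous_deriv (by simp)
  have hz : ∀ x, x ∉ P.param e → η x = 0 := fun x hx =>
    image_eq_zero_of_notMem_tsupport fun h => hx (hηs h)
  have hz' : ∀ x, x ∉ P.param e → deriv η x = 0 := fun x hx =>
    image_eq_zero_of_notMem_tsupport fun h => hx (hηs (tsupport_deriv_subset h))
  rw [setIntegral_eq_integral_of_forall_compl_eq_zero (fun x hx => by rw [hz' x hx, zero_smul]),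
    setIntegral_eq_integral_of_forall_compl_eq_zero (fun x hx => by rw [hz x hx, zero_smul])]
  simp only [Complex.real_smul, ← Complex.ofReal_mul]
  rw [integral_complex_ofReal, integral_complex_ofReal, ← Complex.ofReal_neg]
  congr 1
  have := integral_mul_deriv_eq_deriv_mul_of_integrable (u := η) (v := φ) (u' := deriv η)
    (v' := deriv φ) (fun x _ => (hη.differentiable (by simp) x).hasDerivAt)
    (fun x _ => (hφ.differentiable (by simp) x).hasDerivAt)
    ((hη.continuous.mul hd).integrable_of_hasCompactSupport (hηc.mul_right))
    ((hdη.mul hφ.continuous).integrable_of_hasCompactSupport (hηc.deriv.mul_right))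
    ((hη.continuous.mul hφ.continuous).integrable_of_hasCompactSupport (hηc.mul_right))
  rw [this, neg_neg]

theorem denseRange_edgeH1_toL2 (e : Edge) : DenseRange (edgeH1.toL2 P e) := by
  by_cases he : e.IsSing
  · refine Function.Surjective.denseRange fun f => ?_
    exact ⟨⟨WithLp.toLp 2 (f.1, 0), f.2, fun _ => rfl, fun h => absurd he h⟩, rfl⟩
  · refine denseRange_of_orthogonal (edgeH1.toL2 P e) fun f hf => ?_
    have hfl : LocallyIntegrableOn (f.1 : ℝ → ℂ) (P.param e) (P.muAlpha e) :=
      ((Lp.memLp f.1).locallyIntegrable (by norm_num)).locallyIntegrableOn _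
    have h0 := (P.isOpen_param e).ae_eq_zero_of_integral_contDiff_smul_eq_zero hfl
      (fun φ hφ hc _ => by
        obtain ⟨p, hp⟩ := P.exists_edgeH1_of_contDiff he hφ hc
        have h1 : ⟪p.1.fst, f.1⟫_ℂ = 0 := hf p
        rw [L2.inner_def] at h1
        rw [← h1]
        refine integral_congr_ae ?_
        filter_upwards [hp] with x hx
        rw [hx, RCLike.inner_apply, Complex.conj_ofReal, Complex.real_smul, mul_comm])
    ext1
    refine (Lp.eq_zero_iff_ae_eq_zero).2 ?_
    have hm : ∀ᵐ u ∂(P.muAlpha e), u ∈ P.param e :=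
      (withDensity_absolutelyContinuous _ _).ae_le
        (ae_restrict_mem (P.isOpen_param e).measurableSet)
    filter_upwards [h0, hm] with x hx hx'
    exact hx hx'

theorem denseRange_EGamma : DenseRange P.EGamma :=
  denseRange_sumMap _ _ P.denseRange_edgeH1_toL2

end Domain

/-! ### Weak derivatives of functions of `max a b` -/

section Max

variable {Φ : ℝ × ℝ → ℝ}

theorem hasDerivAt_comp_line (hΦ : ContDiff ℝ ∞ Φ) {c : ℝ → ℝ × ℝ} {v : ℝ × ℝ} {a : ℝ}
    (hc : HasDerivAt c v a) : HasDerivAt (fun x => Φ (c x)) (fderiv ℝ Φ (c a) v) a :=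
  (hΦ.differentiable (by simp) (c a)).hasFDerivAt.comp_hasDerivAt a hc

theorem integral_Iic_fderiv_fst (hΦ : ContDiff ℝ ∞ Φ) (hc : HasCompactSupport Φ) (b : ℝ) :
    ∫ a in Iic b, fderiv ℝ Φ (a, b) (1, 0) = Φ (b, b) := by
  have h1 : HasCompactSupport fun a => Φ (a, b) :=
    hc.comp_isClosedEmbedding (g := fun a : ℝ => (a, b))
      (Function.LeftInverse.isClosedEmbedding (f := Prod.fst) (fun _ => rfl) continuous_fst
        (by fun_prop))
  have h2 : ContDiff ℝ 1 fun a => Φ (a, b) :=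
    (hΦ.comp (contDiff_id.prodMk contDiff_const)).of_le (by simp)
  rw [← h1.integral_Iic_deriv_eq h2 b]
  congr 1 with a
  exact (hasDerivAt_comp_line hΦ ((hasDerivAt_id a).prodMk (hasDerivAt_const a b))).deriv.symm

theorem integral_Iio_fderiv_snd (hΦ : ContDiff ℝ ∞ Φ) (hc : HasCompactSupport Φ) (a : ℝ) :
    ∫ b in Iio a, fderiv ℝ Φ (a, b) (0, 1) = Φ (a, a) := by
  have h1 : HasCompactSupport fun b => Φ (a, b) :=
    hc.comp_isClosedEmbedding (g := fun b : ℝ => (a, b))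
      (Function.LeftInverse.isClosedEmbedding (f := Prod.snd) (fun _ => rfl) continuous_snd
        (by fun_prop))
  have h2 : ContDiff ℝ 1 fun b => Φ (a, b) :=
    (hΦ.comp (contDiff_const.prodMk contDiff_id)).of_le (by simp)
  rw [← integral_Iic_eq_integral_Iio, ← h1.integral_Iic_deriv_eq h2 a]
  congr 1 with b
  exact (hasDerivAt_comp_line hΦ ((hasDerivAt_const b a).prodMk (hasDerivAt_id b))).deriv.symm

/-- Integration over the region `b < a` along the lines parallel to the diagonal. -/
theorem setIntegral_lt_eq {H : ℝ × ℝ → ℂ} (hH : Integrable H) :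
    ∫ q in {q : ℝ × ℝ | q.2 < q.1}, H q = ∫ r in Iio 0, ∫ a, H (a, a + r) := by
  have hS : MeasurableSet {q : ℝ × ℝ | q.2 < q.1} := measurableSet_lt measurable_snd measurable_fst
  have hmp : MeasurePreserving (fun z : ℝ × ℝ => (z.1, z.1 + z.2)) volume volume :=
    measurePreserving_prod_add volume volume
  have hme : MeasurableEmbedding (fun z : ℝ × ℝ => (z.1, z.1 + z.2)) :=
    (MeasurableEquiv.shearAddRight ℝ).measurableEmbedding
  rw [← integral_indicator hS, ← hmp.integral_comp hme, ← integral_indicator measurableSet_Iio,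
    Measure.volume_eq_prod, integral_prod_symm]
  · congr 1 with r
    by_cases hr : r < 0
    · rw [indicator_of_mem (show r ∈ Iio 0 from hr)]
      congr 1 with a
      rw [indicator_of_mem]
      simpa using hr
    · rw [indicator_of_notMem (show r ∉ Iio 0 from hr)]
      refine integral_eq_zero_of_ae (ae_of_all _ fun a => ?_)
      refine indicator_of_notMem ?_ H
      simpa using hr
  · exact hmp.integrable_comp_of_integrable (hH.indicator hS)

/-- The chain rule for `f (max a b)`: if `g` is the weak derivative of `f`, then the weak partial
derivative with respect to `a` is `g (max a b)` for `b < a` and zero elsewhere. -/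
theorem integral_fderiv_smul_max {I : Set ℝ} {f g : ℝ → ℂ}
    (hw : ∀ η : ℝ → ℝ, ContDiff ℝ ∞ η → HasCompactSupport η → tsupport η ⊆ I →
      ∫ a, deriv η a • f a = -∫ a, η a • g a)
    (hΦ : ContDiff ℝ ∞ Φ) (hc : HasCompactSupport Φ) (hs : ∀ q ∈ tsupport Φ, max q.1 q.2 ∈ I)
    (hf : ∀ ψ : ℝ × ℝ → ℝ, Continuous ψ → tsupport ψ ⊆ tsupport Φ →
      Integrable fun q => ψ q • f (max q.1 q.2))
    (hg : Integrable fun q => Φ q • g (max q.1 q.2)) :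
    ∫ q, fderiv ℝ Φ q (1, 0) • f (max q.1 q.2) =
      -∫ q, Φ q • {q : ℝ × ℝ | q.2 < q.1}.indicator (fun q => g (max q.1 q.2)) q := by
  set S : Set (ℝ × ℝ) := {q | q.2 < q.1} with hSdef
  have hS : MeasurableSet S := measurableSet_lt measurable_snd measurable_fst
  have hcd : ∀ v, Continuous fun q => fderiv ℝ Φ q v := fun v =>
    (hΦ.continuous_fderiv (by simp)).clm_apply continuous_const
  have hi : ∀ v, Integrable fun q => fderiv ℝ Φ q v • f (max q.1 q.2) := fun v =>
    hf _ (hcd v) (tsupport_fderiv_apply_subset ℝ v)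
  have hline : ∀ r ∈ Iio (0 : ℝ),
      ∫ a, fderiv ℝ Φ (a, a + r) (1, 1) • f (max a (a + r)) =
        -∫ a, Φ (a, a + r) • g (max a (a + r)) := by
    intro r hr
    have hm : ∀ a, max a (a + r) = a := fun a => max_eq_left (by linarith [mem_Iio.1 hr])
    simp only [hm]
    have hemb : IsClosedEmbedding fun a : ℝ => (a, a + r) :=
      Function.LeftInverse.isClosedEmbedding (f := Prod.fst) (fun _ => rfl) continuous_fst
        (by fun_prop)
    have h1 : HasCompactSupport fun a => Φ (a, a + r) := hc.comp_isClosedEmbedding hemb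
    have h2 : ContDiff ℝ ∞ fun a => Φ (a, a + r) :=
      hΦ.comp (contDiff_id.prodMk (contDiff_id.add contDiff_const))
    rw [← hw _ h2 h1]
    · congr 1 with a
      congr 1
      exact (hasDerivAt_comp_line hΦ
        ((hasDerivAt_id a).prodMk ((hasDerivAt_id a).add_const r))).deriv.symm
    · intro a ha
      have := hs _ (tsupport_comp_subset_preimage Φ hemb.continuous ha)
      rwa [hm] at this
  have hA : ∫ q in S, fderiv ℝ Φ q (1, 1) • f (max q.1 q.2) =
      -∫ q in S, Φ q • g (max q.1 q.2) := by
    rw [setIntegral_lt_eq (hi _), setIntegral_lt_eq hg, ← integral_neg]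
    exact setIntegral_congr_fun measurableSet_Iio hline
  have hB : ∫ q in S, fderiv ℝ Φ q (0, 1) • f (max q.1 q.2) = ∫ a, Φ (a, a) • f a := by
    rw [← integral_indicator hS, Measure.volume_eq_prod, integral_prod]
    · congr 1 with a
      rw [← integral_Iio_fderiv_snd hΦ hc a, ← integral_smul_const,
        ← integral_indicator measurableSet_Iio]
      congr 1 with b
      by_cases hb : b < a
      · rw [indicator_of_mem (show (a, b) ∈ S from hb), indicator_of_mem (show b ∈ Iio a from hb)]
        simp only [max_eq_left hb.le]
      · rw [indicator_of_notMem (show (a, b) ∉ S from hb),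
          indicator_of_notMem (show b ∉ Iio a from hb)]
    · exact (hi _).indicator hS
  have hC : ∫ q in Sᶜ, fderiv ℝ Φ q (1, 0) • f (max q.1 q.2) = ∫ b, Φ (b, b) • f b := by
    rw [← integral_indicator hS.compl, Measure.volume_eq_prod, integral_prod_symm]
    · congr 1 with b
      rw [← integral_Iic_fderiv_fst hΦ hc b, ← integral_smul_const,
        ← integral_indicator measurableSet_Iic]
      congr 1 with a
      by_cases hb : a ≤ b
      · rw [indicator_of_mem (show (a, b) ∈ Sᶜ from not_lt.2 hb),
          indicator_of_mem (show a ∈ Iic b from hb)]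
        simp only [max_eq_right hb]
      · rw [indicator_of_notMem (show (a, b) ∉ Sᶜ from fun h => hb (not_lt.1 h)),
          indicator_of_notMem (show a ∉ Iic b from hb)]
    · exact (hi _).indicator hS.compl
  have hD : ∫ q in S, fderiv ℝ Φ q (1, 1) • f (max q.1 q.2) =
      (∫ q in S, fderiv ℝ Φ q (1, 0) • f (max q.1 q.2)) +
        ∫ q in S, fderiv ℝ Φ q (0, 1) • f (max q.1 q.2) := by
    rw [← integral_add (hi _).integrableOn (hi _).integrableOn]
    congr 1 with q
    rw [← add_smul, ← map_add]
    simp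
  have hE : ∫ q, Φ q • S.indicator (fun q => g (max q.1 q.2)) q =
      ∫ q in S, Φ q • g (max q.1 q.2) := by
    rw [← integral_indicator hS]
    congr 1 with q
    by_cases hq : q ∈ S
    · rw [indicator_of_mem hq, indicator_of_mem hq]
    · rw [indicator_of_notMem hq, indicator_of_notMem hq, smul_zero]
  rw [← integral_add_compl hS (hi _), hC, hE, ← hA, hD, hB]

/-- The scaled version of a weak derivative. -/
theorem integral_deriv_smul_comp_mul {I : Set ℝ} {F G : ℝ → ℂ} {κ : ℝ} (hκ : 0 < κ)
    (hw : ∀ η : ℝ → ℝ, ContDiff ℝ ∞ η → HasCompactSupport η → tsupport η ⊆ I →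
      ∫ u in I, deriv η u • F u = -∫ u in I, η u • G u)
    {η : ℝ → ℝ} (hη : ContDiff ℝ ∞ η) (hc : HasCompactSupport η)
    (hs : tsupport η ⊆ {a | κ * a ∈ I}) :
    ∫ a, deriv η a • F (κ * a) = -∫ a, η a • ((κ : ℂ) * G (κ * a)) := by
  have hκ' : κ⁻¹ ≠ 0 := (inv_pos.2 hκ).ne'
  have habs : |κ⁻¹| = κ⁻¹ := abs_of_pos (inv_pos.2 hκ)
  set ζ : ℝ → ℝ := fun u => η (κ⁻¹ * u) with hζ
  have hemb : IsClosedEmbedding fun u : ℝ => κ⁻¹ * u :=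
    (Homeomorph.mulLeft₀ κ⁻¹ hκ').isClosedEmbedding
  have h1 : ContDiff ℝ ∞ ζ := hη.comp (contDiff_const.mul contDiff_id)
  have h2 : HasCompactSupport ζ := hc.comp_isClosedEmbedding hemb
  have h3 : tsupport ζ ⊆ I := by
    intro u hu
    have := hs (tsupport_comp_subset_preimage η hemb.continuous hu)
    rwa [mem_ofPred_eq, mul_inv_cancel_left₀ hκ.ne'] at this
  have h4 : ∀ u, deriv ζ u = κ⁻¹ * deriv η (κ⁻¹ * u) := fun u => by
    rw [hζ, deriv_comp_mul_left, smul_eq_mul]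
  have hz : ∀ u, u ∉ I → ζ u = 0 := fun u hu =>
    image_eq_zero_of_notMem_tsupport fun h => hu (h3 h)
  have hz' : ∀ u, u ∉ I → deriv ζ u = 0 := fun u hu =>
    image_eq_zero_of_notMem_tsupport fun h => hu (h3 (tsupport_deriv_subset h))
  have h5 := hw ζ h1 h2 h3
  rw [setIntegral_eq_integral_of_forall_compl_eq_zero (fun u hu => by rw [hz' u hu, zero_smul]),
    setIntegral_eq_integral_of_forall_compl_eq_zero (fun u hu => by rw [hz u hu, zero_smul])] at h5
  have e1 : ∫ a, deriv η a • F (κ * a) = ∫ u, deriv ζ u • F u := by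
    have := Measure.integral_comp_mul_left (fun u => deriv η (κ⁻¹ * u) • F u) κ
    simp only [inv_mul_cancel_left₀ hκ.ne'] at this
    rw [this, habs, ← integral_smul]
    simp only [h4, mul_smul]
  have e2 : ∫ a, η a • ((κ : ℂ) * G (κ * a)) = ∫ u, ζ u • G u := by
    have := Measure.integral_comp_mul_left (fun u => η (κ⁻¹ * u) • ((κ : ℂ) * G u)) κ
    simp only [inv_mul_cancel_left₀ hκ.ne'] at this
    rw [this, habs, ← integral_smul]
    congr 1 with u
    have : (κ : ℂ) ≠ 0 := Complex.ofReal_ne_zero.2 hκ.ne'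
    simp only [hζ, Complex.real_smul]
    push_cast
    field_simp
  rw [e1, e2, h5]

end Max

/-! ### Transfer to the plane -/

section Heights

variable {σ c : Fin 2 → ℝ}

/-- The linear part of the inverse of `heightMap`. -/
def heightLin (σ : Fin 2 → ℝ) (i j : Fin 2) : ℝ × ℝ →L[ℝ] Plane :=
  (ContinuousLinearMap.fst ℝ ℝ ℝ).smulRight (EuclideanSpace.single i (σ i)) +
    (ContinuousLinearMap.snd ℝ ℝ ℝ).smulRight (EuclideanSpace.single j (σ j))

/-- The coordinates `σ p i + c`, `σ p j + c` in the plane. -/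
def heightMap (σ c : Fin 2 → ℝ) (hσ : ∀ i, σ i * σ i = 1) {i j : Fin 2} (hij : i ≠ j) :
    Plane ≃ₜ ℝ × ℝ where
  toFun p := (σ i * p i + c i, σ j * p j + c j)
  invFun q := heightLin σ i j q +
    -(EuclideanSpace.single i (σ i * c i) + EuclideanSpace.single j (σ j * c j))
  left_inv p := by
    ext k
    have hk : k = i ∨ k = j := by omega
    rcases hk with rfl | rfl
    · simp [heightLin, hij]
      linear_combination p k * hσ k
    · simp [heightLin, hij.symm]
      linear_combination p k * hσ k
  right_inv q := by
    ext
    · simp [heightLin, hij]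
      linear_combination q.1 * hσ i - c i * hσ i
    · simp [heightLin, hij.symm]
      linear_combination q.2 * hσ j - c j * hσ j
  continuous_toFun := by fun_prop
  continuous_invFun := by fun_prop

theorem measurePreserving_mul_add {s : ℝ} (hs : s * s = 1) (d : ℝ) :
    MeasurePreserving (fun x : ℝ => s * x + d) volume volume := by
  have h1 : MeasurePreserving (fun x : ℝ => x + d) volume volume :=
    measurePreserving_add_right volume d
  have h2 : s = 1 ∨ s = -1 := mul_self_eq_one_iff.1 hs
  rcases h2 with rfl | rfl
  · simpa using h1
  · simpa [Function.comp_def] using h1.comp (Measure.measurePreserving_neg (volume : Measure ℝ))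

theorem measurePreserving_heightMap (hσ : ∀ i, σ i * σ i = 1) {i j : Fin 2} (hij : i ≠ j) :
    MeasurePreserving (heightMap σ c hσ hij) volume volume := by
  have h1 : ∀ k l : Fin 2, MeasurePreserving
      (Prod.map (fun x : ℝ => σ k * x + c k) (fun x : ℝ => σ l * x + c l)) volume volume :=
    fun k l => (measurePreserving_mul_add (hσ k) (c k)).prod
      (measurePreserving_mul_add (hσ l) (c l))
  have hcase : (i = 0 ∧ j = 1) ∨ (i = 1 ∧ j = 0) := by omega
  rcases hcase with ⟨rfl, rfl⟩ | ⟨rfl, rfl⟩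
  · exact (h1 0 1).comp measurePreserving_planeEquiv
  · exact (h1 1 0).comp (Measure.measurePreserving_swap.comp measurePreserving_planeEquiv)

/-- The chain rule for a function of the maximum of two affine functions. -/
theorem integral_fderiv_smul_max_height (hσ : ∀ i, σ i * σ i = 1) {κ : ℝ} (hκ : 0 < κ)
    {I : Set ℝ} {F G : ℝ → ℂ}
    (hw : ∀ η : ℝ → ℝ, ContDiff ℝ ∞ η → HasCompactSupport η → tsupport η ⊆ I →
      ∫ u in I, deriv η u • F u = -∫ u in I, η u • G u)
    {i j : Fin 2} (hij : i ≠ j) {U : Plane → ℝ}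
    (hU : ∀ p, U p = κ * max (σ i * p i + c i) (σ j * p j + c j))
    {φ : Plane → ℝ} (hφ : ContDiff ℝ ∞ φ) (hc : HasCompactSupport φ)
    (hs : ∀ p ∈ tsupport φ, U p ∈ I)
    (hF : ∀ ψ : Plane → ℝ, Continuous ψ → tsupport ψ ⊆ tsupport φ →
      Integrable fun p => ψ p • F (U p))
    (hG : Integrable fun p => φ p • G (U p)) :
    ∫ p, fderiv ℝ φ p (EuclideanSpace.single i 1) • F (U p) =
      -∫ p, φ p • (((σ i * κ : ℝ) : ℂ) *
        {p : Plane | σ j * p j + c j < σ i * p i + c i}.indicator (fun p => G (U p)) p) := by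
  set T := heightMap σ c hσ hij
  have hmp : MeasurePreserving T volume volume := measurePreserving_heightMap hσ hij
  have hme : MeasurableEmbedding T := T.measurableEmbedding
  set Φ : ℝ × ℝ → ℝ := fun q => φ (T.symm q) with hΦdef
  have hUT : ∀ p, U p = κ * max (T p).1 (T p).2 := hU
  have hUs : ∀ q, U (T.symm q) = κ * max q.1 q.2 := fun q => by
    rw [hUT, T.apply_symm_apply]
  have hsd : ∀ q, HasFDerivAt (fun q => T.symm q) (heightLin σ i j) q := fun q =>
    (heightLin σ i j).hasFDerivAt.add_const _
  have hsc : ContDiff ℝ ∞ fun q => T.symm q := (heightLin σ i j).contDiff.add contDiff_const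
  have hΦ : ContDiff ℝ ∞ Φ := hφ.comp hsc
  have hΦc : HasCompactSupport Φ := hc.comp_homeomorph T.symm
  have hts : ∀ q, q ∈ tsupport Φ → T.symm q ∈ tsupport φ := fun q hq =>
    tsupport_comp_subset_preimage φ T.symm.continuous hq
  have hfd : ∀ p, fderiv ℝ Φ (T p) (1, 0) =
      σ i * fderiv ℝ φ p (EuclideanSpace.single i 1) := by
    intro p
    have h1 : HasFDerivAt Φ ((fderiv ℝ φ p).comp (heightLin σ i j)) (T p) := by
      refine HasFDerivAt.comp (T p) ?_ (hsd (T p))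
      rw [T.symm_apply_apply]
      exact (hφ.differentiable (by simp) p).hasFDerivAt
    rw [h1.fderiv, ContinuousLinearMap.comp_apply]
    have h2 : heightLin σ i j (1, 0) = σ i • EuclideanSpace.single i 1 := by
      ext k
      simp [heightLin]
    rw [h2, map_smul, smul_eq_mul]
  have key := integral_fderiv_smul_max (I := {a | κ * a ∈ I}) (f := fun a => F (κ * a))
    (g := fun a => (κ : ℂ) * G (κ * a))
    (fun η h1 h2 h3 => integral_deriv_smul_comp_mul hκ hw h1 h2 h3) hΦ hΦc
    (fun q hq => by
      have := hs _ (hts q hq)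
      rwa [hUs] at this)
    (fun ψ h1 h2 => by
      rw [← hmp.integrable_comp_emb hme]
      refine (hF (fun p => ψ (T p)) (h1.comp T.continuous) fun p hp => ?_).congr
        (ae_of_all _ fun p => ?_)
      · have := hts _ (h2 (tsupport_comp_subset_preimage ψ T.continuous hp))
        rwa [T.symm_apply_apply] at this
      · simp only [Function.comp_apply, hUT])
    (by
      rw [← hmp.integrable_comp_emb hme]
      refine (hG.const_mul (κ : ℂ)).congr (ae_of_all _ fun p => ?_)
      simp only [Function.comp_apply, hΦdef, T.symm_apply_apply, hUT, Complex.real_smul]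
      ring)
  rw [← hmp.integral_comp hme, ← hmp.integral_comp hme] at key
  have e1 : ∫ p, fderiv ℝ φ p (EuclideanSpace.single i 1) • F (U p) =
      (σ i : ℂ) * ∫ p, fderiv ℝ Φ (T p) (1, 0) • F (κ * max (T p).1 (T p).2) := by
    rw [← integral_const_mul]
    congr 1 with p
    rw [hfd, hUT]
    have : (σ i : ℂ) * σ i = 1 := by exact_mod_cast hσ i
    simp only [Complex.real_smul]
    push_cast
    linear_combination (-(fderiv ℝ φ p (EuclideanSpace.single i 1) : ℂ) *
      F (κ * max (T p).1 (T p).2)) * this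
  rw [e1, key, mul_neg, ← integral_const_mul]
  congr 2 with p
  simp only [hΦdef, T.symm_apply_apply, Complex.real_smul]
  by_cases hp : σ j * p j + c j < σ i * p i + c i
  · rw [indicator_of_mem (show T p ∈ {q : ℝ × ℝ | q.2 < q.1} from hp),
      indicator_of_mem (by exact hp), hUT]
    push_cast
    ring
  · rw [indicator_of_notMem (show T p ∉ {q : ℝ × ℝ | q.2 < q.1} from hp),
      indicator_of_notMem (by exact hp)]
    ring

end Heights

/-! ### Weighted composition operators between `L²` spaces -/

section Pullback

variable {X Y : Type*} [MeasurableSpace X] [MeasurableSpace Y] {μ : Measure X} {ν : Measure Y}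

/-- The operator `g ↦ m · (g ∘ u)`. -/
def pullback (m : X → ℂ) (u : X → Y) (hu : Measure.QuasiMeasurePreserving u μ ν)
    (h : ∀ g : Lp ℂ 2 ν, MemLp (fun x => m x * g (u x)) 2 μ) : Lp ℂ 2 ν →ₗ[ℂ] Lp ℂ 2 μ where
  toFun g := (h g).toLp _
  map_add' g₁ g₂ := by
    refine Lp.ext ?_
    filter_upwards [(h (g₁ + g₂)).coeFn_toLp, (h g₁).coeFn_toLp, (h g₂).coeFn_toLp,
      Lp.coeFn_add ((h g₁).toLp _) ((h g₂).toLp _), hu.ae (Lp.coeFn_add g₁ g₂)]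
      with x h1 h2 h3 h4 h5
    rw [h1, h4, Pi.add_apply, h2, h3, h5, Pi.add_apply, mul_add]
  map_smul' a g := by
    refine Lp.ext ?_
    filter_upwards [(h (a • g)).coeFn_toLp, (h g).coeFn_toLp,
      Lp.coeFn_smul a ((h g).toLp _), hu.ae (Lp.coeFn_smul a g)] with x h1 h2 h3 h4
    rw [h1, RingHom.id_apply, h3, Pi.smul_apply, h2, h4, Pi.smul_apply, smul_eq_mul, smul_eq_mul]
    ring

theorem coeFn_pullback {m : X → ℂ} {u : X → Y} (hu : Measure.QuasiMeasurePreserving u μ ν)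
    (h : ∀ g : Lp ℂ 2 ν, MemLp (fun x => m x * g (u x)) 2 μ) (g : Lp ℂ 2 ν) :
    pullback m u hu h g =ᵐ[μ] fun x => m x * g (u x) :=
  (h g).coeFn_toLp

theorem enorm_sq_eq_lintegral (f : Lp ℂ 2 μ) : ‖f‖ₑ ^ 2 = ∫⁻ x, ‖f x‖ₑ ^ 2 ∂μ := by
  have := eLpNorm_nnreal_pow_eq_lintegral (μ := μ) (f := f) (p := 2) (by norm_num)
  rw [Lp.enorm_def]
  simpa using this

end Pullback

/-! ### Functions of the edge coordinate on a cell -/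

theorem mem_H1_of_const {U : Set Plane} {p : WithLp 2 (L2 U × PiLp 2 fun _ : Fin 2 => L2 U)}
    {c : ℂ} (h1 : p.fst =ᵐ[volume.restrict U] fun _ => c) (h2 : p.snd = 0) : p ∈ H1 U := by
  intro φ hφ hc hU i
  have e2 : ∫ x in U, φ x • p.snd i x = 0 := by
    refine integral_eq_zero_of_ae ?_
    have : p.snd i = 0 := by rw [h2]; rfl
    rw [this]
    filter_upwards [Lp.coeFn_zero ℂ 2 (volume.restrict U)] with x hx
    rw [hx]
    simp
  have hz : ∀ x, x ∉ U → fderiv ℝ φ x (EuclideanSpace.single i 1) = 0 := fun x hx => by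
    rw [image_eq_zero_of_notMem_tsupport (f := fderiv ℝ φ)
      fun h => hx (hU (tsupport_fderiv_subset ℝ h))]
    rfl
  have hd : Continuous fun x => fderiv ℝ φ x (EuclideanSpace.single i 1) :=
    (hφ.continuous_fderiv (by simp)).clm_apply continuous_const
  have hdc : HasCompactSupport fun x => fderiv ℝ φ x (EuclideanSpace.single i 1) :=
    hc.fderiv_apply ℝ _
  have e1 : ∫ x in U, (fderiv ℝ φ x (EuclideanSpace.single i 1)) • p.fst x =
      (∫ x, fderiv ℝ φ x (EuclideanSpace.single i 1)) • c := by
    rw [← integral_smul_const]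
    refine Eq.trans (integral_congr_ae ?_)
      (setIntegral_eq_integral_of_forall_compl_eq_zero (s := U)
        (fun x hx => by rw [hz x hx, zero_smul]))
    filter_upwards [h1] with x hx
    rw [hx]
  have e3 := integral_mul_fderiv_eq_neg_fderiv_mul_of_integrable (μ := volume) (f := φ)
    (g := fun _ => (1 : ℝ)) (v := EuclideanSpace.single i (1 : ℝ))
    (by simpa using hd.integrable_of_hasCompactSupport hdc) (by simp)
    (by simpa using hφ.continuous.integrable_of_hasCompactSupport hc)
    (fun x _ => (hφ.differentiable (by simp)) x) (fun x _ => differentiableAt_const _)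
  have e4 : ∫ x, fderiv ℝ φ x (EuclideanSpace.single i 1) = 0 := by
    simpa using e3
  rw [e1, e2, e4, zero_smul, neg_zero]

namespace Domain

variable (P : Domain)

theorem max_height_of_mem_cell {e : Edge} (he : ¬ e.IsSing) {x : Plane} (hx : x ∈ P.cell e) :
    gradConst e * max (P.height e 0 x) (P.height e 1 x) ∈ P.param e := by
  have h : x ∈ {x ∈ P.Omega | tau P.Omega x ∈ P.curve e '' P.param e} := hx
  rw [(P.fanPair e).preimage_eq] at h
  rcases h with (⟨p, hp, rfl⟩ | ⟨p, hp, rfl⟩) | ⟨u, hu, rfl⟩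
  · have hp' : p = !₂[p 0, p 1] := by ext k; fin_cases k <;> simp
    have := P.max_height_fan₁ he hp.1 hp.2.1.le hp.2.2
    rw [← hp'] at this
    rw [this]
    exact hp.1
  · have hp' : p = !₂[p 0, p 1] := by ext k; fin_cases k <;> simp
    have := P.max_height_fan₂ he hp.1 hp.2.1.le
    rw [← hp'] at this
    rw [this]
    exact hp.1
  · have := P.max_height_fan₁ he hu le_rfl one_pos
    have h0 : fan (P.curve e) (P.near₁ e) !₂[u, 0] = P.curve e u := by simp [fan]
    rw [h0] at this
    rw [this]
    exact hu

theorem edgeCoord_eq_max_height {e : Edge} (he : ¬ e.IsSing) :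
    ∀ᵐ x ∂(volume.restrict (P.cell e)),
      P.edgeCoord e x = gradConst e * max (P.height e 0 x) (P.height e 1 x) := by
  rw [P.restrict_cell]
  filter_upwards [ae_restrict_mem (P.fanPair e).isOpen_openPart.measurableSet] with x hx
  rcases hx with ⟨p, hp, rfl⟩ | ⟨p, hp, rfl⟩
  · have hp' : p = !₂[p 0, p 1] := by ext k; fin_cases k <;> simp
    have := P.max_height_fan₁ he hp.1 hp.2.1.le hp.2.2
    rw [← hp'] at this
    rw [this]
    exact (P.fanPair e).coord_fan hp
  · have hp' : p = !₂[p 0, p 1] := by ext k; fin_cases k <;> simp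
    have := P.max_height_fan₂ he hp.1 hp.2.1.le
    rw [← hp'] at this
    rw [this]
    exact (P.fanPair e).coord_fan' hp

/-- The partial derivatives of the edge coordinate. -/
def gradCoord (e : Edge) (i : Fin 2) (x : Plane) : ℂ :=
  {x : Plane | P.height e (i + 1) x < P.height e i x}.indicator
    (fun _ => (((P.coeff e i).1 * gradConst e : ℝ) : ℂ)) x

theorem measurable_gradCoord (e : Edge) (i : Fin 2) : Measurable (P.gradCoord e i) := by
  have hm : ∀ k, Measurable (P.height e k) := fun k => by
    unfold height
    fun_prop
  exact measurable_const.indicator (measurableSet_lt (hm _) (hm _))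

theorem sum_enorm_gradCoord_sq_le (e : Edge) (x : Plane) :
    ∑ i, ‖P.gradCoord e i x‖ₑ ^ 2 ≤ ENNReal.ofReal (gradConst e ^ 2) := by
  have hc : ∀ i, ‖(((P.coeff e i).1 * gradConst e : ℝ) : ℂ)‖ₑ ^ 2 =
      ENNReal.ofReal (gradConst e ^ 2) := fun i => by
    rw [← ofReal_norm, ← ENNReal.ofReal_pow (norm_nonneg _), Complex.norm_real,
      Real.norm_eq_abs, sq_abs]
    congr 1
    linear_combination gradConst e ^ 2 * P.coeff_mul_self e i
  rw [Fin.sum_univ_two]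
  unfold gradCoord
  have h11 : (1 : Fin 2) + 1 = 0 := rfl
  rw [zero_add, h11]
  rcases lt_trichotomy (P.height e 1 x) (P.height e 0 x) with h | h | h
  · rw [indicator_of_mem (by exact h), indicator_of_notMem (by exact h.not_gt), hc]
    simp
  · rw [indicator_of_notMem (by exact h.not_lt), indicator_of_notMem (by exact h.not_gt)]
    simp
  · rw [indicator_of_notMem (by exact h.not_gt), indicator_of_mem (by exact h), hc]
    simp

theorem memLp_comp_edgeCoord (e : Edge) (f : Lp ℂ 2 (P.muAlpha e)) :
    MemLp (fun x => f (P.edgeCoord e x)) 2 (volume.restrict (P.cell e)) :=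
  (Lp.memLp f).comp_measurePreserving (P.measurePreserving_edgeCoord e)

/-- On a regular cell the weak gradient of `f ∘ τ` is `f' ∘ τ` times the gradient of the edge
coordinate. -/
theorem mem_H1_of_weakDeriv {e : Edge} (he : ¬ e.IsSing) {f : Lp ℂ 2 (P.muAlpha e)}
    {g : Lp ℂ 2 (P.muBeta e)} (h : P.WeakDeriv e f g)
    (hg : MemLp g 2 (P.muAlpha e))
    {p : WithLp 2 (L2 (P.cell e) × PiLp 2 fun _ : Fin 2 => L2 (P.cell e))}
    (h1 : p.fst =ᵐ[volume.restrict (P.cell e)] fun x => f (P.edgeCoord e x))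
    (h2 : ∀ i, p.snd i =ᵐ[volume.restrict (P.cell e)]
      fun x => P.gradCoord e i x * g (P.edgeCoord e x)) : p ∈ H1 (P.cell e) := by
  intro φ hφ hc hs i
  have hU := P.edgeCoord_eq_max_height he
  set U : Plane → ℝ := fun x => gradConst e * max (P.height e 0 x) (P.height e 1 x) with hUdef
  have hz : ∀ {ψ : Plane → ℝ}, tsupport ψ ⊆ tsupport φ → ∀ x, x ∉ P.cell e → ψ x = 0 :=
    fun hψ x hx => image_eq_zero_of_notMem_tsupport fun h => hx (hs (hψ h))
  have htest : ∀ (ψ : Plane → ℝ), Continuous ψ → tsupport ψ ⊆ tsupport φ → ∀ k : ℝ → ℂ,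
      MemLp (fun x => k (P.edgeCoord e x)) 2 (volume.restrict (P.cell e)) →
      Integrable fun x => ψ x • k (U x) := by
    intro ψ hψ hψs k hk
    have hψc : HasCompactSupport ψ := hc.of_isClosed_subset (isClosed_tsupport _) hψs
    have i1 := integrable_test_smul (hk.toLp _) hψ hψc
    have i2 : IntegrableOn (fun x => ψ x • k (U x)) (P.cell e) := by
      refine i1.congr ?_
      filter_upwards [hk.coeFn_toLp, hU] with x hx hx'
      rw [hx, hx']
    refine (integrableOn_iff_integrable_of_support_subset ?_).1 i2
    intro x hx
    by_contra hx'
    exact hx (by simp only [hz hψs x hx', zero_smul])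
  have hgc : MemLp (fun x => g (P.edgeCoord e x)) 2 (volume.restrict (P.cell e)) :=
    hg.comp_measurePreserving (P.measurePreserving_edgeCoord e)
  have hne : i ≠ i + 1 := by fin_cases i <;> decide
  have key := integral_fderiv_smul_max_height (σ := fun k => (P.coeff e k).1)
    (c := fun k => (P.coeff e k).2) (P.coeff_mul_self e) (gradConst_pos e)
    ((P.weakDeriv_iff he f g).1 h) hne (U := U)
    (fun x => by
      rw [hUdef]
      fin_cases i
      · rfl
      · exact congrArg _ (max_comm _ _))
    hφ hc (fun x hx => P.max_height_of_mem_cell he (hs hx))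
    (fun ψ hψ hψs => htest ψ hψ hψs f (P.memLp_comp_edgeCoord e f))
    (htest φ hφ.continuous subset_rfl g hgc)
  have e1 : ∫ x in P.cell e, (fderiv ℝ φ x (EuclideanSpace.single i 1)) • p.fst x =
      ∫ x, (fderiv ℝ φ x (EuclideanSpace.single i 1)) • f (U x) := by
    refine Eq.trans (integral_congr_ae ?_)
      (setIntegral_eq_integral_of_forall_compl_eq_zero (s := P.cell e)
        (fun x hx => by rw [hz (tsupport_fderiv_apply_subset ℝ _) x hx, zero_smul]))
    filter_upwards [h1, hU] with x hx hx'
    rw [hx, hx']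
  have e2 : ∫ x in P.cell e, φ x • p.snd i x =
      ∫ x, φ x • ((((P.coeff e i).1 * gradConst e : ℝ) : ℂ) *
        {x : Plane | P.height e (i + 1) x < P.height e i x}.indicator
          (fun x => g (U x)) x) := by
    refine Eq.trans (integral_congr_ae ?_)
      (setIntegral_eq_integral_of_forall_compl_eq_zero (s := P.cell e)
        (fun x hx => by rw [hz subset_rfl x hx, zero_smul]))
    filter_upwards [h2 i, hU] with x hx hx'
    rw [hx, hx', gradCoord]
    by_cases hh : P.height e (i + 1) x < P.height e i x
    · rw [indicator_of_mem (by exact hh), indicator_of_mem (by exact hh)]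
    · rw [indicator_of_notMem (by exact hh), indicator_of_notMem (by exact hh), zero_mul, mul_zero]
  rw [e1, e2]
  exact key

/-! ### The operator `T₁` -/

theorem memLp_alpha_of_beta {e : Edge} (he : ¬ e.IsSing) (g : Lp ℂ 2 (P.muBeta e)) :
    MemLp g 2 (P.muAlpha e) := by
  have hκ : ENNReal.ofReal (gradConst e ^ 2) ≠ 0 :=
    (ENNReal.ofReal_pos.2 (pow_pos (gradConst_pos e) 2)).ne'
  refine MemLp.of_measure_le_smul (c := (ENNReal.ofReal (gradConst e ^ 2))⁻¹)
    (ENNReal.inv_ne_top.2 hκ) ?_ (Lp.memLp g)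
  rw [P.muBeta_eq_smul he, smul_smul, ENNReal.inv_mul_cancel hκ ENNReal.ofReal_ne_top, one_smul]

theorem quasiMeasurePreserving_edgeCoord {e : Edge} (he : ¬ e.IsSing) :
    Measure.QuasiMeasurePreserving (P.edgeCoord e) (volume.restrict (P.cell e)) (P.muBeta e) := by
  refine (P.measurePreserving_edgeCoord e).quasiMeasurePreserving.mono_right ?_
  rw [P.muBeta_eq_smul he]
  exact Measure.absolutelyContinuous_smul
    (ENNReal.ofReal_pos.2 (pow_pos (gradConst_pos e) 2)).ne'

/-- The operator `f ↦ f ∘ τ` from `L²(e; α dσ)` to `L²(τ⁻¹(e))`. -/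
def compCoord (e : Edge) : Lp ℂ 2 (P.muAlpha e) →ₗ[ℂ] L2 (P.cell e) :=
  pullback (fun _ => 1) (P.edgeCoord e) (P.measurePreserving_edgeCoord e).quasiMeasurePreserving
    fun f => by simpa using P.memLp_comp_edgeCoord e f

theorem coeFn_compCoord (e : Edge) (f : Lp ℂ 2 (P.muAlpha e)) :
    P.compCoord e f =ᵐ[volume.restrict (P.cell e)] fun x => f (P.edgeCoord e x) := by
  refine (coeFn_pullback (m := fun _ => 1) _ _ f).trans (ae_of_all _ fun x => ?_)
  exact one_mul _

theorem enorm_eq_of_ae_eq_comp (e : Edge) {f : Lp ℂ 2 (P.muAlpha e)} {F : L2 (P.cell e)}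
    (h : F =ᵐ[volume.restrict (P.cell e)] fun x => f (P.edgeCoord e x)) : ‖F‖ₑ = ‖f‖ₑ := by
  rw [Lp.enorm_def, Lp.enorm_def, eLpNorm_congr_ae h]
  exact eLpNorm_comp_measurePreserving (Lp.aestronglyMeasurable f)
    (P.measurePreserving_edgeCoord e)

theorem norm_eq_of_ae_eq_comp (e : Edge) {f : Lp ℂ 2 (P.muAlpha e)} {F : L2 (P.cell e)}
    (h : F =ᵐ[volume.restrict (P.cell e)] fun x => f (P.edgeCoord e x)) : ‖F‖ = ‖f‖ := by
  have := P.enorm_eq_of_ae_eq_comp e h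
  rwa [← ofReal_norm, ← ofReal_norm, ENNReal.ofReal_eq_ofReal_iff (norm_nonneg _)
    (norm_nonneg _)] at this

theorem norm_compCoord (e : Edge) (f : Lp ℂ 2 (P.muAlpha e)) : ‖P.compCoord e f‖ = ‖f‖ :=
  P.norm_eq_of_ae_eq_comp e (P.coeFn_compCoord e f)

theorem memLp_gradCoord_mul {e : Edge} (he : ¬ e.IsSing) (i : Fin 2) (g : Lp ℂ 2 (P.muBeta e)) :
    MemLp (fun x => P.gradCoord e i x * g (P.edgeCoord e x)) 2 (volume.restrict (P.cell e)) := by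
  have h1 : MemLp (fun x => g (P.edgeCoord e x)) 2 (volume.restrict (P.cell e)) :=
    (P.memLp_alpha_of_beta he g).comp_measurePreserving (P.measurePreserving_edgeCoord e)
  refine h1.of_le_mul (c := ‖(((P.coeff e i).1 * gradConst e : ℝ) : ℂ)‖)
    ((P.measurable_gradCoord e i).aestronglyMeasurable.mul h1.1) (ae_of_all _ fun x => ?_)
  rw [norm_mul]
  refine mul_le_mul_of_nonneg_right ?_ (norm_nonneg _)
  exact norm_indicator_le_norm_self _ x

/-- The partial derivative of `f ∘ τ`, in terms of the derivative of `f`. -/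
def gradComp {e : Edge} (he : ¬ e.IsSing) (i : Fin 2) :
    Lp ℂ 2 (P.muBeta e) →ₗ[ℂ] L2 (P.cell e) :=
  pullback (P.gradCoord e i) (P.edgeCoord e) (P.quasiMeasurePreserving_edgeCoord he)
    (P.memLp_gradCoord_mul he i)

theorem coeFn_gradComp {e : Edge} (he : ¬ e.IsSing) (i : Fin 2) (g : Lp ℂ 2 (P.muBeta e)) :
    P.gradComp he i g =ᵐ[volume.restrict (P.cell e)]
      fun x => P.gradCoord e i x * g (P.edgeCoord e x) :=
  coeFn_pullback _ _ g

theorem sum_norm_gradComp_sq_le {e : Edge} (he : ¬ e.IsSing) (g : Lp ℂ 2 (P.muBeta e)) :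
    ∑ i, ‖P.gradComp he i g‖ ^ 2 ≤ ‖g‖ ^ 2 := by
  have hE : ∑ i, ‖P.gradComp he i g‖ₑ ^ 2 ≤ ‖g‖ₑ ^ 2 := by
    have hae : AEMeasurable (fun u => ‖g u‖ₑ ^ 2) (P.muAlpha e) :=
      ((P.memLp_alpha_of_beta he g).1.enorm).pow_const 2
    calc ∑ i, ‖P.gradComp he i g‖ₑ ^ 2
        = ∑ i, ∫⁻ x in P.cell e, ‖P.gradCoord e i x‖ₑ ^ 2 * ‖g (P.edgeCoord e x)‖ₑ ^ 2 := by
          refine Finset.sum_congr rfl fun i _ => ?_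
          rw [enorm_sq_eq_lintegral]
          refine lintegral_congr_ae ?_
          filter_upwards [P.coeFn_gradComp he i g] with x hx
          rw [hx, enorm_mul, mul_pow]
      _ = ∫⁻ x in P.cell e, ∑ i, ‖P.gradCoord e i x‖ₑ ^ 2 * ‖g (P.edgeCoord e x)‖ₑ ^ 2 := by
          rw [lintegral_finsetSum']
          intro i _
          exact ((P.measurable_gradCoord e i).enorm.pow_const 2).aemeasurable.mul
            (hae.comp_quasiMeasurePreserving
              (P.measurePreserving_edgeCoord e).quasiMeasurePreserving)
      _ ≤ ∫⁻ x in P.cell e, ENNReal.ofReal (gradConst e ^ 2) * ‖g (P.edgeCoord e x)‖ₑ ^ 2 := by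
          refine lintegral_mono fun x => ?_
          rw [← Finset.sum_mul]
          exact mul_le_mul_left (P.sum_enorm_gradCoord_sq_le e x) _
      _ = ENNReal.ofReal (gradConst e ^ 2) *
            ∫⁻ x in P.cell e, ‖g (P.edgeCoord e x)‖ₑ ^ 2 :=
          lintegral_const_mul' _ _ ENNReal.ofReal_ne_top
      _ = ENNReal.ofReal (gradConst e ^ 2) * ∫⁻ u, ‖g u‖ₑ ^ 2 ∂(P.muAlpha e) := by
          rw [← (P.measurePreserving_edgeCoord e).map_eq, lintegral_map' _
            (P.measurePreserving_edgeCoord e).aemeasurable]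
          rw [(P.measurePreserving_edgeCoord e).map_eq]
          exact hae
      _ = ‖g‖ₑ ^ 2 := by
          have hs : ∀ k : ℝ → ENNReal, ∫⁻ u, k u ∂(P.muBeta e) =
              ENNReal.ofReal (gradConst e ^ 2) * ∫⁻ u, k u ∂(P.muAlpha e) := fun k => by
            rw [P.muBeta_eq_smul he, lintegral_smul_measure, smul_eq_mul]
          rw [enorm_sq_eq_lintegral, hs]
  have h2 := ENNReal.toReal_mono (by simp) hE
  rw [ENNReal.toReal_sum (fun i _ => by simp)] at h2
  simpa using h2

/-- The operator `f ↦ f ∘ τ` from the component of `H̃¹(Γ)` on an edge to `H¹(τ⁻¹(e))`. -/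
theorem exists_edgeT1 (e : Edge) : ∃ L : P.edgeH1 e →ₗ[ℂ] H1 (P.cell e),
    (∀ p, ‖L p‖ ≤ ‖p‖) ∧
    ∀ p, (L p).1.fst =ᵐ[volume.restrict (P.cell e)] fun x => p.1.fst (P.edgeCoord e x) := by
  by_cases he : e.IsSing
  · have hmem : ∀ p : P.edgeH1 e,
        (WithLp.toLp 2 (P.compCoord e p.1.fst, 0) :
          WithLp 2 (L2 (P.cell e) × PiLp 2 fun _ : Fin 2 => L2 (P.cell e))) ∈ H1 (P.cell e) := by
      intro p
      obtain ⟨c, hc⟩ := p.2.1 he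
      refine mem_H1_of_const (c := c) ((P.coeFn_compCoord e _).trans ?_) rfl
      exact (P.measurePreserving_edgeCoord e).quasiMeasurePreserving.ae hc
    refine ⟨{ toFun := fun p => ⟨_, hmem p⟩, map_add' := ?_, map_smul' := ?_ }, ?_, ?_⟩
    · intro p q
      refine Subtype.ext (WithLp.ofLp_injective 2 (Prod.ext ?_ ?_))
      · exact map_add (P.compCoord e) p.1.fst q.1.fst
      · exact (add_zero _).symm
    · intro a p
      refine Subtype.ext (WithLp.ofLp_injective 2 (Prod.ext ?_ ?_))
      · exact map_smul (P.compCoord e) a p.1.fst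
      · exact (smul_zero _).symm
    · intro p
      refine le_trans (le_of_eq ?_) (norm_fst_le_norm p.1)
      rw [← P.norm_compCoord e p.1.fst]
      exact WithLp.norm_toLp_fst 2 (L2 (P.cell e)) (PiLp 2 fun _ : Fin 2 => L2 (P.cell e)) _
    · exact fun p => P.coeFn_compCoord e _
  · have hmem : ∀ p : P.edgeH1 e,
        (WithLp.toLp 2 (P.compCoord e p.1.fst,
            WithLp.toLp 2 fun i => P.gradComp he i p.1.snd) :
          WithLp 2 (L2 (P.cell e) × PiLp 2 fun _ : Fin 2 => L2 (P.cell e))) ∈ H1 (P.cell e) :=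
      fun p => P.mem_H1_of_weakDeriv he (p.2.2.2 he) (P.memLp_alpha_of_beta he _)
        (P.coeFn_compCoord e _) (fun i => P.coeFn_gradComp he i _)
    refine ⟨{ toFun := fun p => ⟨_, hmem p⟩, map_add' := ?_, map_smul' := ?_ }, ?_, ?_⟩
    · intro p q
      refine Subtype.ext (WithLp.ofLp_injective 2 (Prod.ext ?_ ?_))
      · exact map_add (P.compCoord e) p.1.fst q.1.fst
      · refine WithLp.ofLp_injective 2 (funext fun i => ?_)
        exact map_add (P.gradComp he i) p.1.snd q.1.snd
    · intro a p
      refine Subtype.ext (WithLp.ofLp_injective 2 (Prod.ext ?_ ?_))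
      · exact map_smul (P.compCoord e) a p.1.fst
      · refine WithLp.ofLp_injective 2 (funext fun i => ?_)
        exact map_smul (P.gradComp he i) a p.1.snd
    · intro p
      refine le_of_sq_le_sq ?_ (norm_nonneg _)
      have h1 := WithLp.prod_norm_sq_eq_of_L2 p.1
      have h2 := WithLp.prod_norm_sq_eq_of_L2
        (WithLp.toLp 2 (P.compCoord e p.1.fst, WithLp.toLp 2 fun i => P.gradComp he i p.1.snd) :
          WithLp 2 (L2 (P.cell e) × PiLp 2 fun _ : Fin 2 => L2 (P.cell e)))
      have h3 := PiLp.norm_sq_eq_of_L2 (fun _ : Fin 2 => L2 (P.cell e))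
        (WithLp.toLp 2 fun i => P.gradComp he i p.1.snd)
      have h4 := P.sum_norm_gradComp_sq_le he p.1.snd
      have h5 := P.norm_compCoord e p.1.fst
      refine le_of_eq_of_le h2 (le_of_le_of_eq ?_ h1.symm)
      exact add_le_add (congrArg (· ^ 2) h5).le (h3.le.trans h4)
    · exact fun p => P.coeFn_compCoord e _

theorem exists_isT1 : ∃ T₁ : P.H1Gamma →L[ℂ] P.H1Omega, P.IsT1 T₁ := by
  choose L hL hL' using P.exists_edgeT1
  refine ⟨sumMap (V := fun e => P.edgeH1 e) (W := fun e : Edge => H1 (P.cell e)) L hL,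
    fun f e => ?_⟩
  filter_upwards [hL' e (f e), P.edgeCoord_eq e] with x hx hx' u hu hut
  rw [← hx' u hu hut]
  exact hx

end Domain

/-! ### Null sequences of locally constant functions -/

section HilbertSum

variable {ι : Type*} {V W : ι → Type*}
  [∀ i, NormedAddCommGroup (V i)] [∀ i, InnerProductSpace ℂ (V i)]
  [∀ i, NormedAddCommGroup (W i)] [∀ i, InnerProductSpace ℂ (W i)]

theorem orthonormal_lp_single [DecidableEq ι] {k : ℕ → ι} (hk : Function.Injective k)
    {x : ∀ n, V (k n)} (hx : ∀ n, ‖x n‖ = 1) :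
    Orthonormal ℂ fun n => (lp.single 2 (k n) (x n) : lp V 2) := by
  refine ⟨fun n => ?_, fun m n hmn => ?_⟩
  · rw [lp.norm_single (by norm_num), hx]
  · change ⟪lp.single 2 (k m) (x m), (lp.single 2 (k n) (x n) : lp V 2)⟫_ℂ = 0
    rw [lp.inner_single_left, lp.single_apply_ne _ _ _ fun h => hmn (hk h), inner_zero_right]

theorem inner_lp_congr {v w : lp V 2} {f g : lp W 2} (h : ∀ i, ⟪v i, w i⟫_ℂ = ⟪f i, g i⟫_ℂ) :
    ⟪v, w⟫_ℂ = ⟪f, g⟫_ℂ := by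
  rw [lp.inner_eq_tsum, lp.inner_eq_tsum]
  exact tsum_congr h

end HilbertSum

theorem norm_lp_congr {ι : Type*} {V W : ι → Type*} [∀ i, NormedAddCommGroup (V i)]
    [∀ i, NormedAddCommGroup (W i)] {f : lp V 2} {g : lp W 2} (h : ∀ i, ‖f i‖ = ‖g i‖) :
    ‖f‖ = ‖g‖ :=
  le_antisymm (lp.norm_mono (by norm_num) fun i => (h i).le)
    (lp.norm_mono (by norm_num) fun i => (h i).ge)

theorem map_lp_single {ι : Type*} [DecidableEq ι] {V W : ι → Type*}
    [∀ i, NormedAddCommGroup (V i)] [∀ i, NormedAddCommGroup (W i)] (J : ∀ i, V i → W i) (hJ : ∀ i, J i 0 = 0) (i : ι) (v : V i)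
    (j : ι) : J j ((lp.single 2 i v : lp V 2) j) = (lp.single 2 i (J i v) : lp W 2) j := by
  rcases eq_or_ne j i with rfl | hne
  · rw [lp.single_apply_self, lp.single_apply_self]
  · rw [lp.single_apply_ne _ _ _ hne, lp.single_apply_ne _ _ _ hne, hJ]

theorem exists_const_norm_eq_one {X : Type*} [MeasurableSpace X] {μ : Measure X}
    [IsFiniteMeasure μ] (hμ : μ univ ≠ 0) :
    ∃ f : Lp ℂ 2 μ, ‖f‖ = 1 ∧ ∃ c : ℂ, f =ᵐ[μ] fun _ => c := by
  set one : Lp ℂ 2 μ := (memLp_const (1 : ℂ)).toLp _ with hone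
  have h1 : one =ᵐ[μ] fun _ => 1 := (memLp_const (1 : ℂ)).coeFn_toLp
  have h0 : one ≠ 0 := by
    intro h
    rw [Lp.eq_zero_iff_ae_eq_zero] at h
    have h2 : ∀ᵐ x ∂μ, False := by
      filter_upwards [h, h1] with x hx hx'
      rw [hx] at hx'
      exact zero_ne_one hx'
    rw [ae_iff] at h2
    exact hμ (by simpa using h2)
  refine ⟨((‖one‖ : ℂ)⁻¹) • one, norm_smul_inv_norm h0, (‖one‖ : ℂ)⁻¹, ?_⟩
  filter_upwards [Lp.coeFn_smul ((‖one‖ : ℂ)⁻¹) one, h1] with x hx hx'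
  rw [hx, Pi.smul_apply, hx', smul_eq_mul, mul_one]

theorem inner_eq_inner_fst {A B : Type*} [NormedAddCommGroup A] [InnerProductSpace ℂ A]
    [NormedAddCommGroup B] [InnerProductSpace ℂ B] (p : WithLp 2 (A × B)) {q : WithLp 2 (A × B)}
    (hq : q.snd = 0) : ⟪p, q⟫_ℂ = ⟪p.fst, q.fst⟫_ℂ := by
  rw [WithLp.prod_inner_apply]
  have h : q.ofLp.2 = 0 := hq
  rw [h, inner_zero_right, add_zero]
  rfl

namespace Domain

variable (P : Domain)

theorem param_mouth_nonempty (k : ℕ) (s : Side) : (P.param (.mouth k s)).Nonempty :=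
  nonempty_Ioo.2 (reach_pos (P.δ_pos k).le (P.δ_lt_roomSide_mouthRoom k s))

theorem volume_cell_mouth_ne_zero (k : ℕ) (s : Side) : volume (P.cell (.mouth k s)) ≠ 0 :=
  (P.volume_cell_pos (P.param_mouth_nonempty k s)).ne'

theorem mouth_injective (s : Side) : Function.Injective fun k => Edge.mouth k s := by
  intro k l h
  simpa using h

/-! ### The operator on the skeleton -/

theorem singPart_le_nullSpace : P.singPart ≤ nullSpace P.HGamma := by
  intro f hf
  have hmem : ∀ e, (WithLp.toLp 2 ((f e).1, 0) :
      WithLp 2 (Lp ℂ 2 (P.muAlpha e) × Lp ℂ 2 (P.muBeta e))) ∈ P.edgeH1 e := by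
    intro e
    by_cases he : e.IsSing
    · exact ⟨(f e).2, fun _ => rfl, fun h => absurd he h⟩
    · rw [hf e he]
      exact (P.edgeH1 e).zero_mem
  have hn : ∀ e, ‖(⟨_, hmem e⟩ : P.edgeH1 e)‖ ≤ ‖f e‖ := fun e =>
    (WithLp.norm_toLp_fst 2 (Lp ℂ 2 (P.muAlpha e)) (Lp ℂ 2 (P.muBeta e)) (f e).1).le
  set v : P.H1Gamma := ⟨fun e => ⟨_, hmem e⟩, (lp.memℓp f).mono' hn⟩ with hv
  have hJ : P.EGamma v = f := rfl
  rw [← hJ]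
  refine mem_nullSpace_formOperator P.denseRange_EGamma fun w => inner_lp_congr fun e => ?_
  exact inner_eq_inner_fst (w e).1 rfl

theorem exists_orthonormal_singPart :
    ∃ u : ℕ → P.L2Gamma, Orthonormal ℂ u ∧ ∀ n, u n ∈ P.singPart := by
  classical
  have h : ∀ k, ∃ f : P.edgeL2 (.mouth k .right), ‖f‖ = 1 := by
    intro k
    obtain ⟨f, hf, hc⟩ := exists_const_norm_eq_one (μ := P.muAlpha (.mouth k .right))
      (by rw [P.muAlpha_univ]; exact P.volume_cell_mouth_ne_zero k .right)
    exact ⟨⟨f, fun _ => hc⟩, hf⟩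
  choose x hx using h
  refine ⟨_, orthonormal_lp_single (V := fun e => P.edgeL2 e) (mouth_injective .right) hx,
    fun n e he => ?_⟩
  refine lp.single_apply_ne _ _ _ ?_
  rintro rfl
  exact he trivial

theorem not_isCompactOperator_resolvent :
    ¬ IsCompactOperator (P.EGamma ∘L rieszAdjoint P.EGamma) := by
  obtain ⟨u, hu, hs⟩ := P.exists_orthonormal_singPart
  have hR := isInverseOfAddOne_formOperator P.denseRange_EGamma
  refine not_isCompactOperator_of_orthonormal (x := u) (M := 1) (fun n => (hu.1 n).le) ?_
  convert hu using 2 with n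
  obtain ⟨w, hw, hw'⟩ := P.singPart_le_nullSpace (hs n)
  have h1 : P.HGamma w = 0 := hw
  have h2 : (w : P.L2Gamma) = u n := hw'
  have h3 := hR.1 w
  rw [show formOperator P.EGamma w = 0 from h1, zero_add, h2] at h3
  exact h3

/-! ### The operator on the domain -/

theorem exists_H1_const (k : ℕ) : ∃ q : H1 (P.cell (.mouth k .right)),
    ‖H1.toL2 (P.cell (.mouth k .right)) q‖ = 1 ∧ ‖q‖ ≤ 1 ∧ q.1.snd = 0 := by
  obtain ⟨f, hf, c, hc⟩ := exists_const_norm_eq_one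
    (μ := volume.restrict (P.cell (.mouth k .right)))
    (by rw [Measure.restrict_apply_univ]; exact P.volume_cell_mouth_ne_zero k .right)
  refine ⟨⟨WithLp.toLp 2 (f, 0), mem_H1_of_const hc rfl⟩, hf, ?_, rfl⟩
  rw [← hf]
  exact (WithLp.norm_toLp_fst 2 (L2 (P.cell (.mouth k .right)))
    (PiLp 2 fun _ : Fin 2 => L2 (P.cell (.mouth k .right))) f).le

theorem exists_null_H1Omega : ∃ v : ℕ → P.H1Omega, (∀ n, ‖v n‖ ≤ 1) ∧
    (Orthonormal ℂ fun n => P.E1 (v n)) ∧ ∀ n, P.E1 (v n) ∈ nullSpace P.HOmega := by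
  classical
  choose q hq hq' hq'' using P.exists_H1_const
  set v : ℕ → P.H1Omega := fun n =>
    lp.single (E := fun e : Edge => H1 (P.cell e)) 2 (Edge.mouth n .right) (q n) with hv
  have hs : ∀ n, P.E1 (v n) = lp.single (E := fun e : Edge => L2 (P.cell e)) 2
      (Edge.mouth n .right) (H1.toL2 _ (q n)) := fun n =>
    lp.ext (funext fun e => map_lp_single (V := fun e : Edge => H1 (P.cell e))
      (W := fun e : Edge => L2 (P.cell e)) (fun e => H1.toL2 (P.cell e))
      (fun e => map_zero _) (.mouth n .right) (q n) e)
  have ho := orthonormal_lp_single (V := fun e : Edge => L2 (P.cell e))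
    (mouth_injective .right) hq
  refine ⟨v, fun n => ?_, ?_, fun n => ?_⟩
  · exact (lp.norm_single (by norm_num) _ _).trans_le (hq' n)
  · simp only [hs]
    exact ho
  · have h := mem_nullSpace_formOperator (V := P.H1Omega) (H := P.L2Omega) (J := P.E1)
      (v := v n)
      (by with_reducible_and_instances exact P.denseRange_E1)
    refine h fun w => inner_lp_congr (V := fun e : Edge => H1 (P.cell e))
      (W := fun e : Edge => L2 (P.cell e)) fun e => ?_
    refine inner_eq_inner_fst (w e).1 ?_
    rcases eq_or_ne e (.mouth n .right) with rfl | hne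
    · rw [hv, lp.single_apply_self]
      exact hq'' n
    · rw [hv, lp.single_apply_ne _ _ _ hne]
      rfl

theorem not_isCompactOperator_E1 : ¬ IsCompactOperator P.E1 := by
  obtain ⟨v, hv, hv', -⟩ := P.exists_null_H1Omega
  have h := not_isCompactOperator_of_orthonormal (V := P.H1Omega) (H := P.L2Omega) (C := P.E1)
    (x := v) hv
  exact h hv'

theorem zero_mem_essSpectrum_HOmega : (0 : ℂ) ∈ essSpectrum P.HOmega := by
  obtain ⟨v, -, hv, hv'⟩ := P.exists_null_H1Omega
  exact zero_mem_essSpectrum (H := P.L2Omega) hv hv'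

/-! ### Comparison of the two operators -/

theorem fst_ae_eq_of_isT1 {T₁ : P.H1Gamma →L[ℂ] P.H1Omega} (hT : P.IsT1 T₁) (f : P.H1Gamma)
    (e : Edge) : (T₁ f e).1.fst =ᵐ[volume.restrict (P.cell e)]
      fun x => (f e).1.fst (P.edgeCoord e x) := by
  have hm : ∀ᵐ x ∂(volume.restrict (P.cell e)), x ∈ (P.fanPair e).openPart := by
    rw [P.restrict_cell]
    exact ae_restrict_mem (P.fanPair e).isOpen_openPart.measurableSet
  filter_upwards [hT f e, P.edgeCoord_eq e, hm] with x h1 h2 h3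
  obtain ⟨u, hu, hut⟩ := ((P.fanPair e).openPart_subset h3).2
  rw [h1 u hu hut, h2 u hu hut]

theorem exists_isT1_adjoint :
    ∃ (T₁ : P.H1Gamma →L[ℂ] P.H1Omega) (T₁' : P.H1Omega →L[ℂ] P.H1Gamma),
      P.IsT1 T₁ ∧ ∀ f g, ⟪T₁ f, g⟫_ℂ = ⟪f, T₁' g⟫_ℂ := by
  obtain ⟨T₁, hT⟩ := P.exists_isT1
  have h := inner_rieszAdjoint_right (V := P.H1Gamma) (H := P.H1Omega) T₁
  refine ⟨T₁, rieszAdjoint (V := P.H1Gamma) (H := P.H1Omega) T₁, hT, fun f g => ?_⟩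
  with_reducible exact (h f g).symm

theorem essSpectrum_HOmega_subset {T₁ : P.H1Gamma →L[ℂ] P.H1Omega}
    {T₁' : P.H1Omega →L[ℂ] P.H1Gamma} (hT : P.IsT1 T₁)
    (hadj : ∀ f g, ⟪T₁ f, g⟫_ℂ = ⟪f, T₁' g⟫_ℂ)
    (hC : IsCompactOperator (P.E1 ∘L (T₁ ∘L T₁' - ContinuousLinearMap.id ℂ P.H1Omega))) :
    essSpectrum P.HOmega ⊆ essSpectrum P.HGamma := by
  have hn : ∀ f, ‖P.E1 (T₁ f)‖ = ‖P.EGamma f‖ := fun f =>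
    norm_lp_congr (V := fun e : Edge => L2 (P.cell e)) (W := fun e => P.edgeL2 e)
      fun e => P.norm_eq_of_ae_eq_comp e (P.fst_ae_eq_of_isT1 hT f e)
  unfold HOmega HGamma
  have h := essSpectrum_formOperator_subset (V := P.H1Omega) (H := P.L2Omega) (W := P.H1Gamma)
    (G := P.L2Gamma) (J := P.E1) (K := P.EGamma) (T := T₁) (T' := T₁')
  with_reducible_and_instances
    exact h P.denseRange_E1 P.denseRange_EGamma hadj hn hC

end Domain

end RP

end

theorem theorem5p9 (P : RP.Domain) :
    -- (1)
    ((∃ R : P.L2Gamma →L[ℂ] P.L2Gamma,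
        RP.IsInverseOfAddOne P.HGamma R ∧ ¬ IsCompactOperator R) ∧
      (0 : ℂ) ∈ RP.essSpectrum P.HGamma ∧
      ¬ FiniteDimensional ℂ (RP.nullSpace P.HGamma) ∧
      P.singPart ≤ RP.nullSpace P.HGamma ∧ ¬ FiniteDimensional ℂ P.singPart) ∧
    -- (2)
    (¬ IsCompactOperator P.E1 ∧ (0 : ℂ) ∈ RP.essSpectrum P.HOmega) ∧
    -- (3): `T₁` and its adjoint exist as bounded operators, and the inclusion holds
    ((∃ (T₁ : P.H1Gamma →L[ℂ] P.H1Omega) (T₁' : P.H1Omega →L[ℂ] P.H1Gamma),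
        P.IsT1 T₁ ∧ ∀ f g, ⟪T₁ f, g⟫_ℂ = ⟪f, T₁' g⟫_ℂ) ∧
      ∀ (T₁ : P.H1Gamma →L[ℂ] P.H1Omega) (T₁' : P.H1Omega →L[ℂ] P.H1Gamma),
        P.IsT1 T₁ → (∀ f g, ⟪T₁ f, g⟫_ℂ = ⟪f, T₁' g⟫_ℂ) →
        IsCompactOperator (P.E1 ∘L (T₁ ∘L T₁' - ContinuousLinearMap.id ℂ P.H1Omega)) →
        RP.essSpectrum P.HOmega ⊆ RP.essSpectrum P.HGamma) := by
  obtain ⟨u, hu, hs⟩ := P.exists_orthonormal_singPart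
  have hn : ∀ n, u n ∈ RP.nullSpace P.HGamma := fun n => P.singPart_le_nullSpace (hs n)
  exact ⟨⟨⟨P.EGamma ∘L RP.rieszAdjoint P.EGamma,
      RP.isInverseOfAddOne_formOperator P.denseRange_EGamma,
      P.not_isCompactOperator_resolvent⟩, RP.zero_mem_essSpectrum hu hn,
      RP.not_finiteDimensional_of_orthonormal hu hn, P.singPart_le_nullSpace,
      RP.not_finiteDimensional_of_orthonormal hu hs⟩,
    ⟨P.not_isCompactOperator_E1, P.zero_mem_essSpectrum_HOmega⟩, P.exists_isT1_adjoint,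
    fun _ _ hT hadj hC => P.essSpectrum_HOmega_subset hT hadj hC⟩
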